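/- Let $\Omega$ be a smooth connected manifold (Hausdorff, second countable) of dimension $n\ge 2$, for example a domain of $\mathbb R^n$, and let $\nu$ be a positive measure on $\Omega$ whose density with respect to Lebesgue measure in local coordinates is locally bounded and locally bounded away from $0$. Consider the symmetric operator $$Pu=-\operatorname{div}(A\nabla u)+cu,$$ where $-\operatorname{div}$ is the formal adjoint of the gradient with respect to $\nu$, the coefficients $A$ and $c$ are real, measurable and locally bounded, and $A(x)$ is symmetric, positive definite and locally uniformly elliptic. Let $$q(u)=\int_\Omega\big(\langle A\nabla u,\nabla u\rangle+cu^2\big)\,d\nu,\qquad u\in C_0^\infty(\Omega).$$ Let $W:\Omega\to(0,\infty)$ be measurable and locally bounded, and assume that for some $\lambda>0$ the Hardy inequality $$\lambda\int_\Omega Wu^2\,d\nu\le q(u),\qquad \forall u\in C_0^\infty(\Omega),$$ holds. Let $\lambda_\infty\in[0,\infty]$ be the best constant at infinity, that is, the supremum of all $\alpha\ge 0$ for which there is a compact set $K\subset\Omega$ with $\alpha\int_{\Omega\setminus K}Wu^2\,d\nu\le q(u)$ for all $u\in C_0^\infty(\Omega\setminus K)$. Let $\varphi\in W^{1,2}_{loc}(\Omega)$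 be a positive weak solution of $P\varphi=0$ in $\Omega$, and put $d\mu=\varphi^2W\,d\nu$. Let $\rho$ be the distance of the Agmon metric $|\xi|_{Ag}^2=W\langle A^{-1}\xi,\xi\rangle$ (the infimum of the Agmon lengths of $C^1$ paths), fix $x_0\in\Omega$, and let $B_{Ag}(x_0,r)=\{x:\rho(x_0,x)<r\}$. Put $V(r)=\mu(B_{Ag}(x_0,r))$ if $\mu(\Omega)=\infty$, and $V(r)=\mu(\Omega\setminus B_{Ag}(x_0,r))^{-1}$ if $\mu(\Omega)<\infty$ (with $0^{-1}=\infty$), and let $$\sigma=\limsup_{r\to\infty}\frac1r\log V(r)\in[0,\infty].$$ Assume that the Agmon metric is complete, i.e. every $\rho$-Cauchy sequence converges to a point of $\Omega$ in the topology of $\Omega$. Then $$\lambda_\infty\le\frac{\sigma^2}{4}.$$ -/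

import Mathlib

open Set Filter Topology MeasureTheory Manifold
open scoped ENNReal NNReal ContDiff

noncomputable section

namespace AgmonBrooks

/-- The Euclidean space `ℝⁿ` on which the manifolds are modelled. -/
abbrev Eucl (n : ℕ) : Type := EuclideanSpace ℝ (Fin n)

section Pointwise

variable (n : ℕ) {M : Type*} [TopologicalSpace M] [ChartedSpace (Eucl n) M]

/-- The cotangent space `T*ₓM`. -/
abbrev Cotangent (x : M) : Type := TangentSpace (𝓡 n) x →L[ℝ] ℝ

/-- The differential `du(x) ∈ T*ₓM` of a real function `u`. -/
def diff (u : M → ℝ) (x : M) : Cotangent n x := mfderiv (𝓡 n) 𝓘(ℝ, ℝ) u x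

/-- The differential at `x` of the preferred chart around `x₀`, a linear map `TₓM → ℝⁿ`. -/
def chartDeriv (x₀ x : M) : TangentSpace (𝓡 n) x →L[ℝ] Eucl n :=
  mfderiv (𝓡 n) (𝓡 n) (chartAt (Eucl n) x₀) x

/-- The differential at `y` of the inverse of the preferred chart around `x₀`, a linear map from
`ℝⁿ` to the tangent space at the point with coordinates `y`. -/
def chartSymmDeriv (x₀ : M) (y : Eucl n) :
    Eucl n →L[ℝ] TangentSpace (𝓡 n) ((chartAt (Eucl n) x₀).symm y) :=
  mfderiv (𝓡 n) (𝓡 n) (chartAt (Eucl n) x₀).symm y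

end Pointwise

/-- `C₀^∞(U)` for a subset `U` of the manifold `M`: the smooth functions on `M` with compact
support contained in `U`. -/
def IsTestFunction (n : ℕ) {M : Type*} [TopologicalSpace M] [ChartedSpace (Eucl n) M]
    (U : Set M) (u : M → ℝ) : Prop :=
  ContMDiff (𝓡 n) 𝓘(ℝ, ℝ) ∞ u ∧ HasCompactSupport u ∧ tsupport u ⊆ U

/-- A real function that is bounded near every point. -/
def LocallyBounded {M : Type*} [TopologicalSpace M] (f : M → ℝ) : Prop :=
  ∀ x : M, ∃ C : ℝ, ∀ᶠ y in 𝓝 x, |f y| ≤ C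

/-- A positive measure with a locally bounded and locally uniformly positive density: near every
point, and in local coordinates, it is comparable with Lebesgue measure. -/
def HasLocallyBoundedDensity (n : ℕ) {M : Type*} [TopologicalSpace M]
    [ChartedSpace (Eucl n) M] [MeasurableSpace M] (ν : Measure M) : Prop :=
  ∀ x₀ : M, ∃ C : ℝ≥0, ∃ U ∈ 𝓝 x₀, U ⊆ (chartAt (Eucl n) x₀).source ∧
    ∀ S ⊆ U, MeasurableSet S →
      ν S ≤ C * volume (chartAt (Eucl n) x₀ '' S) ∧
      volume (chartAt (Eucl n) x₀ '' S) ≤ C * ν S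

/-- A field of coefficients `A(x) : T*ₓM → TₓM` (for a domain of `ℝⁿ`: a matrix field), given
together with the inverse maps `A(x)⁻¹ : TₓM → T*ₓM`. -/
abbrev CoeffField (n : ℕ) (M : Type*) [TopologicalSpace M] [ChartedSpace (Eucl n) M] :=
  ∀ x : M, Cotangent n x ≃L[ℝ] TangentSpace (𝓡 n) x

/-- The conditions on the principal part of the operator: `A` is measurable, symmetric, positive
definite, locally bounded and locally uniformly elliptic. Here `⟨ξ, A η⟩ = ξ (A η)`. -/
structure IsEllipticField (n : ℕ) {M : Type*} [TopologicalSpace M] [ChartedSpace (Eucl n) M]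
    [MeasurableSpace M] (A : CoeffField n M) : Prop where
  measurable : ∀ u v : M → ℝ, ContMDiff (𝓡 n) 𝓘(ℝ, ℝ) ∞ u → ContMDiff (𝓡 n) 𝓘(ℝ, ℝ) ∞ v →
    Measurable fun x => diff n u x (A x (diff n v x))
  symm : ∀ (x : M) (ξ η : Cotangent n x), ξ (A x η) = η (A x ξ)
  pos : ∀ (x : M) (ξ : Cotangent n x), ξ ≠ 0 → 0 < ξ (A x ξ)
  /-- Local boundedness and local uniform ellipticity, in local coordinates: the covector with
  constant coordinates `η` in the chart around `x₀` is `η ∘ d(chart)`. -/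
  bounds : ∀ x₀ : M, ∃ C : ℝ, 0 < C ∧ ∀ᶠ x in 𝓝 x₀, ∀ η : Eucl n →L[ℝ] ℝ,
    C⁻¹ * ‖η‖ ^ 2 ≤ (η.comp (chartDeriv n x₀ x)) (A x (η.comp (chartDeriv n x₀ x))) ∧
    (η.comp (chartDeriv n x₀ x)) (A x (η.comp (chartDeriv n x₀ x))) ≤ C * ‖η‖ ^ 2

/-- The field of covectors `G` is the weak differential of `f`, and `f ∈ W^{1,2}_loc(M)`: in each
preferred chart, `f` and `G` are square integrable on compact sets, and
`∫ f ∂ᵥψ = - ∫ G(v) ψ` for all `v ∈ ℝⁿ` and all test functions `ψ` on the range of the chart. -/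
def IsSobolevWithDiff (n : ℕ) {M : Type*} [TopologicalSpace M] [ChartedSpace (Eucl n) M]
    (f : M → ℝ) (G : ∀ x : M, Cotangent n x) : Prop :=
  ∀ x₀ : M,
    (∀ K ⊆ (chartAt (Eucl n) x₀).target, IsCompact K →
      MemLp (fun y => f ((chartAt (Eucl n) x₀).symm y)) 2 (volume.restrict K) ∧
      ∀ v : Eucl n, MemLp (fun y => G ((chartAt (Eucl n) x₀).symm y) (chartSymmDeriv n x₀ y v)) 2
        (volume.restrict K)) ∧
    ∀ ψ : Eucl n → ℝ, ContDiff ℝ ∞ ψ → HasCompactSupport ψ →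
      tsupport ψ ⊆ (chartAt (Eucl n) x₀).target → ∀ v : Eucl n,
        ∫ y, f ((chartAt (Eucl n) x₀).symm y) * fderiv ℝ ψ y v =
          -∫ y, G ((chartAt (Eucl n) x₀).symm y) (chartSymmDeriv n x₀ y v) * ψ y

section Operator

variable (n : ℕ) {M : Type*} [TopologicalSpace M] [ChartedSpace (Eucl n) M] [MeasurableSpace M]

/-- The quadratic form `q(u) = ∫ (⟨A∇u, ∇u⟩ + c u²) dν` of `P = -div(A∇·) + c`, where `-div` is
the formal adjoint of the gradient with respect to `ν`. -/
def quadForm (ν : Measure M) (A : CoeffField n M) (c : M → ℝ) (u : M → ℝ) : ℝ :=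
  ∫ x, (diff n u x (A x (diff n u x)) + c x * u x ^ 2) ∂ν

/-- `φ ∈ W^{1,2}_loc(M)` is a weak solution of `Pφ = 0`. -/
def IsWeakSolution (ν : Measure M) (A : CoeffField n M) (c : M → ℝ) (φ : M → ℝ) : Prop :=
  ∃ G : ∀ x : M, Cotangent n x, IsSobolevWithDiff n φ G ∧
    ∀ ψ : M → ℝ, IsTestFunction n univ ψ →
      ∫ x, (diff n ψ x (A x (G x)) + c x * φ x * ψ x) ∂ν = 0

/-- The Hardy inequality `lam ∫ W u² dν ≤ q(u)` for all `u ∈ C₀^∞(M)`. -/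
def HardyInequality (ν : Measure M) (A : CoeffField n M) (c W : M → ℝ) (lam : ℝ) : Prop :=
  ∀ u : M → ℝ, IsTestFunction n univ u → lam * ∫ x, W x * u x ^ 2 ∂ν ≤ quadForm n ν A c u

/-- The best constant at infinity `λ_∞ ∈ [0, ∞]`: the supremum of all `α ≥ 0` for which there is
a compact set `K` with `α ∫_{M∖K} W u² dν ≤ q(u)` for all `u ∈ C₀^∞(M∖K)`. -/
def bestConstAtInfinity (ν : Measure M) (A : CoeffField n M) (c W : M → ℝ) : ℝ≥0∞ :=
  sSup {a : ℝ≥0∞ | ∃ α : ℝ≥0, a = α ∧ ∃ K : Set M, IsCompact K ∧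
    ∀ u : M → ℝ, IsTestFunction n Kᶜ u →
      (α : ℝ) * ∫ x in Kᶜ, W x * u x ^ 2 ∂ν ≤ quadForm n ν A c u}

end Operator

section Agmon

variable {n : ℕ} {M : Type*} [TopologicalSpace M] [ChartedSpace (Eucl n) M]

/-- The length `(W ⟨A⁻¹v, v⟩)^{1/2}` of a tangent vector in the Agmon metric. -/
def agmonNorm (A : CoeffField n M) (W : M → ℝ) (x : M) (v : TangentSpace (𝓡 n) x) : ℝ :=
  √(W x * (A x).symm v v)

/-- The Agmon distance: the infimum of the Agmon lengths of the `C¹` paths joining two points. -/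
def agmonEDist (A : CoeffField n M) (W : M → ℝ) (x y : M) : ℝ≥0∞ :=
  letI : ∀ z : M, ENorm (TangentSpace (𝓡 n) z) :=
    fun z => ⟨fun v => ENNReal.ofReal (agmonNorm A W z v)⟩
  Manifold.riemannianEDist (𝓡 n) x y

/-- The ball of centre `x₀` and radius `r` for the Agmon distance. -/
def agmonBall (A : CoeffField n M) (W : M → ℝ) (x₀ : M) (r : ℝ) : Set M :=
  {x | agmonEDist A W x₀ x < ENNReal.ofReal r}

/-- Completeness of the Agmon metric: every Cauchy sequence for the Agmon distance converges in
`M`. When `W` is locally bounded and locally bounded from below by positive constants, the Agmon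
distance induces the topology of `M`, so that convergence can be understood in either sense. -/
def AgmonComplete (A : CoeffField n M) (W : M → ℝ) : Prop :=
  ∀ s : ℕ → M,
    (∀ ε : ℝ≥0∞, 0 < ε → ∃ N : ℕ, ∀ k ≥ N, ∀ l ≥ N, agmonEDist A W (s k) (s l) < ε) →
    ∃ x : M, Tendsto s atTop (𝓝 x)

variable [MeasurableSpace M]

/-- The measure `μ = φ² W ν`. -/
def groundMeasure (ν : Measure M) (W φ : M → ℝ) : Measure M :=
  ν.withDensity fun x => ENNReal.ofReal (φ x ^ 2 * W x)

open Classical in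
/-- `V(r)`: the `μ`-volume of the Agmon ball of radius `r` if `μ` is infinite, and the inverse of
the `μ`-volume of its complement if `μ` is finite. -/
def volumeFunction (A : CoeffField n M) (W : M → ℝ) (μ : Measure M) (x₀ : M) (r : ℝ) : ℝ≥0∞ :=
  if μ univ = ⊤ then μ (agmonBall A W x₀ r) else (μ (agmonBall A W x₀ r)ᶜ)⁻¹

/-- The exponential rate `σ = limsup_{r → ∞} (1/r) log V(r)`, an extended real number. -/
def expRate (A : CoeffField n M) (W : M → ℝ) (μ : Measure M) (x₀ : M) : EReal :=
  limsup (fun r : ℝ => ((r⁻¹ : ℝ) : EReal) * ENNReal.log (volumeFunction A W μ x₀ r)) atTop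

end Agmon

end AgmonBrooks

end

/-! Write a function supported off a compact set `K` as `φ v`. Expanding `q(φ v)` and subtracting
the weak equation for `φ` tested against `φ v²` cancels `c` and every term containing the
differential of `φ`, and leaves `∫ φ² ⟨A∇v, ∇v⟩ dν`. A Hardy inequality off `K` with constant `α`
thus becomes `α ∫ v² dμ ≤ ∫ φ² ⟨A∇v, ∇v⟩ dν` for Lipschitz `v` with compact support off `K`
(`integral_le_of_hardy`).

Now take `v = f ∘ ρ`, with `ρ` the Agmon distance to a point. The metric is made so that `⟨A∇ρ, ∇ρ⟩
≤ W` almost everywhere (`ae_diff_agmonEDist_le`), so the right side is at most `∫ f'(ρ)² dμ`.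
Pushing `μ` forward by `ρ` to a measure `m` on the line gives `α ∫ f² dm ≤ ∫ f'² dm` for `f`
supported in a half-line `(R₀, ∞)` (`integral_map_agmonDist_le`). Completeness enters through
Hopf–Rinow (`isCompact_agmonEDist_le`): closed balls are compact, so `f ∘ ρ` has compact support and
`m` is finite on left half-lines.

What remains is Brooks' argument on the line. If `|l'| ≤ (s/2) l` and `s²/4 < α`, the right side is
absorbed into the left, and `∫ l² dm` over a tail is bounded by a constant that depends on `l` only
through its size near the left end (`integral_sq_le_of_deriv_le`). When the mass is infinite, `l` is
a plateau up to `j` followed by the decay `e^{-st/2}`, and `j → ∞` shows that the mass is finite.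
When the mass is finite, `l` is `e^{st/2}` up to `j` followed by a plateau, and the tails decay like
`e^{-sj}`, too fast for the given rate. Either way a contradiction results as soon as `|σ| < s <
2√α`.

The bulk of the work is regularity: `A` is only measurable, `φ` only Sobolev, `ρ` only locally
Lipschitz. Products `φ v` are approximated in energy by test functions (`exists_isApprox`), by
mollification in charts and a partition of unity. The eikonal inequality is obtained from Lebesgue's
differentiation theorem along lines. -/

noncomputable section

open scoped Convolution

set_option linter.unusedSectionVars false
set_option linter.style.haveILetI false

namespace AgmonBrooks

/-! ### Mollification in `L²`. -/

section Mollification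

variable {E : Type*} [NormedAddCommGroup E] [NormedSpace ℝ E] [FiniteDimensional ℝ E]
  [MeasurableSpace E] [BorelSpace E] {μ : Measure E} [μ.IsAddHaarMeasure]

open ContinuousLinearMap in
/-- Convolution with a normalized bump function is a contraction of `L²`. -/
theorem eLpNorm_normed_convolution_le (η : ContDiffBump (0 : E)) {f : E → ℝ}
    (hf : AEStronglyMeasurable f μ) :
    eLpNorm (η.normed μ ⋆[lsmul ℝ ℝ, μ] f) 2 μ ≤ eLpNorm f 2 μ := by
  wlog hfm : StronglyMeasurable f generalizing f
  · rw [eLpNorm_congr_ae hf.ae_eq_mk,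
      convolution_congr (lsmul ℝ ℝ) (ae_eq_refl _) hf.ae_eq_mk]
    exact this hf.stronglyMeasurable_mk.aestronglyMeasurable hf.stronglyMeasurable_mk
  have hη : Measurable fun t => ENNReal.ofReal (η.normed μ t) :=
    η.continuous_normed.measurable.ennreal_ofReal
  set κ : Measure E := μ.withDensity fun t => ENNReal.ofReal (η.normed μ t) with hκ
  have hκ1 : IsProbabilityMeasure κ := by
    constructor
    rw [hκ, withDensity_apply _ MeasurableSet.univ, Measure.restrict_univ,
      ← ofReal_integral_eq_lintegral_ofReal η.integrable_normed
        (Eventually.of_forall η.nonneg_normed), η.integral_normed, ENNReal.ofReal_one]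
  have hfme : Measurable f := hfm.measurable
  -- Jensen's inequality: `κ` is the probability measure whose density is the bump, so the `L¹` norm
  -- of `t ↦ f (x - t)` is at most its `L²` norm. Tonelli and translation invariance then finish.
  have key : ∀ x, ‖(η.normed μ ⋆[lsmul ℝ ℝ, μ] f) x‖ₑ ^ 2 ≤ ∫⁻ t, ‖f (x - t)‖ₑ ^ 2 ∂κ := by
    intro x
    have hm : Measurable fun t => f (x - t) := hfme.comp (measurable_const.sub measurable_id)
    have h1 : ‖(η.normed μ ⋆[lsmul ℝ ℝ, μ] f) x‖ₑ ≤ ∫⁻ t, ‖f (x - t)‖ₑ ∂κ := by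
      rw [convolution_def]
      refine (enorm_integral_le_lintegral_enorm _).trans ?_
      rw [hκ, lintegral_withDensity_eq_lintegral_mul _ hη hm.enorm]
      refine lintegral_mono fun t => ?_
      simp only [lsmul_apply, smul_eq_mul, Pi.mul_apply, enorm_mul]
      rw [Real.enorm_of_nonneg (η.nonneg_normed t)]
    have h2 := eLpNorm_le_eLpNorm_of_exponent_le (p := 1) (q := 2) (μ := κ)
      (f := fun t => f (x - t)) (by norm_num) hm.aestronglyMeasurable
    rw [eLpNorm_one_eq_lintegral_enorm] at h2
    calc _ ≤ (eLpNorm (fun t => f (x - t)) 2 κ) ^ 2 := by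
          gcongr; exact h1.trans h2
      _ = _ := by
          have := eLpNorm_nnreal_pow_eq_lintegral (p := 2) (μ := κ) (f := fun t => f (x - t))
            (by norm_num)
          norm_num at this
          exact_mod_cast this
  have e2 : ∀ g : E → ℝ, eLpNorm g 2 μ ^ 2 = ∫⁻ x, ‖g x‖ₑ ^ 2 ∂μ := by
    intro g
    have := eLpNorm_nnreal_pow_eq_lintegral (p := 2) (μ := μ) (f := g) (by norm_num)
    norm_num at this
    exact_mod_cast this
  rw [← ENNReal.pow_le_pow_left_iff (n := 2) two_ne_zero, e2, e2]
  calc _ ≤ ∫⁻ x, ∫⁻ t, ‖f (x - t)‖ₑ ^ 2 ∂κ ∂μ := lintegral_mono key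
    _ = ∫⁻ t, ∫⁻ x, ‖f (x - t)‖ₑ ^ 2 ∂μ ∂κ := by
        rw [lintegral_lintegral_swap]
        exact ((hfme.comp (measurable_fst.sub measurable_snd)).enorm.pow_const 2).aemeasurable
    _ = ∫⁻ _, ∫⁻ x, ‖f x‖ₑ ^ 2 ∂μ ∂κ := by
        congr with t
        exact lintegral_sub_right_eq_self (fun x => ‖f x‖ₑ ^ 2) t
    _ = _ := by simp

open ContinuousLinearMap in
/-- Mollification converges in `L²`. -/
theorem tendsto_eLpNorm_normed_convolution_sub {η : ℕ → ContDiffBump (0 : E)}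
    (hη : Tendsto (fun k => (η k).rOut) atTop (𝓝 0)) {f : E → ℝ} (hf : MemLp f 2 μ) :
    Tendsto (fun k => eLpNorm ((η k).normed μ ⋆[lsmul ℝ ℝ, μ] f - f) 2 μ) atTop (𝓝 0) := by
  rw [ENNReal.tendsto_nhds_zero]
  intro ε hε
  obtain ⟨δ, hδ, hδε⟩ : ∃ δ : ℝ≥0∞, δ ≠ 0 ∧ δ + δ + δ ≤ ε :=
    ⟨ε / 3, (ENNReal.div_pos hε.ne' (by simp)).ne', (ENNReal.add_thirds ε).le⟩
  obtain ⟨g, hgs, hfg, hgc, hgm⟩ :=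
    hf.exists_hasCompactSupport_eLpNorm_sub_le (by norm_num) hδ
  have hK : IsCompact (Metric.cthickening 1 (tsupport g)) := IsCompact.cthickening hgs
  -- `c` is so small that a function bounded by `c` and vanishing off the unit thickening of the
  -- support of `g` has `L²` norm below `δ`. The uniform continuity of `g` puts the error of its
  -- mollification in this form.
  obtain ⟨c, hc, hcδ⟩ := ENNReal.exists_nnreal_pos_mul_lt
    (a := μ (Metric.cthickening 1 (tsupport g)) ^ (1 / (2 : ℝ≥0∞).toReal)) (b := δ)
    (ENNReal.rpow_ne_top_of_nonneg (by positivity) hK.measure_lt_top.ne) hδ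
  obtain ⟨r, hr, hgr⟩ := Metric.uniformContinuous_iff.1
    (hgs.uniformContinuous_of_continuous hgc) c (by exact_mod_cast hc)
  have hev : ∀ᶠ k in atTop, (η k).rOut < min r 1 :=
    hη.eventually (gt_mem_nhds (lt_min hr one_pos))
  filter_upwards [hev] with k hk
  have hfl : LocallyIntegrable f μ := hf.locallyIntegrable (by norm_num)
  have hgl : LocallyIntegrable g μ := hgc.locallyIntegrable
  have hex : ∀ u : E → ℝ, LocallyIntegrable u μ →
      ConvolutionExists ((η k).normed μ) u (lsmul ℝ ℝ) μ := fun u hu =>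
    (η k).hasCompactSupport_normed.convolutionExists_left _ (η k).continuous_normed hu
  have hdec : (η k).normed μ ⋆[lsmul ℝ ℝ, μ] f - f =
      ((η k).normed μ ⋆[lsmul ℝ ℝ, μ] (f - g)) +
        ((η k).normed μ ⋆[lsmul ℝ ℝ, μ] g - g) + (g - f) := by
    have h := (hex (f - g) (hfl.sub hgl)).distrib_add (hex g hgl)
    rw [sub_add_cancel] at h
    rw [h]
    abel
  have hconvm : ∀ u : E → ℝ, LocallyIntegrable u μ →
      AEStronglyMeasurable ((η k).normed μ ⋆[lsmul ℝ ℝ, μ] u) μ := fun u hu =>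
    ((η k).hasCompactSupport_normed.continuous_convolution_left _
      (η k).continuous_normed hu).aestronglyMeasurable
  have h1 : eLpNorm ((η k).normed μ ⋆[lsmul ℝ ℝ, μ] (f - g)) 2 μ ≤ δ :=
    (eLpNorm_normed_convolution_le _ (hf.1.sub hgm.1)).trans hfg
  have h3 : eLpNorm (g - f) 2 μ ≤ δ := by rwa [eLpNorm_sub_comm]
  have h2 : eLpNorm ((η k).normed μ ⋆[lsmul ℝ ℝ, μ] g - g) 2 μ ≤ δ := by
    have hb : ∀ x, ‖((η k).normed μ ⋆[lsmul ℝ ℝ, μ] g - g) x‖ ≤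
        ‖(Metric.cthickening 1 (tsupport g)).indicator (fun _ => (c : ℝ)) x‖ := by
      intro x
      by_cases hx : x ∈ Metric.cthickening 1 (tsupport g)
      · rw [indicator_of_mem hx, Pi.sub_apply, ← dist_eq_norm]
        have := (η k).dist_normed_convolution_le (μ := μ) (x₀ := x) hgm.1 (ε := c)
          (fun y hy => (hgr ((Metric.mem_ball.1 hy).trans
            (hk.trans_le (min_le_left _ _)))).le)
        simpa using this
      · have hz : ∀ y ∈ Metric.ball x (η k).rOut, g y = 0 := by
          intro y hy
          by_contra hne
          refine hx (Metric.mem_cthickening_of_dist_le x y 1 _ (subset_tsupport _ hne) ?_)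
          rw [dist_comm]
          exact ((Metric.mem_ball.1 hy).trans (hk.trans_le (min_le_right _ _))).le
        have hz0 := hz x (Metric.mem_ball_self (η k).rOut_pos)
        have := (η k).normed_convolution_eq_right (μ := μ) (g := g) (x₀ := x)
          (fun y hy => by rw [hz y hy, hz0])
        rw [Pi.sub_apply, this]
        simp
    refine (eLpNorm_mono hb).trans ?_
    rw [eLpNorm_indicator_const hK.measurableSet (by norm_num) (by norm_num)]
    refine le_trans (le_of_eq ?_) hcδ.le
    simp
  rw [hdec]
  refine le_trans ?_ hδε
  refine (eLpNorm_add_le ((hconvm _ (hfl.sub hgl)).add ((hconvm _ hgl).sub hgm.1))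
    (hgm.1.sub hf.1) (by norm_num)).trans ?_
  refine add_le_add ((eLpNorm_add_le (hconvm _ (hfl.sub hgl)) ((hconvm _ hgl).sub hgm.1)
    (by norm_num)).trans (add_le_add h1 h2)) h3

/-- `g` is the weak derivative of `u` in the direction `v`. -/
def HasWeakLineDeriv (μ : Measure E) (u g : E → ℝ) (v : E) : Prop :=
  ∀ ψ : E → ℝ, ContDiff ℝ ∞ ψ → HasCompactSupport ψ →
    ∫ y, u y * fderiv ℝ ψ y v ∂μ = -∫ y, g y * ψ y ∂μ

-- The derivative of the convolution falls on the bump. The weak identity for the test function `t ↦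
-- η.normed μ (x - t)` moves it to `u`, the sign from the reflection cancelling the sign from the
-- integration by parts.
open ContinuousLinearMap in
theorem fderiv_normed_convolution_apply (η : ContDiffBump (0 : E)) {u g : E → ℝ} {v : E}
    (hu : LocallyIntegrable u μ) (h : HasWeakLineDeriv μ u g v) (x : E) :
    fderiv ℝ (η.normed μ ⋆[lsmul ℝ ℝ, μ] u) x v = (η.normed μ ⋆[lsmul ℝ ℝ, μ] g) x := by
  have hη1 : ContDiff ℝ 1 (η.normed μ) := η.contDiff_normed
  have hc := η.hasCompactSupport_normed (μ := μ)
  rw [(hc.hasFDerivAt_convolution_left (lsmul ℝ ℝ) hη1 hu x).fderiv,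
    convolution_eq_swap, ContinuousLinearMap.integral_apply]
  · have hψ : ContDiff ℝ ∞ fun t => η.normed μ (x - t) :=
      η.contDiff_normed.comp (contDiff_const.sub contDiff_id)
    have hψc : HasCompactSupport fun t => η.normed μ (x - t) :=
      hc.comp_homeomorph (Homeomorph.subLeft x)
    have hd : ∀ t, fderiv ℝ (fun t => η.normed μ (x - t)) t v =
        -fderiv ℝ (η.normed μ) (x - t) v := by
      intro t
      have h1 : HasFDerivAt (fun t => x - t) (-ContinuousLinearMap.id ℝ E) t :=
        (hasFDerivAt_id t).const_sub x
      have h2 := ((hη1.differentiable one_ne_zero) (x - t)).hasFDerivAt.comp t h1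
      rw [show (fun t => η.normed μ (x - t)) = η.normed μ ∘ fun t => x - t from rfl, h2.fderiv]
      simp
    have := h _ hψ hψc
    simp only [hd, mul_neg, integral_neg, neg_inj] at this
    rw [convolution_eq_swap]
    simp only [precompL_apply, lsmul_apply, smul_eq_mul]
    rw [show (∫ t, η.normed μ (x - t) * g t ∂μ) = ∫ t, g t * η.normed μ (x - t) ∂μ by
      simp only [mul_comm], ← this]
    simp only [mul_comm]
  · have hex : ConvolutionExistsAt (fderiv ℝ (η.normed μ)) u x
        ((lsmul ℝ ℝ : ℝ →L[ℝ] ℝ →L[ℝ] ℝ).precompL E) μ :=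
      HasCompactSupport.convolutionExists_left _ (hc.fderiv ℝ)
        (hη1.continuous_fderiv one_ne_zero) hu x
    exact hex.integrable_swap

open ContinuousLinearMap in
/-- Mollification of a compactly supported function, with convergence in `L²` of the function and
of all its weak derivatives. -/
theorem exists_smooth_approx {K : Set E} {u : E → ℝ} (hu : MemLp u 2 μ)
    (huK : ∀ x ∉ K, u x = 0) {δ : ℝ} (hδ : 0 < δ) :
    ∃ uk : ℕ → E → ℝ, (∀ k, ContDiff ℝ ∞ (uk k)) ∧
      (∀ k, tsupport (uk k) ⊆ Metric.cthickening δ K) ∧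
      Tendsto (fun k => eLpNorm (uk k - u) 2 μ) atTop (𝓝 0) ∧
      ∀ (v : E) (g : E → ℝ), MemLp g 2 μ → HasWeakLineDeriv μ u g v →
        Tendsto (fun k => eLpNorm ((fun x => fderiv ℝ (uk k) x v) - g) 2 μ) atTop (𝓝 0) := by
  -- The outer radii tend to zero and never exceed `δ`, which keeps all supports in the
  -- `δ`-thickening of `K`.
  let η : ℕ → ContDiffBump (0 : E) := fun k =>
    ⟨δ / (k + 1) / 2, δ / (k + 1), by positivity, half_lt_self (by positivity)⟩
  have hη : Tendsto (fun k => (η k).rOut) atTop (𝓝 0) :=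
    tendsto_const_nhds.div_atTop (tendsto_natCast_atTop_atTop.atTop_add tendsto_const_nhds)
  have hul : LocallyIntegrable u μ := hu.locallyIntegrable (by norm_num)
  refine ⟨fun k => (η k).normed μ ⋆[lsmul ℝ ℝ, μ] u, fun k => ?_, fun k => ?_,
    tendsto_eLpNorm_normed_convolution_sub hη hu, fun v g hg hw => ?_⟩
  · exact (η k).hasCompactSupport_normed.contDiff_convolution_left _ (η k).contDiff_normed hul
  · refine closure_minimal ?_ Metric.isClosed_cthickening
    refine (support_convolution_subset (lsmul ℝ ℝ)).trans ?_
    rintro _ ⟨a, ha, b, hb, rfl⟩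
    have hbK : b ∈ K := by
      by_contra hbK
      exact hb (huK b hbK)
    rw [(η k).support_normed_eq, mem_ball_zero_iff] at ha
    refine Metric.mem_cthickening_of_dist_le _ b δ K hbK ?_
    simp only [dist_eq_norm, add_sub_cancel_right]
    refine ha.le.trans ?_
    exact div_le_self hδ.le (by linarith [(Nat.cast_nonneg k : (0 : ℝ) ≤ k)])
  · refine (tendsto_eLpNorm_normed_convolution_sub hη hg).congr fun k => ?_
    congr 1
    ext x
    simp [fderiv_normed_convolution_apply (η k) hul hw x]

end Mollification

/-! ### Weak derivatives, Lipschitz multipliers and the product rule. -/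

section WeakDerivative

theorem tendsto_integral_mul_of_eLpNorm {X : Type*} [MeasurableSpace X] {μ : Measure X}
    {f r : X → ℝ} {rk : ℕ → X → ℝ} (hf : MemLp f 2 μ) (hr : MemLp r 2 μ)
    (hrk : ∀ k, MemLp (rk k) 2 μ)
    (h : Tendsto (fun k => eLpNorm (rk k - r) 2 μ) atTop (𝓝 0)) :
    Tendsto (fun k => ∫ x, f x * rk k x ∂μ) atTop (𝓝 (∫ x, f x * r x ∂μ)) := by
  refine tendsto_integral_of_L1 _ (hf.1.mul hr.1)
    (Eventually.of_forall fun k => hf.integrable_mul (hrk k)) ?_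
  have h0 : Tendsto (fun k => eLpNorm f 2 μ * eLpNorm (rk k - r) 2 μ) atTop (𝓝 0) := by
    simpa using ENNReal.Tendsto.const_mul h (Or.inr hf.2.ne)
  refine tendsto_of_tendsto_of_tendsto_of_le_of_le tendsto_const_nhds h0 (fun _ => bot_le)
    fun k => ?_
  have := eLpNorm_smul_le_mul_eLpNorm (p := 2) (q := 2) (r := 1) ((hrk k).1.sub hr.1) hf.1
  rw [eLpNorm_one_eq_lintegral_enorm] at this
  refine le_trans (le_of_eq ?_) this
  refine lintegral_congr fun x => ?_
  simp [mul_sub]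

theorem exists_lipschitzWith_mul {E : Type*} [NormedAddCommGroup E] {w ψ : E → ℝ} {C D : ℝ≥0} (hw : LipschitzWith C w)
    (hψ : LipschitzWith D ψ) {B B' : ℝ} (hB : ∀ x, ‖w x‖ ≤ B) (hB' : ∀ x, ‖ψ x‖ ≤ B') :
    ∃ K : ℝ≥0, LipschitzWith K fun x => w x * ψ x := by
  have hB0 : 0 ≤ B := (norm_nonneg _).trans (hB 0)
  have hB0' : 0 ≤ B' := (norm_nonneg _).trans (hB' 0)
  refine ⟨⟨B * D + B' * C, by positivity⟩, LipschitzWith.of_dist_le_mul fun x y => ?_⟩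
  have h1 := hw.dist_le_mul x y
  have h2 := hψ.dist_le_mul x y
  rw [Real.dist_eq] at h1 h2 ⊢
  have e : w x * ψ x - w y * ψ y = w x * (ψ x - ψ y) + ψ y * (w x - w y) := by ring
  rw [e]
  calc _ ≤ ‖w x‖ * |ψ x - ψ y| + ‖ψ y‖ * |w x - w y| := by
        refine (abs_add_le _ _).trans ?_
        rw [abs_mul, abs_mul]; rfl
    _ ≤ B * (D * dist x y) + B' * (C * dist x y) := by
        gcongr
        · exact hB x
        · exact hB' y
    _ = _ := by
        change _ = (B * D + B' * C) * dist x y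
        ring

theorem memLp_mul_of_tsupport_subset {E : Type*} [TopologicalSpace E] [T2Space E] [MeasurableSpace E]
    [BorelSpace E] {μ : Measure E} {Ω : Set E} {f w : E → ℝ}
    (hf : ∀ K ⊆ Ω, IsCompact K → MemLp f 2 (μ.restrict K)) {B : ℝ} (hw : AEStronglyMeasurable w μ)
    (hB : ∀ x, ‖w x‖ ≤ B) {K : Set E} (hK : IsCompact K) (hKΩ : K ⊆ Ω) (hwK : ∀ x ∉ K, w x = 0) :
    MemLp (fun x => f x * w x) 2 μ := by
  have h1 : MemLp (K.indicator f) 2 μ := (memLp_indicator_iff_restrict hK.measurableSet).2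
    (hf K hKΩ hK)
  have h2 : (fun x => f x * w x) = fun x => K.indicator f x * w x := by
    ext x
    by_cases hx : x ∈ K
    · rw [indicator_of_mem hx]
    · simp [hwK x hx]
  rw [h2]
  refine h1.of_le_mul (c := B) (h1.1.mul hw) (Eventually.of_forall fun x => ?_)
  rw [norm_mul, mul_comm]
  gcongr
  exact hB x

variable {E : Type*} [NormedAddCommGroup E] [NormedSpace ℝ E] [FiniteDimensional ℝ E]
  [MeasurableSpace E] [BorelSpace E] {μ : Measure E} [μ.IsAddHaarMeasure]

/-- Integration by parts holds between a Lipschitz function and a compactly supported Lipschitz one,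
so the pointwise line derivative is also the weak one. -/
theorem hasWeakLineDeriv_of_lipschitzWith {w : E → ℝ} {C : ℝ≥0} (hw : LipschitzWith C w) (v : E) :
    HasWeakLineDeriv μ w (fun x => lineDeriv ℝ w x v) v := by
  intro ψ hψ hψc
  obtain ⟨D, hD⟩ := (hψ.of_le (by simp : (1 : ℕ∞ω) ≤ (∞ : ℕ∞ω))).lipschitzWith_of_hasCompactSupport hψc
    one_ne_zero
  have h := hw.integral_lineDeriv_mul_eq (μ := μ) hD hψc v
  rw [h, ← integral_neg]
  refine integral_congr_ae (Eventually.of_forall fun y => ?_)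
  have hd : DifferentiableAt ℝ ψ y := hψ.differentiable (by simp) y
  simp only [hd.lineDeriv_eq_fderiv, map_neg]
  ring

/-- `φ ∈ W^{1,2}_loc(Ω)`, with weak derivatives `g v` in the directions `v`. -/
structure IsLocalSobolev (μ : Measure E) (Ω : Set E) (φ : E → ℝ) (g : E → E → ℝ) : Prop where
  memLp : ∀ K ⊆ Ω, IsCompact K → MemLp φ 2 (μ.restrict K)
  memLp_deriv : ∀ K ⊆ Ω, IsCompact K → ∀ v, MemLp (g v) 2 (μ.restrict K)
  weak : ∀ ψ : E → ℝ, ContDiff ℝ ∞ ψ → HasCompactSupport ψ → tsupport ψ ⊆ Ω → ∀ v,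
    ∫ y, φ y * fderiv ℝ ψ y v ∂μ = -∫ y, g v y * ψ y ∂μ

theorem lineDeriv_eq_zero_of_notMem_tsupport {w : E → ℝ} {x : E} (hx : x ∉ tsupport w) (v : E) :
    lineDeriv ℝ w x v = 0 := by
  have h : w =ᶠ[𝓝 x] fun _ => 0 := notMem_tsupport_iff_eventuallyEq.1 hx
  rw [h.lineDeriv_eq, (differentiableAt_const (0 : ℝ)).lineDeriv_eq_fderiv]
  simp

variable {Ω : Set E} {φ : E → ℝ} {g : E → E → ℝ}

/-- Mollifications of `w` are admissible test functions, since their supports stay in a compact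
thickening inside `Ω`. Both sides pass to the limit by Hölder's inequality in `L²` on that
thickening. Lipschitz test functions are needed for the product rule. -/
theorem IsLocalSobolev.integral_mul_lineDeriv (h : IsLocalSobolev μ Ω φ g) (hΩ : IsOpen Ω)
    {w : E → ℝ} {C : ℝ≥0} (hw : LipschitzWith C w) (hwc : HasCompactSupport w)
    (hwΩ : tsupport w ⊆ Ω) (v : E) :
    ∫ y, φ y * lineDeriv ℝ w y v ∂μ = -∫ y, g v y * w y ∂μ := by
  obtain ⟨δ, hδ, hδΩ⟩ := hwc.isCompact.exists_cthickening_subset_open hΩ hwΩ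
  have hwt : ∀ x ∉ tsupport w, w x = 0 := fun x hx => image_eq_zero_of_notMem_tsupport hx
  have hK : IsCompact (Metric.cthickening δ (tsupport w)) := hwc.isCompact.cthickening
  obtain ⟨B, hB⟩ := hwc.exists_bound_of_continuous hw.continuous
  have hwL : MemLp w 2 μ := hw.continuous.memLp_of_hasCompactSupport hwc
  have hdm : AEStronglyMeasurable (fun x => lineDeriv ℝ w x v) μ :=
    aestronglyMeasurable_lineDeriv hw.continuous μ
  have hdL : MemLp (fun x => lineDeriv ℝ w x v) 2 μ := by
    have h1 : MemLp ((tsupport w).indicator fun _ => (C * ‖v‖ : ℝ)) 2 μ :=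
      memLp_indicator_const _ hwc.isCompact.measurableSet _ (Or.inr hwc.isCompact.measure_lt_top.ne)
    refine h1.mono hdm (Eventually.of_forall fun x => ?_)
    by_cases hx : x ∈ tsupport w
    · rw [indicator_of_mem hx]
      exact (norm_lineDeriv_le_of_lipschitz ℝ hw).trans (le_abs_self _)
    · simp [lineDeriv_eq_zero_of_notMem_tsupport hx]
  obtain ⟨wk, hk1, hk2, hk3, hk4⟩ := exists_smooth_approx (μ := μ) hwL hwt hδ
  have hwkc : ∀ k, HasCompactSupport (wk k) := fun k =>
    hK.of_isClosed_subset (isClosed_tsupport _) (hk2 k)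
  have hd0 : ∀ k, ∀ x ∉ Metric.cthickening δ (tsupport w), fderiv ℝ (wk k) x v = 0 := by
    intro k x hx
    have : x ∉ tsupport (fderiv ℝ (wk k)) := fun hx' => hx (hk2 k (tsupport_fderiv_subset ℝ hx'))
    simp [image_eq_zero_of_notMem_tsupport this]
  have hfd : ∀ k, Continuous fun x => fderiv ℝ (wk k) x v := fun k =>
    ((hk1 k).continuous_fderiv (by simp)).clm_apply continuous_const
  have hsub := Metric.self_subset_cthickening (δ := δ) (tsupport w)
  have hfdL : ∀ k, MemLp (fun x => fderiv ℝ (wk k) x v) 2 μ := fun k =>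
    (hfd k).memLp_of_hasCompactSupport (HasCompactSupport.intro hK (hd0 k))
  have hφK : MemLp ((Metric.cthickening δ (tsupport w)).indicator φ) 2 μ :=
    (memLp_indicator_iff_restrict hK.measurableSet).2 (h.memLp _ hδΩ hK)
  have hgK : MemLp ((Metric.cthickening δ (tsupport w)).indicator (g v)) 2 μ :=
    (memLp_indicator_iff_restrict hK.measurableSet).2 (h.memLp_deriv _ hδΩ hK v)
  have hind : ∀ f r : E → ℝ, (∀ x ∉ Metric.cthickening δ (tsupport w), r x = 0) →
      ∫ x, (Metric.cthickening δ (tsupport w)).indicator f x * r x ∂μ = ∫ x, f x * r x ∂μ := by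
    intro f r hr
    congr 1
    ext x
    by_cases hx : x ∈ Metric.cthickening δ (tsupport w)
    · rw [indicator_of_mem hx]
    · simp [hr x hx]
  have t1 := tendsto_integral_mul_of_eLpNorm hφK hdL hfdL
    (hk4 v _ hdL (hasWeakLineDeriv_of_lipschitzWith hw v))
  have t2 := (tendsto_integral_mul_of_eLpNorm hgK hwL
    (fun k => (hk1 k).continuous.memLp_of_hasCompactSupport (hwkc k)) hk3).neg
  rw [hind _ _ fun x hx => lineDeriv_eq_zero_of_notMem_tsupport (fun hx' => hx (hsub hx')) v] at t1
  rw [hind _ _ fun x hx => hwt x (fun hx' => hx (hsub hx'))] at t2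
  refine tendsto_nhds_unique t1 (t2.congr fun k => ?_)
  rw [hind _ _ (hd0 k), hind _ _ fun x hx => image_eq_zero_of_notMem_tsupport
    (fun hx' => hx (hk2 k hx')), h.weak _ (hk1 k) (hwkc k) ((hk2 k).trans hδΩ)]

theorem IsLocalSobolev.memLp_mul_deriv (h : IsLocalSobolev μ Ω φ g)
    {w : E → ℝ} {C : ℝ≥0} (hw : LipschitzWith C w) (hwc : HasCompactSupport w)
    (hwΩ : tsupport w ⊆ Ω) (v : E) :
    MemLp (fun x => g v x * w x + φ x * lineDeriv ℝ w x v) 2 μ := by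
  obtain ⟨B, hB⟩ := hwc.exists_bound_of_continuous hw.continuous
  exact (memLp_mul_of_tsupport_subset (fun K hK hKc => h.memLp_deriv K hK hKc v)
    hw.continuous.aestronglyMeasurable hB hwc.isCompact hwΩ
    fun x hx => image_eq_zero_of_notMem_tsupport hx).add
    (memLp_mul_of_tsupport_subset h.memLp (aestronglyMeasurable_lineDeriv hw.continuous μ)
      (fun x => norm_lineDeriv_le_of_lipschitz ℝ hw) hwc.isCompact hwΩ
      fun x hx => lineDeriv_eq_zero_of_notMem_tsupport hx v)

theorem IsLocalSobolev.memLp_mul (h : IsLocalSobolev μ Ω φ g)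
    {w : E → ℝ} {C : ℝ≥0} (hw : LipschitzWith C w) (hwc : HasCompactSupport w)
    (hwΩ : tsupport w ⊆ Ω) : MemLp (fun x => φ x * w x) 2 μ := by
  obtain ⟨B, hB⟩ := hwc.exists_bound_of_continuous hw.continuous
  exact memLp_mul_of_tsupport_subset h.memLp
    hw.continuous.aestronglyMeasurable hB hwc.isCompact hwΩ
    fun x hx => image_eq_zero_of_notMem_tsupport hx

/-- The product rule for a Sobolev function and a compactly supported Lipschitz function. -/
theorem IsLocalSobolev.hasWeakLineDeriv_mul (h : IsLocalSobolev μ Ω φ g) (hΩ : IsOpen Ω)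
    {w : E → ℝ} {C : ℝ≥0} (hw : LipschitzWith C w) (hwc : HasCompactSupport w)
    (hwΩ : tsupport w ⊆ Ω) (v : E) :
    HasWeakLineDeriv μ (fun x => φ x * w x)
      (fun x => g v x * w x + φ x * lineDeriv ℝ w x v) v := by
  intro ψ hψ hψc
  obtain ⟨D, hD⟩ := (hψ.of_le (by simp : (1 : ℕ∞ω) ≤ (∞ : ℕ∞ω))).lipschitzWith_of_hasCompactSupport
    hψc one_ne_zero
  obtain ⟨B, hB⟩ := hwc.exists_bound_of_continuous hw.continuous
  obtain ⟨B', hB'⟩ := hψc.exists_bound_of_continuous hψ.continuous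
  obtain ⟨K, hK⟩ := exists_lipschitzWith_mul hw hD hB hB'
  have hψL : MemLp ψ 2 μ := hψ.continuous.memLp_of_hasCompactSupport hψc
  have hψ'L : MemLp (fun x => fderiv ℝ ψ x v) 2 μ :=
    ((hψ.continuous_fderiv (by simp)).clm_apply continuous_const).memLp_of_hasCompactSupport
      (hψc.fderiv_apply ℝ v)
  -- The weak derivative of `φ` is tested against the Lipschitz function `w ψ`, whose line
  -- derivative is then expanded almost everywhere.
  have h1 := h.integral_mul_lineDeriv hΩ hK hwc.mul_right
    ((tsupport_mul_subset_left).trans hwΩ) v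
  have h2 : ∀ᵐ y ∂μ, φ y * lineDeriv ℝ (fun x => w x * ψ x) y v =
      φ y * w y * fderiv ℝ ψ y v + φ y * lineDeriv ℝ w y v * ψ y := by
    filter_upwards [hw.ae_lineDifferentiableAt (μ := μ) v] with y hy
    have hψd : LineDifferentiableAt ℝ ψ y v :=
      (hψ.differentiable (by simp) y).lineDifferentiableAt
    have h3 : lineDeriv ℝ (fun x => w x * ψ x) y v =
        lineDeriv ℝ w y v * ψ y + w y * lineDeriv ℝ ψ y v := by
      have := HasDerivAt.mul hy.hasLineDerivAt hψd.hasLineDerivAt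
      have h4 := this.deriv
      simp only [zero_smul, add_zero] at h4
      exact h4
    rw [h3, (hψ.differentiable (by simp) y).lineDeriv_eq_fderiv]
    ring
  have i1 : Integrable (fun y => φ y * w y * fderiv ℝ ψ y v) μ :=
    (h.memLp_mul hw hwc hwΩ).integrable_mul hψ'L
  obtain ⟨B, hB⟩ := hwc.exists_bound_of_continuous hw.continuous
  have i2 : Integrable (fun y => φ y * lineDeriv ℝ w y v * ψ y) μ :=
    (memLp_mul_of_tsupport_subset h.memLp (aestronglyMeasurable_lineDeriv hw.continuous μ)
      (fun x => norm_lineDeriv_le_of_lipschitz ℝ hw) hwc.isCompact hwΩ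
      fun x hx => lineDeriv_eq_zero_of_notMem_tsupport hx v).integrable_mul hψL
  have i3 : Integrable (fun y => g v y * w y * ψ y) μ :=
    (memLp_mul_of_tsupport_subset (fun K hK hKc => h.memLp_deriv K hK hKc v)
      hw.continuous.aestronglyMeasurable hB hwc.isCompact hwΩ
      fun x hx => image_eq_zero_of_notMem_tsupport hx).integrable_mul hψL
  rw [integral_congr_ae h2, integral_add i1 i2] at h1
  simp only [add_mul]
  rw [integral_add i3 i2]
  simp only [← mul_assoc] at h1
  linarith

/-- Smooth approximation of the product of a Sobolev function and a compactly supported Lipschitz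
function. -/
theorem IsLocalSobolev.exists_smooth_approx_mul (h : IsLocalSobolev μ Ω φ g) (hΩ : IsOpen Ω)
    {w : E → ℝ} {C : ℝ≥0} (hw : LipschitzWith C w) (hwc : HasCompactSupport w)
    (hwΩ : tsupport w ⊆ Ω) :
    ∃ (L : Set E) (uk : ℕ → E → ℝ), IsCompact L ∧ L ⊆ Ω ∧ tsupport w ⊆ L ∧
      (∀ k, ContDiff ℝ ∞ (uk k)) ∧ (∀ k, tsupport (uk k) ⊆ L) ∧
      Tendsto (fun k => eLpNorm (fun x => uk k x - φ x * w x) 2 μ) atTop (𝓝 0) ∧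
      ∀ v, Tendsto (fun k => eLpNorm
        (fun x => fderiv ℝ (uk k) x v - (g v x * w x + φ x * lineDeriv ℝ w x v)) 2 μ)
        atTop (𝓝 0) := by
  obtain ⟨δ, hδ, hδΩ⟩ := hwc.isCompact.exists_cthickening_subset_open hΩ hwΩ
  obtain ⟨uk, h1, h2, h3, h4⟩ := exists_smooth_approx (h.memLp_mul hw hwc hwΩ) (K := tsupport w)
    (fun x hx => by rw [image_eq_zero_of_notMem_tsupport hx, mul_zero]) hδ
  exact ⟨_, uk, hwc.isCompact.cthickening, hδΩ, Metric.self_subset_cthickening _, h1, h2, h3,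
    fun v => h4 v _ (h.memLp_mul_deriv hw hwc hwΩ v) (h.hasWeakLineDeriv_mul hΩ hw hwc hwΩ v)⟩

end WeakDerivative

/-! ### Compactness of balls in complete length spaces. -/

/-- The Hopf–Rinow–Cohn-Vossen theorem: in a complete, locally compact length space the closed
balls are compact. -/
theorem isCompact_closedBall_of_length_space {X : Type*} [PseudoMetricSpace X] [CompleteSpace X]
    [LocallyCompactSpace X]
    (hlen : ∀ (x y : X) (a b : ℝ), 0 ≤ a → 0 < b → dist x y < a + b →
      ∃ z, dist x z ≤ a ∧ dist z y < b) (x : X) (r : ℝ) :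
    IsCompact (Metric.closedBall x r) := by
  by_contra hr
  have hr0 : 0 ≤ r := by
    by_contra h
    exact hr (by rw [Metric.closedBall_eq_empty.2 (not_le.1 h)]; exact isCompact_empty)
  -- If the ball of radius `r` is not compact, the radii of compact balls are bounded by `r`. Their
  -- supremum is attained by completeness and can be exceeded by local compactness, a contradiction.
  let S : Set ℝ := {t | 0 ≤ t ∧ IsCompact (Metric.closedBall x t)}
  have hS0 : (0 : ℝ) ∈ S := by
    refine ⟨le_rfl, ?_⟩
    obtain ⟨ε, hε, hc⟩ := (isCompact_singleton (x := x)).exists_isCompact_cthickening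
    refine hc.of_isClosed_subset Metric.isClosed_closedBall fun y hy => ?_
    exact Metric.mem_cthickening_of_dist_le y x ε _ rfl ((Metric.mem_closedBall.1 hy).trans hε.le)
  have hSb : ∀ t ∈ S, t ≤ r := by
    intro t ht
    by_contra h
    exact hr (ht.2.of_isClosed_subset Metric.isClosed_closedBall
      (Metric.closedBall_subset_closedBall (not_le.1 h).le))
  have hbdd : BddAbove S := ⟨r, hSb⟩
  set R := sSup S with hR
  have hR0 : 0 ≤ R := le_csSup hbdd hS0
  have hlt : ∀ t < R, IsCompact (Metric.closedBall x t) := by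
    intro t ht
    obtain ⟨t', ht', htt'⟩ := exists_lt_of_lt_csSup ⟨0, hS0⟩ ht
    exact ht'.2.of_isClosed_subset Metric.isClosed_closedBall
      (Metric.closedBall_subset_closedBall htt'.le)
  have hRc : IsCompact (Metric.closedBall x R) := by
    rcases hR0.eq_or_lt with h0 | hpos
    · rw [← h0]; exact hS0.2
    refine isCompact_iff_totallyBounded_isComplete.2 ⟨?_, Metric.isClosed_closedBall.isComplete⟩
    rw [Metric.totallyBounded_iff]
    intro ε hε
    -- Each point of the `R`-ball is within `ε/2` of the compact `t`-ball, because `R < t + ε/2`; an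
    -- `ε/2`-net of the latter is therefore an `ε`-net of the former.
    set t := max 0 (R - ε / 4) with ht
    have htR : t < R := max_lt hpos (by linarith)
    obtain ⟨F, hF, hFc⟩ := Metric.totallyBounded_iff.1 (hlt t htR).totallyBounded (ε / 2)
      (by linarith)
    refine ⟨F, hF, fun y hy => ?_⟩
    obtain ⟨z, hz1, hz2⟩ := hlen x y t (ε / 2) (le_max_left _ _) (by linarith)
      (by
        have := Metric.mem_closedBall'.1 hy
        have h2 : R - ε / 4 ≤ t := le_max_right _ _
        linarith)
    obtain ⟨c, hc, hzc⟩ := mem_iUnion₂.1 (hFc (Metric.mem_closedBall'.2 hz1))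
    refine mem_iUnion₂.2 ⟨c, hc, ?_⟩
    rw [Metric.mem_ball] at hzc ⊢
    rw [dist_comm] at hz2
    linarith [dist_triangle y z c]
  obtain ⟨ε, hε, hc⟩ := hRc.exists_isCompact_cthickening
  have : R + ε / 2 ∈ S := by
    refine ⟨by linarith, hc.of_isClosed_subset Metric.isClosed_closedBall fun y hy => ?_⟩
    obtain ⟨z, hz1, hz2⟩ := hlen x y R ε hR0 hε
      (by
        have := Metric.mem_closedBall'.1 hy
        linarith)
    exact Metric.mem_cthickening_of_dist_le y z ε _ (Metric.mem_closedBall'.2 hz1)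
      (by rw [dist_comm]; exact hz2.le)
  linarith [le_csSup hbdd this]

/-! ### Brooks' argument on the line. -/

section OneDimensional

theorem exists_bound_deriv_smoothTransition :
    ∃ C : ℝ, 0 ≤ C ∧ ∀ t, |deriv Real.smoothTransition t| ≤ C := by
  have hc : HasCompactSupport (deriv Real.smoothTransition) := by
    refine HasCompactSupport.intro (K := Icc 0 1) isCompact_Icc fun x hx => ?_
    rcases lt_or_ge x 0 with h | h
    · have : Real.smoothTransition =ᶠ[𝓝 x] fun _ => 0 := by
        filter_upwards [Iio_mem_nhds h] with y hy
        exact Real.smoothTransition.zero_of_nonpos (le_of_lt hy)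
      rw [this.deriv_eq]; simp
    · have h1 : 1 < x := by
        by_contra h1
        exact hx ⟨h, not_lt.1 h1⟩
      have : Real.smoothTransition =ᶠ[𝓝 x] fun _ => 1 := by
        filter_upwards [Ioi_mem_nhds h1] with y hy
        exact Real.smoothTransition.one_of_one_le (le_of_lt hy)
      rw [this.deriv_eq]; simp
  obtain ⟨C, hC⟩ := hc.exists_bound_of_continuous
    ((Real.smoothTransition.contDiff (n := 1)).continuous_deriv le_rfl)
  exact ⟨C, (norm_nonneg _).trans (hC 0), hC⟩

theorem hasDerivAt_smoothTransition (t : ℝ) :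
    HasDerivAt Real.smoothTransition (deriv Real.smoothTransition t) t :=
  ((Real.smoothTransition.contDiff (n := 1)).differentiable one_ne_zero t).hasDerivAt

/-- The one-dimensional Hardy inequality extends from compactly supported functions to functions
of finite energy. -/
theorem integral_sq_le_of_forall_compact_support {m : Measure ℝ} {α R₀ R₁ : ℝ} (hR : R₀ < R₁)
    (h : ∀ f : ℝ → ℝ, ContDiff ℝ 1 f → HasCompactSupport f → tsupport f ⊆ Ioi R₀ →
      α * ∫ t, f t ^ 2 ∂m ≤ ∫ t, deriv f t ^ 2 ∂m)
    {f : ℝ → ℝ} (hf : ContDiff ℝ 1 f) (hf0 : ∀ t ≤ R₁, f t = 0)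
    (hi : Integrable (fun t => f t ^ 2) m) (hi' : Integrable (fun t => deriv f t ^ 2) m) :
    α * ∫ t, f t ^ 2 ∂m ≤ ∫ t, deriv f t ^ 2 ∂m := by
  obtain ⟨C, hC0, hC⟩ := exists_bound_deriv_smoothTransition
  -- Equal to `1` for `t ≤ k` and to `0` for `t ≥ k + 1`, with derivative bounded by `C` for all
  -- `k`.
  let χ : ℕ → ℝ → ℝ := fun k t => Real.smoothTransition (k + 1 - t)
  have hχd : ∀ k t, HasDerivAt (χ k) (-deriv Real.smoothTransition (k + 1 - t)) t := by
    intro k t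
    have := (hasDerivAt_smoothTransition (k + 1 - t)).comp t ((hasDerivAt_id t).const_sub (k + 1 : ℝ))
    rw [mul_neg_one] at this
    exact this
  have hχc : ∀ k, ContDiff ℝ 1 (χ k) := fun k =>
    Real.smoothTransition.contDiff.comp (contDiff_const.sub contDiff_id)
  have hfd : ∀ t, HasDerivAt f (deriv f t) t := fun t =>
    (hf.differentiable one_ne_zero t).hasDerivAt
  have hd : ∀ k t, deriv (fun t => f t * χ k t) t =
      deriv f t * χ k t + f t * -deriv Real.smoothTransition (k + 1 - t) := fun k t =>
    ((hfd t).mul (hχd k t)).deriv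
  have hχ1 : ∀ k t, |χ k t| ≤ 1 := fun k t => by
    rw [abs_of_nonneg (Real.smoothTransition.nonneg _)]
    exact Real.smoothTransition.le_one _
  have hev : ∀ t, ∀ᶠ k : ℕ in atTop, (fun t => f t * χ k t) =ᶠ[𝓝 t] f := by
    intro t
    filter_upwards [eventually_gt_atTop ⌈t⌉₊] with k hk
    have : t < k := (Nat.le_ceil t).trans_lt (by exact_mod_cast hk)
    filter_upwards [Iio_mem_nhds this] with y hy
    have : χ k y = 1 := Real.smoothTransition.one_of_one_le (by
      have := mem_Iio.1 hy
      linarith)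
    rw [this, mul_one]
  have hk : ∀ k, α * ∫ t, (f t * χ k t) ^ 2 ∂m ≤ ∫ t, deriv (fun t => f t * χ k t) t ^ 2 ∂m := by
    intro k
    have hs : tsupport (fun t => f t * χ k t) ⊆ Icc R₁ (k + 1) := by
      refine closure_minimal (fun t ht => ?_) isClosed_Icc
      by_contra hn
      refine ht ?_
      by_cases h1 : t ≤ R₁
      · simp [hf0 t h1]
      · have h2 : (k + 1 : ℝ) < t := by
          by_contra h2
          exact hn ⟨(not_le.1 h1).le, not_lt.1 h2⟩
        have : χ k t = 0 := Real.smoothTransition.zero_of_nonpos (by linarith)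
        simp [this]
    exact h _ (hf.mul (hχc k)) (isCompact_Icc.of_isClosed_subset (isClosed_tsupport _) hs)
      (hs.trans fun t ht => hR.trans_le ht.1)
  have hmf : ∀ k, Continuous fun t => f t * χ k t := fun k => (hf.mul (hχc k)).continuous
  have hmf' : ∀ k, Continuous (deriv fun t => f t * χ k t) := fun k =>
    (hf.mul (hχc k)).continuous_deriv le_rfl
  have t1 : Tendsto (fun k => ∫ t, (f t * χ k t) ^ 2 ∂m) atTop (𝓝 (∫ t, f t ^ 2 ∂m)) := by
    refine tendsto_integral_of_dominated_convergence _
      (fun k => ((hmf k).pow 2).aestronglyMeasurable) hi (fun k => ?_) ?_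
    · refine Eventually.of_forall fun t => ?_
      rw [Real.norm_eq_abs, abs_of_nonneg (sq_nonneg _), mul_pow]
      refine mul_le_of_le_one_right (sq_nonneg _) ?_
      rw [← sq_abs]
      exact pow_le_one₀ (abs_nonneg _) (hχ1 k t)
    · refine Eventually.of_forall fun t => ?_
      refine tendsto_const_nhds.congr' ?_
      filter_upwards [hev t] with k hk
      have := hk.eq_of_nhds
      rw [this]
  have t2 : Tendsto (fun k => ∫ t, deriv (fun t => f t * χ k t) t ^ 2 ∂m) atTop
      (𝓝 (∫ t, deriv f t ^ 2 ∂m)) := by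
    -- The majorant comes from `(a + b)² ≤ 2a² + 2b²`, with `|χ| ≤ 1` and `|χ'| ≤ C`.
    refine tendsto_integral_of_dominated_convergence
      (fun t => 2 * deriv f t ^ 2 + 2 * C ^ 2 * f t ^ 2)
      (fun k => ((hmf' k).pow 2).aestronglyMeasurable)
      ((hi'.const_mul 2).add (hi.const_mul (2 * C ^ 2))) (fun k => ?_) ?_
    · refine Eventually.of_forall fun t => ?_
      rw [Real.norm_eq_abs, abs_of_nonneg (sq_nonneg _), hd]
      have e1 : (deriv f t * χ k t) ^ 2 ≤ deriv f t ^ 2 := by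
        rw [mul_pow]
        refine mul_le_of_le_one_right (sq_nonneg _) ?_
        rw [← sq_abs]
        exact pow_le_one₀ (abs_nonneg _) (hχ1 k t)
      have e2 : (f t * -deriv Real.smoothTransition (k + 1 - t)) ^ 2 ≤ C ^ 2 * f t ^ 2 := by
        rw [mul_pow, neg_sq, mul_comm, ← sq_abs (deriv _ _)]
        gcongr
        exact hC _
      nlinarith [sq_nonneg (deriv f t * χ k t - f t * -deriv Real.smoothTransition (k + 1 - t))]
    · refine Eventually.of_forall fun t => ?_
      refine tendsto_const_nhds.congr' ?_
      filter_upwards [hev t] with k hk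
      rw [hk.deriv_eq]
  exact le_of_tendsto_of_tendsto' (t1.const_mul α) t2 hk

/-- Test functions `l` with `|l'| ≤ (s/2) l`, cut off at the left end. -/
theorem integral_sq_le_of_deriv_le {m : Measure ℝ} {α R₀ R₁ s B : ℝ} (hR : R₀ < R₁)
    (hfin : ∀ r, m (Iic r) < ⊤) (hs : 0 ≤ s) (hα : s ^ 2 / 4 ≤ α)
    (h : ∀ f : ℝ → ℝ, ContDiff ℝ 1 f → HasCompactSupport f → tsupport f ⊆ Ioi R₀ →
      α * ∫ t, f t ^ 2 ∂m ≤ ∫ t, deriv f t ^ 2 ∂m) :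
    ∃ D : ℝ, ∀ l : ℝ → ℝ, ContDiff ℝ 1 l → (∀ t, 0 ≤ l t) → (∀ t, |deriv l t| ≤ s / 2 * l t) →
      (∀ t ≤ R₁ + 1, l t ≤ B) → Integrable (fun t => l t ^ 2) m →
      (α - s ^ 2 / 4) * ∫ t in Ici (R₁ + 1), l t ^ 2 ∂m ≤ D := by
  obtain ⟨C, hC0, hC⟩ := exists_bound_deriv_smoothTransition
  -- Beyond `R₁ + 1` the cutoff `θ` is `1`, and `l'² ≤ (s²/4) l²` is absorbed on the left. The only
  -- error comes from `t ≤ R₁ + 1`, where `|(θ l)'| ≤ (C + s/2) B`. It is essential that this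
  -- constant is the same for all `l`.
  refine ⟨((C + s / 2) * B) ^ 2 * m.real (Iic (R₁ + 1)), fun l hl hl0 hl' hlB hli => ?_⟩
  let θ : ℝ → ℝ := fun t => Real.smoothTransition (t - R₁)
  have hθc : ContDiff ℝ 1 θ := Real.smoothTransition.contDiff.comp (contDiff_id.sub contDiff_const)
  have hθd : ∀ t, HasDerivAt θ (deriv Real.smoothTransition (t - R₁)) t := by
    intro t
    have := (hasDerivAt_smoothTransition (t - R₁)).comp t ((hasDerivAt_id t).sub_const R₁)
    rw [mul_one] at this
    exact this
  have hθ0 : ∀ t, 0 ≤ θ t := fun t => Real.smoothTransition.nonneg _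
  have hθ1 : ∀ t, θ t ≤ 1 := fun t => Real.smoothTransition.le_one _
  have hd : ∀ t, deriv (fun t => θ t * l t) t =
      deriv Real.smoothTransition (t - R₁) * l t + θ t * deriv l t := fun t =>
    ((hθd t).mul (hl.differentiable one_ne_zero t).hasDerivAt).deriv
  have hfi : Integrable (fun t => (θ t * l t) ^ 2) m := by
    refine hli.mono' ((hθc.mul hl).continuous.pow 2).aestronglyMeasurable
      (Eventually.of_forall fun t => ?_)
    rw [Real.norm_eq_abs, abs_of_nonneg (sq_nonneg _), mul_pow]
    exact mul_le_of_le_one_left (sq_nonneg _) (pow_le_one₀ (hθ0 t) (hθ1 t))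
  have hbound : ∀ t, deriv (fun t => θ t * l t) t ^ 2 ≤ s ^ 2 / 4 * (θ t * l t) ^ 2 +
      (Iic (R₁ + 1)).indicator (fun _ => ((C + s / 2) * B) ^ 2) t := by
    intro t
    rw [hd]
    rcases le_or_gt t (R₁ + 1) with ht | ht
    · rw [indicator_of_mem (mem_Iic.2 ht)]
      have h1 : |deriv Real.smoothTransition (t - R₁) * l t + θ t * deriv l t| ≤
          (C + s / 2) * B := by
        refine (abs_add_le _ _).trans ?_
        rw [abs_mul, abs_mul, abs_of_nonneg (hl0 t), abs_of_nonneg (hθ0 t)]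
        have hB := hlB t ht
        calc _ ≤ C * l t + 1 * (s / 2 * l t) := by
              gcongr
              · exact hl0 t
              · exact hC _
              · exact hθ1 t
              · exact hl' t
          _ = (C + s / 2) * l t := by ring
          _ ≤ _ := by gcongr
      have h2 := sq_le_sq' (by linarith [abs_le.1 h1]) (abs_le.1 h1).2
      have : 0 ≤ s ^ 2 / 4 * (θ t * l t) ^ 2 := by positivity
      linarith
    · rw [indicator_of_notMem (by simpa using ht), add_zero]
      have e1 : θ =ᶠ[𝓝 t] fun _ => 1 := by
        filter_upwards [Ioi_mem_nhds ht] with y hy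
        exact Real.smoothTransition.one_of_one_le (by
          have := mem_Ioi.1 hy
          linarith)
      have e2 : deriv Real.smoothTransition (t - R₁) = 0 := by
        rw [← (hθd t).deriv, e1.deriv_eq]; simp
      have e3 := e1.eq_of_nhds
      rw [e2, e3, zero_mul, zero_add, one_mul, one_mul, ← sq_abs]
      calc _ ≤ (s / 2 * l t) ^ 2 := by
            gcongr
            exact hl' t
        _ = _ := by ring
  have hindi : Integrable ((Iic (R₁ + 1)).indicator fun _ => ((C + s / 2) * B) ^ 2) m :=
    (integrable_indicator_iff measurableSet_Iic).2 (integrableOn_const (hfin _).ne)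
  have hbi := (hfi.const_mul (s ^ 2 / 4)).add hindi
  have hfi' : Integrable (fun t => deriv (fun t => θ t * l t) t ^ 2) m := by
    refine hbi.mono' (((hθc.mul hl).continuous_deriv le_rfl).pow 2).aestronglyMeasurable
      (Eventually.of_forall fun t => ?_)
    rw [Real.norm_eq_abs, abs_of_nonneg (sq_nonneg _)]
    exact hbound t
  have main := integral_sq_le_of_forall_compact_support hR h (hθc.mul hl) (fun t ht => by
    have : θ t = 0 := Real.smoothTransition.zero_of_nonpos (by linarith)
    rw [this, zero_mul]) hfi hfi'
  have h2 := integral_mono hfi' hbi hbound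
  simp only [Pi.add_apply] at h2
  rw [integral_add (hfi.const_mul _) hindi, integral_const_mul, integral_indicator measurableSet_Iic,
    setIntegral_const, smul_eq_mul] at h2
  have h3 : ∫ t in Ici (R₁ + 1), l t ^ 2 ∂m ≤ ∫ t, (θ t * l t) ^ 2 ∂m := by
    calc _ = ∫ t in Ici (R₁ + 1), (θ t * l t) ^ 2 ∂m := by
          refine setIntegral_congr_fun measurableSet_Ici fun t ht => ?_
          have : θ t = 1 := Real.smoothTransition.one_of_one_le (by
            have := mem_Ici.1 ht
            linarith)
          simp [this]
      _ ≤ _ := setIntegral_le_integral hfi (Eventually.of_forall fun t => sq_nonneg _)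
  have h4 := mul_le_mul_of_nonneg_left h3 (sub_nonneg.2 hα)
  nlinarith


/-- On the unit interval from `N + k` the mass is at most `e^{s'(N+k+1)}` and `u` is at most `c
e^{-s(N+k)}`, so the integrals over these intervals are dominated by a geometric series of ratio
`e^{-(s-s')}`. -/
theorem integrable_of_le_exp_neg {m : Measure ℝ} {s s' B : ℝ} (hs : 0 ≤ s) (hss : s' < s)
    (hV : ∀ᶠ r in atTop, m (Iio r) ≤ ENNReal.ofReal (Real.exp (s' * r))) {u : ℝ → ℝ}
    (hfin : ∀ r, m (Iic r) < ⊤)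
    (hu : Continuous u) (hu0 : ∀ t, 0 ≤ u t) (huB : ∀ t, u t ≤ B) {c : ℝ}
    (huexp : ∀ t, u t ≤ c * Real.exp (-s * t)) : Integrable u m := by
  have hc : 0 ≤ c := by
    have := (hu0 0).trans (huexp 0)
    simpa using this
  obtain ⟨N, hN⟩ := eventually_atTop.1 hV
  have h1 : IntegrableOn u (Iic N) m :=
    Measure.integrableOn_of_bounded (M := B) (hfin N).ne hu.aestronglyMeasurable
      (Eventually.of_forall fun t => by
        rw [Real.norm_eq_abs, abs_of_nonneg (hu0 t)]
        exact huB t)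
  have h2 : IntegrableOn u (Ici N) m := by
    refine ⟨hu.aestronglyMeasurable, ?_⟩
    rw [hasFiniteIntegral_iff_enorm]
    have hcov : Ici N ⊆ ⋃ k : ℕ, Ico (N + k) (N + k + 1) := by
      intro t ht
      refine mem_iUnion.2 ⟨⌊t - N⌋₊, ?_, ?_⟩
      · have := Nat.floor_le (sub_nonneg.2 (mem_Ici.1 ht))
        linarith
      · have := Nat.lt_floor_add_one (t - N)
        linarith
    have hpiece : ∀ k : ℕ, ∫⁻ t in Ico (N + k) (N + k + 1), ‖u t‖ₑ ∂m ≤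
        ENNReal.ofReal (c * Real.exp (s' * (N + 1) - s * N)) *
          ENNReal.ofReal (Real.exp (-(s - s'))) ^ k := by
      intro k
      calc _ ≤ ∫⁻ t in Ico (N + k) (N + k + 1), ENNReal.ofReal (c * Real.exp (-s * (N + k))) ∂m := by
              refine setLIntegral_mono measurable_const fun t ht => ?_
              rw [Real.enorm_of_nonneg (hu0 t)]
              refine ENNReal.ofReal_le_ofReal ((huexp t).trans ?_)
              gcongr c * Real.exp ?_
              nlinarith [ht.1]
          _ ≤ ENNReal.ofReal (c * Real.exp (-s * (N + k))) *
                ENNReal.ofReal (Real.exp (s' * (N + k + 1))) := by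
              rw [setLIntegral_const]
              gcongr
              exact (measure_mono fun t ht => ht.2).trans (hN _ (by
                have := (Nat.cast_nonneg k : (0 : ℝ) ≤ k)
                linarith))
          _ = _ := by
              rw [← ENNReal.ofReal_pow (Real.exp_pos _).le, ← ENNReal.ofReal_mul (by positivity),
                ← ENNReal.ofReal_mul (by positivity), ← Real.exp_nat_mul, mul_assoc, mul_assoc,
                ← Real.exp_add, ← Real.exp_add]
              congr 3
              ring
    refine (lintegral_mono_set hcov).trans_lt ((lintegral_iUnion_le _ _).trans_lt ?_)
    refine (ENNReal.tsum_le_tsum hpiece).trans_lt ?_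
    rw [ENNReal.tsum_mul_left, ENNReal.tsum_geometric]
    refine ENNReal.mul_lt_top ENNReal.ofReal_lt_top (ENNReal.inv_lt_top.2 (tsub_pos_of_lt ?_))
    rw [← ENNReal.ofReal_one]
    exact (ENNReal.ofReal_lt_ofReal_iff one_pos).2 (by
      rw [Real.exp_lt_one_iff]
      linarith)
  have := h1.union h2
  rwa [Iic_union_Ici, integrableOn_univ] at this

/-- Brooks' bound when the total mass is infinite. -/
theorem le_sq_div_four_of_measure_univ_eq_top {m : Measure ℝ} {α R₀ s s' : ℝ} (hs : 0 < s)
    (hss : s' < s) (hfin : ∀ r, m (Iic r) < ⊤) (hm : m univ = ⊤)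
    (hV : ∀ᶠ r in atTop, m (Iio r) ≤ ENNReal.ofReal (Real.exp (s' * r)))
    (h : ∀ f : ℝ → ℝ, ContDiff ℝ 1 f → HasCompactSupport f → tsupport f ⊆ Ioi R₀ →
      α * ∫ t, f t ^ 2 ∂m ≤ ∫ t, deriv f t ^ 2 ∂m) : α ≤ s ^ 2 / 4 := by
  by_contra hα
  rw [not_le] at hα
  obtain ⟨D, hD⟩ := integral_sq_le_of_deriv_le (B := 1) (lt_add_one R₀) hfin hs.le hα.le h
  -- A smooth substitute for `min(1, e^{-s(t-j)/2})`, with `l' = -(s/2) l (1 - l)`.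
  let l : ℝ → ℝ → ℝ := fun j t => (1 + Real.exp (s / 2 * (t - j)))⁻¹
  have hpos : ∀ j t, 0 < 1 + Real.exp (s / 2 * (t - j)) := fun j t => by positivity
  have hlc : ∀ j, ContDiff ℝ 1 (l j) := fun j => by
    refine ContDiff.inv (by fun_prop) fun t => (hpos j t).ne'
  have hld : ∀ j t, HasDerivAt (l j) (-(Real.exp (s / 2 * (t - j)) * (s / 2)) /
      (1 + Real.exp (s / 2 * (t - j))) ^ 2) t := by
    intro j t
    have h1 : HasDerivAt (fun t => s / 2 * (t - j)) (s / 2) t := by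
      simpa using ((hasDerivAt_id t).sub_const j).const_mul (s / 2)
    exact (h1.exp.const_add 1).inv (hpos j t).ne'
  have hl' : ∀ j t, |deriv (l j) t| ≤ s / 2 * l j t := by
    intro j t
    have he := Real.exp_pos (s / 2 * (t - j))
    rw [(hld j t).deriv, abs_div, abs_neg, abs_of_nonneg (by positivity),
      abs_of_nonneg (by positivity)]
    simp only [l]
    rw [div_le_iff₀ (by positivity)]
    field_simp
    nlinarith
  have hl0 : ∀ j t, 0 ≤ l j t := fun j t => (inv_pos.2 (hpos j t)).le
  have hl1 : ∀ j t, l j t ≤ 1 := fun j t => inv_le_one_of_one_le₀ (by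
    linarith [Real.exp_pos (s / 2 * (t - j))])
  have hli : ∀ j, Integrable (fun t => l j t ^ 2) m := by
    intro j
    refine integrable_of_le_exp_neg (B := 1) (c := Real.exp (s * j)) hs.le hss hV hfin
      ((hlc j).continuous.pow 2) (fun t => sq_nonneg _)
      (fun t => pow_le_one₀ (hl0 j t) (hl1 j t)) fun t => ?_
    have h1 : l j t ≤ Real.exp (-(s / 2 * (t - j))) := by
      rw [Real.exp_neg]
      exact inv_anti₀ (Real.exp_pos _) (by linarith)
    calc l j t ^ 2 ≤ Real.exp (-(s / 2 * (t - j))) ^ 2 := by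
          gcongr
      _ = _ := by
          rw [← Real.exp_nat_mul, ← Real.exp_add]
          congr 1
          push_cast
          ring
  set R := R₀ + 1 + 1 with hR
  -- Here `l j ≥ 1/2` on `[R, j]`, while `D` does not depend on `j`; letting `j → ∞` makes the mass
  -- of `[R, ∞)` finite.
  have hbound : ∀ j : ℝ, m.real (Icc R j) ≤ 4 * D / (α - s ^ 2 / 4) := by
    intro j
    have h1 := hD (l j) (hlc j) (hl0 j) (hl' j) (fun t _ => hl1 j t) (hli j)
    have h2 : m.real (Icc R j) * (1 / 4) ≤ ∫ t in Ici R, l j t ^ 2 ∂m := by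
      have hfinI : m (Icc R j) ≠ ⊤ :=
        ((measure_mono Icc_subset_Iic_self).trans_lt (hfin j)).ne
      calc _ = ∫ t in Icc R j, (1 / 4 : ℝ) ∂m := by
            rw [setIntegral_const, smul_eq_mul]
        _ ≤ ∫ t in Icc R j, l j t ^ 2 ∂m := by
            refine setIntegral_mono_on (integrableOn_const hfinI) (hli j).integrableOn
              measurableSet_Icc fun t ht => ?_
            have h3 : 1 / 2 ≤ l j t := by
              simp only [l]
              rw [one_div]
              refine inv_anti₀ (hpos j t) ?_
              have : Real.exp (s / 2 * (t - j)) ≤ 1 := by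
                rw [Real.exp_le_one_iff]
                nlinarith [ht.2]
              linarith
            nlinarith
        _ ≤ _ := setIntegral_mono_set (hli j).integrableOn
            (Eventually.of_forall fun t => sq_nonneg _)
            (Eventually.of_forall fun t ht => ht.1)
    rw [le_div_iff₀ (sub_pos.2 hα)]
    nlinarith [mul_le_mul_of_nonneg_left h2 (sub_pos.2 hα).le]
  have hle : m (Ici R) ≤ ENNReal.ofReal (4 * D / (α - s ^ 2 / 4)) := by
    have hU : Ici R = ⋃ j : ℕ, Icc R (j : ℝ) := by
      ext t
      simp only [mem_Ici, mem_iUnion, mem_Icc]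
      exact ⟨fun ht => (exists_nat_ge t).imp fun j hj => ⟨ht, hj⟩, fun ⟨j, hj⟩ => hj.1⟩
    have hmono : Monotone fun j : ℕ => Icc R (j : ℝ) := fun i j hij =>
      Icc_subset_Icc_right (by exact_mod_cast hij)
    rw [hU, hmono.measure_iUnion]
    refine iSup_le fun j => ?_
    rw [← ENNReal.ofReal_toReal ((measure_mono (Icc_subset_Iic_self (a := R))).trans_lt
      (hfin j)).ne]
    exact ENNReal.ofReal_le_ofReal (hbound j)
  refine (measure_union_lt_top (hfin R) (hle.trans_lt ENNReal.ofReal_lt_top)).ne ?_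
  rw [Iic_union_Ici, hm]

/-- Brooks' bound when the total mass is finite. -/
theorem le_sq_div_four_of_measure_univ_ne_top {m : Measure ℝ} {α R₀ s s' : ℝ} (hs : 0 < s)
    (hss : s' < s) (hm : m univ ≠ ⊤)
    (hV : ∀ᶠ r in atTop, ENNReal.ofReal (Real.exp (-(s' * r))) ≤ m (Ici r))
    (h : ∀ f : ℝ → ℝ, ContDiff ℝ 1 f → HasCompactSupport f → tsupport f ⊆ Ioi R₀ →
      α * ∫ t, f t ^ 2 ∂m ≤ ∫ t, deriv f t ^ 2 ∂m) : α ≤ s ^ 2 / 4 := by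
  by_contra hα
  rw [not_le] at hα
  have hmf : IsFiniteMeasure m := ⟨lt_top_iff_ne_top.2 hm⟩
  set R := R₀ + 1 + 1 with hR
  -- `B` bounds `e^{st/2}`, and hence every `l j` below, on `t ≤ R`.
  obtain ⟨D, hD⟩ := integral_sq_le_of_deriv_le (B := Real.exp (s / 2 * R)) (lt_add_one R₀)
    (fun r => measure_lt_top m _) hs.le hα.le h
  -- The exponential `e^{st/2}`, saturating at height `e^{sj/2}` beyond `j`; being bounded, it is
  -- square integrable for the finite measure `m`.
  let l : ℝ → ℝ → ℝ := fun j t => Real.exp (s / 2 * t) * (1 + Real.exp (s / 2 * (t - j)))⁻¹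
  have hpos : ∀ j t, 0 < 1 + Real.exp (s / 2 * (t - j)) := fun j t => by positivity
  have hlc : ∀ j, ContDiff ℝ 1 (l j) := fun j => by
    refine ContDiff.mul (by fun_prop) (ContDiff.inv (by fun_prop) fun t => (hpos j t).ne')
  have hld : ∀ j t, HasDerivAt (l j) (Real.exp (s / 2 * t) * (s / 2) *
      (1 + Real.exp (s / 2 * (t - j)))⁻¹ + Real.exp (s / 2 * t) *
      (-(Real.exp (s / 2 * (t - j)) * (s / 2)) / (1 + Real.exp (s / 2 * (t - j))) ^ 2)) t := by
    intro j t
    have h1 : HasDerivAt (fun t => s / 2 * (t - j)) (s / 2) t := by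
      simpa using ((hasDerivAt_id t).sub_const j).const_mul (s / 2)
    have h2 : HasDerivAt (fun t => s / 2 * t) (s / 2) t := by
      simpa using (hasDerivAt_id t).const_mul (s / 2)
    exact h2.exp.mul ((h1.exp.const_add 1).inv (hpos j t).ne')
  have hl0 : ∀ j t, 0 ≤ l j t := fun j t =>
    mul_nonneg (Real.exp_pos _).le (inv_pos.2 (hpos j t)).le
  have hl' : ∀ j t, |deriv (l j) t| ≤ s / 2 * l j t := by
    intro j t
    have he := Real.exp_pos (s / 2 * (t - j))
    have hp := hpos j t
    have e : deriv (l j) t = s / 2 * l j t * (1 + Real.exp (s / 2 * (t - j)))⁻¹ := by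
      rw [(hld j t).deriv]
      simp only [l]
      field_simp
      ring
    rw [e, abs_of_nonneg (mul_nonneg (mul_nonneg (by positivity) (hl0 j t)) (by positivity))]
    exact mul_le_of_le_one_right (mul_nonneg (by positivity) (hl0 j t))
      (inv_le_one_of_one_le₀ (by linarith))
  have hl1 : ∀ j t, l j t ≤ Real.exp (s / 2 * t) := fun j t =>
    mul_le_of_le_one_right (Real.exp_pos _).le (inv_le_one_of_one_le₀ (by
      linarith [Real.exp_pos (s / 2 * (t - j))]))
  have hl2 : ∀ j t, l j t ≤ Real.exp (s / 2 * j) := by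
    intro j t
    have e : Real.exp (s / 2 * t) = Real.exp (s / 2 * j) * Real.exp (s / 2 * (t - j)) := by
      rw [← Real.exp_add]
      congr 1
      ring
    simp only [l]
    rw [← div_eq_mul_inv, div_le_iff₀ (hpos j t), e]
    gcongr
    linarith
  have hli : ∀ j, Integrable (fun t => l j t ^ 2) m := by
    intro j
    refine Integrable.of_bound ((hlc j).continuous.pow 2).aestronglyMeasurable
      (Real.exp (s / 2 * j) ^ 2) (Eventually.of_forall fun t => ?_)
    rw [Real.norm_eq_abs, abs_of_nonneg (sq_nonneg _)]
    gcongr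
    exact hl2 j t
  have hbound : ∀ j ≥ R, (α - s ^ 2 / 4) * (m.real (Ici j) * (Real.exp (s * j) / 4)) ≤ D := by
    intro j hj
    have h1 := hD (l j) (hlc j) (hl0 j) (hl' j) (fun t ht => (hl1 j t).trans (by gcongr)) (hli j)
    refine le_trans (mul_le_mul_of_nonneg_left ?_ (sub_pos.2 hα).le) h1
    calc _ = ∫ t in Ici j, Real.exp (s * j) / 4 ∂m := by
          rw [setIntegral_const, smul_eq_mul]
      _ ≤ ∫ t in Ici j, l j t ^ 2 ∂m := by
          refine setIntegral_mono_on (integrable_const _) (hli j).integrableOn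
            measurableSet_Ici fun t ht => ?_
          have e : Real.exp (s / 2 * t) = Real.exp (s / 2 * j) * Real.exp (s / 2 * (t - j)) := by
            rw [← Real.exp_add]
            congr 1
            ring
          have h3 : Real.exp (s / 2 * j) / 2 ≤ l j t := by
            have : 1 ≤ Real.exp (s / 2 * (t - j)) :=
              Real.one_le_exp (mul_nonneg (by positivity) (sub_nonneg.2 ht))
            simp only [l]
            rw [← div_eq_mul_inv, le_div_iff₀ (hpos j t), e]
            nlinarith [Real.exp_pos (s / 2 * j)]
          calc Real.exp (s * j) / 4 = (Real.exp (s / 2 * j) / 2) ^ 2 := by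
                rw [div_pow, ← Real.exp_nat_mul]
                congr 2
                · push_cast
                  ring
                · norm_num
            _ ≤ _ := by gcongr
      _ ≤ _ := setIntegral_mono_set (hli j).integrableOn
          (Eventually.of_forall fun t => sq_nonneg _)
          (Eventually.of_forall fun t ht => hj.trans ht)
  -- Together with `m [j, ∞) ≥ e^{-s'j}`, the bound just proved would keep `e^{(s-s')j}` bounded as
  -- `j → ∞`.
  have htend : Tendsto (fun j => (α - s ^ 2 / 4) / 4 * Real.exp ((s - s') * j)) atTop atTop :=
    (Real.tendsto_exp_atTop.comp (tendsto_id.const_mul_atTop (sub_pos.2 hss))).const_mul_atTop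
      (by linarith)
  obtain ⟨j, hj1, hj2, hj3⟩ :=
    ((htend.eventually_gt_atTop D).and (hV.and (eventually_ge_atTop R))).exists
  have h1 := hbound j hj3
  have h2 : Real.exp (-(s' * j)) ≤ m.real (Ici j) :=
    (ENNReal.ofReal_le_iff_le_toReal (measure_ne_top m _)).1 hj2
  have h3 : Real.exp ((s - s') * j) = Real.exp (-(s' * j)) * Real.exp (s * j) := by
    rw [← Real.exp_add]
    congr 1
    ring
  have h4 : (α - s ^ 2 / 4) / 4 * Real.exp ((s - s') * j) ≤
      (α - s ^ 2 / 4) * (m.real (Ici j) * (Real.exp (s * j) / 4)) := by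
    rw [h3]
    have := mul_le_mul_of_nonneg_right h2 (Real.exp_pos (s * j)).le
    have := mul_le_mul_of_nonneg_left this (sub_pos.2 hα).le
    linarith
  linarith

end OneDimensional

/-! ### Differentials in the preferred charts. -/

section Charts

variable {n : ℕ} {M : Type*} [TopologicalSpace M] [ChartedSpace (Eucl n) M]

theorem exists_ball_chart (x₀ : M) {s : Set M} (hs : s ∈ 𝓝 x₀) :
    ∃ δ > 0, Metric.ball (chartAt (Eucl n) x₀ x₀) δ ⊆ (chartAt (Eucl n) x₀).target ∧
      ∀ y ∈ Metric.ball (chartAt (Eucl n) x₀ x₀) δ, (chartAt (Eucl n) x₀).symm y ∈ s := by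
  have h1 : (chartAt (Eucl n) x₀).target ∈ 𝓝 (chartAt (Eucl n) x₀ x₀) :=
    (chartAt (Eucl n) x₀).open_target.mem_nhds (mem_chart_target _ _)
  have h2 : (chartAt (Eucl n) x₀).symm ⁻¹' s ∈ 𝓝 (chartAt (Eucl n) x₀ x₀) := by
    refine ((chartAt (Eucl n) x₀).continuousAt_symm (mem_chart_target _ _)).preimage_mem_nhds ?_
    rwa [(chartAt (Eucl n) x₀).left_inv (mem_chart_source _ _)]
  obtain ⟨δ, hδ, h⟩ := Metric.mem_nhds_iff.1 (inter_mem h1 h2)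
  exact ⟨δ, hδ, fun y hy => (h hy).1, fun y hy => (h hy).2⟩

variable [IsManifold (𝓡 n) ∞ M]

theorem mdifferentiable_chart' (x₀ : M) :
    (chartAt (Eucl n) x₀).MDifferentiable (𝓡 n) (𝓡 n) :=
  haveI : IsManifold (𝓡 n) 1 M := IsManifold.of_le (n := ∞) (by simp)
  mdifferentiable_chart x₀

theorem chartDeriv_chartSymmDeriv {x₀ : M} {y : Eucl n} (hy : y ∈ (chartAt (Eucl n) x₀).target)
    (v : Eucl n) :
    chartDeriv n x₀ ((chartAt (Eucl n) x₀).symm y) (chartSymmDeriv n x₀ y v) = v := by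
  have := (mdifferentiable_chart' x₀).comp_symm_deriv hy
  exact congrArg (fun L => L v) this

/-- In finite dimension a right inverse is a left inverse; the tangent spaces unfold to `Eucl n`, so
both differentials can be read as endomorphisms of one space. -/
theorem chartSymmDeriv_chartDeriv {x₀ : M} {y : Eucl n} (hy : y ∈ (chartAt (Eucl n) x₀).target)
    (v : TangentSpace (𝓡 n) ((chartAt (Eucl n) x₀).symm y)) :
    chartSymmDeriv n x₀ y (chartDeriv n x₀ ((chartAt (Eucl n) x₀).symm y) v) = v := by
  let D : Eucl n →ₗ[ℝ] Eucl n := (chartDeriv n x₀ ((chartAt (Eucl n) x₀).symm y)).toLinearMap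
  let S : Eucl n →ₗ[ℝ] Eucl n := (chartSymmDeriv n x₀ y).toLinearMap
  have h : D * S = 1 := LinearMap.ext fun w => chartDeriv_chartSymmDeriv hy w
  have h' := mul_eq_one_comm.1 h
  exact LinearMap.congr_fun h' v

theorem cotangent_eq_comp_chartDeriv {x₀ : M} {y : Eucl n}
    (hy : y ∈ (chartAt (Eucl n) x₀).target)
    (ξ : Cotangent n ((chartAt (Eucl n) x₀).symm y)) :
    (ξ.comp (chartSymmDeriv n x₀ y)).comp (chartDeriv n x₀ ((chartAt (Eucl n) x₀).symm y)) = ξ := by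
  ext v
  exact congrArg ξ (chartSymmDeriv_chartDeriv hy v)

theorem hasMFDerivAt_of_comp_chart_symm {x₀ : M} {y : Eucl n}
    (hy : y ∈ (chartAt (Eucl n) x₀).target) {u : M → ℝ} {F : Eucl n → ℝ} {L : Eucl n →L[ℝ] ℝ}
    (hF : HasFDerivAt F L y)
    (hu : ∀ᶠ z in 𝓝 y, u ((chartAt (Eucl n) x₀).symm z) = F z) :
    HasMFDerivAt (𝓡 n) 𝓘(ℝ, ℝ) u ((chartAt (Eucl n) x₀).symm y)
      (L.comp (chartDeriv n x₀ ((chartAt (Eucl n) x₀).symm y)) :) := by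
  set e := chartAt (Eucl n) x₀ with he
  have hx : e.symm y ∈ e.source := e.map_target hy
  have h1 : HasMFDerivAt (𝓡 n) (𝓡 n) e (e.symm y) (chartDeriv n x₀ (e.symm y)) :=
    ((mdifferentiable_chart' x₀).mdifferentiableAt hx).hasMFDerivAt
  have hF' : HasFDerivAt F L (e (e.symm y)) := by rwa [e.right_inv hy]
  have h2 := HasMFDerivAt.comp (e.symm y) hF'.hasMFDerivAt h1
  refine h2.congr_of_eventuallyEq ?_
  have h3 : Tendsto e (𝓝 (e.symm y)) (𝓝 y) := by
    have := (e.continuousAt hx).tendsto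
    rwa [e.right_inv hy] at this
  filter_upwards [h3.eventually hu, e.open_source.mem_nhds hx] with z hz hzs
  rw [e.left_inv hzs] at hz
  exact hz

theorem HasMFDerivAt.hasFDerivAt_comp_chart_symm {x₀ : M} {y : Eucl n}
    (hy : y ∈ (chartAt (Eucl n) x₀).target) {u : M → ℝ}
    {L : Cotangent n ((chartAt (Eucl n) x₀).symm y)}
    (hu : HasMFDerivAt (𝓡 n) 𝓘(ℝ, ℝ) u ((chartAt (Eucl n) x₀).symm y) L) :
    HasFDerivAt (fun z => u ((chartAt (Eucl n) x₀).symm z)) (L.comp (chartSymmDeriv n x₀ y)) y := by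
  have h1 : HasMFDerivAt (𝓡 n) (𝓡 n) (chartAt (Eucl n) x₀).symm y (chartSymmDeriv n x₀ y) :=
    ((mdifferentiable_chart' x₀).symm.mdifferentiableAt hy).hasMFDerivAt
  exact (HasMFDerivAt.comp y hu h1).hasFDerivAt

end Charts

/-! ### The Agmon distance: finiteness, continuity, compact balls. -/

section AgmonDistance

variable {n : ℕ} {M : Type*} [TopologicalSpace M] [ChartedSpace (Eucl n) M]
  (A : CoeffField n M) (W : M → ℝ)

/-- The extended norm of the Agmon metric on the tangent spaces. -/
abbrev agmonENorm (z : M) : ENorm (TangentSpace (𝓡 n) z) :=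
  ⟨fun v => ENNReal.ofReal (agmonNorm A W z v)⟩

/-- The Agmon length of a path. -/
def agmonLength (γ : ℝ → M) (a b : ℝ) : ℝ≥0∞ :=
  letI := agmonENorm A W
  pathELength (𝓡 n) γ a b

theorem agmonNorm_smul (x : M) (r : ℝ) (v : TangentSpace (𝓡 n) x) :
    agmonNorm A W x (r • v) = |r| * agmonNorm A W x v := by
  unfold agmonNorm
  have h : W x * (A x).symm (r • v) (r • v) = r ^ 2 * (W x * (A x).symm v v) := by
    simp only [map_smul, _root_.smul_apply, smul_eq_mul]
    ring
  rw [h, Real.sqrt_mul (sq_nonneg _), Real.sqrt_sq_eq_abs]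

theorem agmonENormSMulClass (z : M) :
    letI := agmonENorm A W
    ENormSMulClass ℝ (TangentSpace (𝓡 n) z) := by
  letI := agmonENorm A W
  refine ⟨fun r v => ?_⟩
  change ENNReal.ofReal (agmonNorm A W z (r • v)) = ‖r‖ₑ * ENNReal.ofReal (agmonNorm A W z v)
  rw [agmonNorm_smul, ENNReal.ofReal_mul (abs_nonneg _), ← Real.enorm_eq_ofReal_abs]

variable {A W}

theorem agmonEDist_self (x : M) : agmonEDist A W x x = 0 :=
  letI := agmonENorm A W
  haveI := agmonENormSMulClass A W
  riemannianEDist_self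

theorem agmonEDist_comm (x y : M) : agmonEDist A W x y = agmonEDist A W y x :=
  letI := agmonENorm A W
  haveI := agmonENormSMulClass A W
  riemannianEDist_comm

theorem agmonEDist_triangle (x y z : M) :
    agmonEDist A W x z ≤ agmonEDist A W x y + agmonEDist A W y z :=
  letI := agmonENorm A W
  haveI := agmonENormSMulClass A W
  riemannianEDist_triangle

theorem agmonEDist_le_agmonLength {γ : ℝ → M} {a b : ℝ}
    (hγ : ContMDiffOn 𝓘(ℝ, ℝ) (𝓡 n) 1 γ (Icc a b)) (hab : a ≤ b) :
    agmonEDist A W (γ a) (γ b) ≤ agmonLength A W γ a b :=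
  letI := agmonENorm A W
  haveI := agmonENormSMulClass A W
  riemannianEDist_le_pathELength hγ rfl rfl hab

theorem exists_agmonLength_lt {x y : M} {r : ℝ≥0∞} (h : agmonEDist A W x y < r) :
    ∃ γ : ℝ → M, γ 0 = x ∧ γ 1 = y ∧ ContMDiffOn 𝓘(ℝ, ℝ) (𝓡 n) 1 γ (Icc 0 1) ∧
      agmonLength A W γ 0 1 < r :=
  letI := agmonENorm A W
  exists_lt_of_riemannianEDist_lt h

theorem agmonLength_add (γ : ℝ → M) {a b c : ℝ} (h : a ≤ b) (h' : b ≤ c) :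
    agmonLength A W γ a b + agmonLength A W γ b c = agmonLength A W γ a c :=
  letI := agmonENorm A W
  pathELength_add h h'

theorem agmonLength_eq (γ : ℝ → M) (a b : ℝ) :
    agmonLength A W γ a b = ∫⁻ t in Icc a b,
      ENNReal.ofReal (agmonNorm A W (γ t) (mfderiv 𝓘(ℝ, ℝ) (𝓡 n) γ t (1 : ℝ))) :=
  letI := agmonENorm A W
  pathELength_eq_lintegral_mfderiv_Icc

/-- If the endpoint is farther than `a`, a path of length below `a + b` has a point at distance
exactly `a`, by the intermediate value theorem. The piece before it has length at least `a`, so the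
rest is shorter than `b`. This is the length-space condition required by Hopf–Rinow. -/
theorem exists_agmonEDist_le_and_lt {x y : M} (hc : Continuous (agmonEDist A W x)) {a b : ℝ≥0∞}
    (ha : a ≠ ⊤) (hb : 0 < b) (h : agmonEDist A W x y < a + b) :
    ∃ z, agmonEDist A W x z ≤ a ∧ agmonEDist A W z y < b := by
  obtain ⟨γ, rfl, rfl, hγ, hL⟩ := exists_agmonLength_lt h
  rcases le_or_gt (agmonEDist A W (γ 0) (γ 1)) a with h1 | h1
  · exact ⟨γ 1, h1, by rwa [agmonEDist_self]⟩
  have hcon : ContinuousOn (fun t => agmonEDist A W (γ 0) (γ t)) (Icc 0 1) :=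
    hc.comp_continuousOn hγ.continuousOn
  obtain ⟨t, ht, hta⟩ := intermediate_value_Icc zero_le_one hcon
    (show a ∈ Icc _ _ from ⟨by simp [agmonEDist_self], h1.le⟩)
  have hta : agmonEDist A W (γ 0) (γ t) = a := hta
  refine ⟨γ t, hta.le, ?_⟩
  have h2 := agmonEDist_le_agmonLength (A := A) (W := W)
    (hγ.mono (Icc_subset_Icc_right ht.2)) ht.1
  have h3 := agmonEDist_le_agmonLength (A := A) (W := W)
    (hγ.mono (Icc_subset_Icc_left ht.1)) ht.2
  rw [hta] at h2
  rw [← agmonLength_add γ ht.1 ht.2] at hL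
  refine h3.trans_lt ?_
  exact (ENNReal.add_lt_add_iff_left ha).1 ((add_le_add_left h2 _).trans_lt hL)

variable [IsManifold (𝓡 n) ∞ M]

/-- The segment that is straight in coordinates is a competitor for the infimum. The integral is
kept, and not merely a bound on it, because the eikonal inequality differentiates it. -/
theorem agmonEDist_chart_line_le (x₀ : M) {y v : Eucl n} {t : ℝ} (ht : 0 ≤ t)
    (h : ∀ s ∈ Icc 0 t, y + s • v ∈ (chartAt (Eucl n) x₀).target) :
    agmonEDist A W ((chartAt (Eucl n) x₀).symm y) ((chartAt (Eucl n) x₀).symm (y + t • v)) ≤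
      ∫⁻ s in Icc 0 t, ENNReal.ofReal (agmonNorm A W ((chartAt (Eucl n) x₀).symm (y + s • v))
        (chartSymmDeriv n x₀ (y + s • v) v)) := by
  haveI : IsManifold (𝓡 n) 1 M := IsManifold.of_le (n := ∞) (by simp)
  set γ : ℝ → M := fun s => (chartAt (Eucl n) x₀).symm (y + s • v) with hγ
  have hl : ∀ s : ℝ, HasFDerivAt (fun s : ℝ => y + s • v)
      ((1 : ℝ →L[ℝ] ℝ).smulRight v) s := fun s =>
    ((hasFDerivAt_id s).smul_const v).const_add y
  have hc : ContMDiffOn 𝓘(ℝ, ℝ) (𝓡 n) 1 γ (Icc 0 t) := by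
    refine (contMDiffOn_chart_symm (x := x₀)).comp (t := (chartAt (Eucl n) x₀).target) ?_ h
    exact contMDiffOn_iff_contDiffOn.2 (by fun_prop)
  have h1 := agmonEDist_le_agmonLength (A := A) (W := W) hc ht
  rw [agmonLength_eq] at h1
  have h0 : γ 0 = (chartAt (Eucl n) x₀).symm y := by simp [hγ]
  rw [h0] at h1
  refine h1.trans (le_of_eq ?_)
  refine setLIntegral_congr_fun measurableSet_Icc fun s hs => ?_
  have h2 : HasMFDerivAt (𝓡 n) (𝓡 n) (chartAt (Eucl n) x₀).symm (y + s • v)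
      (chartSymmDeriv n x₀ (y + s • v)) :=
    ((mdifferentiable_chart' x₀).symm.mdifferentiableAt (h s hs)).hasMFDerivAt
  have h3 := HasMFDerivAt.comp s h2 (hl s).hasMFDerivAt
  have h4 : mfderiv 𝓘(ℝ, ℝ) (𝓡 n) γ s (1 : ℝ) = chartSymmDeriv n x₀ (y + s • v) v := by
    have h5 : mfderiv 𝓘(ℝ, ℝ) (𝓡 n) γ s = _ := h3.mfderiv
    rw [h5]
    change chartSymmDeriv n x₀ (y + s • v) ((1 : ℝ) • v) = _
    rw [one_smul]
  exact congrArg (fun w => ENNReal.ofReal (agmonNorm A W (γ s) w)) h4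

variable [MeasurableSpace M]

/-- The value at `x` of the quadratic form `⟨A⁻¹v, v⟩`, as a supremum over covectors. -/
theorem two_mul_sub_le_inverse (hA : IsEllipticField n A) (x : M) (v : TangentSpace (𝓡 n) x)
    (η : Cotangent n x) : 2 * η v - η (A x η) ≤ (A x).symm v v := by
  set ξ := (A x).symm v with hξ
  have hv : A x ξ = v := (A x).apply_symm_apply v
  have h1 : 0 ≤ (η - ξ) (A x (η - ξ)) := by
    by_cases h0 : η - ξ = 0
    · rw [h0]; simp
    · exact (hA.pos x _ h0).le
  have h2 := hA.symm x ξ η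
  simp only [map_sub, _root_.sub_apply] at h1
  rw [hv] at h1 h2
  linarith

theorem inverse_nonneg (hA : IsEllipticField n A) (x : M) (v : TangentSpace (𝓡 n) x) :
    0 ≤ (A x).symm v v := by
  have := two_mul_sub_le_inverse hA x v 0
  simpa using this

/-- A lower bound for `A` is an upper bound for `A⁻¹`: if `η` is the covector `A⁻¹v` in coordinates,
then `C⁻¹‖η‖² ≤ η v ≤ ‖η‖‖v‖`, hence `‖η‖ ≤ C‖v‖` and `⟨A⁻¹v, v⟩ ≤ C‖v‖²`. -/
theorem agmonNorm_chart_le (hA : IsEllipticField n A) {x₀ : M} {y : Eucl n}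
    (hy : y ∈ (chartAt (Eucl n) x₀).target) {C B : ℝ} (hC : 0 < C)
    (hb : ∀ η : Eucl n →L[ℝ] ℝ, C⁻¹ * ‖η‖ ^ 2 ≤
      (η.comp (chartDeriv n x₀ ((chartAt (Eucl n) x₀).symm y)))
        (A _ (η.comp (chartDeriv n x₀ ((chartAt (Eucl n) x₀).symm y)))))
    (hW : W ((chartAt (Eucl n) x₀).symm y) ≤ B) (hB : 0 ≤ B) (v : Eucl n) :
    agmonNorm A W ((chartAt (Eucl n) x₀).symm y) (chartSymmDeriv n x₀ y v) ≤ √(B * C) * ‖v‖ := by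
  set x := (chartAt (Eucl n) x₀).symm y with hx
  set ξ := (A x).symm (chartSymmDeriv n x₀ y v) with hξ
  have hv : A x ξ = chartSymmDeriv n x₀ y v := (A x).apply_symm_apply _
  set η : Eucl n →L[ℝ] ℝ := ξ.comp (chartSymmDeriv n x₀ y) with hη
  have h1 := hb η
  have e1 : η.comp (chartDeriv n x₀ x) = ξ := cotangent_eq_comp_chartDeriv hy ξ
  rw [e1, hv] at h1
  have e2 : ξ (chartSymmDeriv n x₀ y v) = η v := rfl
  have h3 : η v ≤ ‖η‖ * ‖v‖ := (le_abs_self _).trans (η.le_opNorm v)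
  have h4 : ‖η‖ ≤ C * ‖v‖ := by
    rcases (norm_nonneg η).eq_or_lt with h0 | h0
    · rw [← h0]; positivity
    · rw [e2] at h1
      have : C⁻¹ * ‖η‖ ^ 2 ≤ ‖η‖ * ‖v‖ := h1.trans h3
      have h5 : ‖η‖ * ‖η‖ ≤ ‖η‖ * (C * ‖v‖) := by
        have := mul_le_mul_of_nonneg_left this hC.le
        rw [← mul_assoc, mul_inv_cancel₀ hC.ne', one_mul] at this
        nlinarith
      exact le_of_mul_le_mul_left h5 h0
  have h6 : ξ (chartSymmDeriv n x₀ y v) ≤ C * ‖v‖ ^ 2 := by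
    rw [e2]
    refine h3.trans ?_
    nlinarith [norm_nonneg v]
  have h7 : 0 ≤ ξ (chartSymmDeriv n x₀ y v) := inverse_nonneg hA x _
  unfold agmonNorm
  rw [← Real.sqrt_sq (norm_nonneg v), ← Real.sqrt_mul (by positivity)]
  refine Real.sqrt_le_sqrt ?_
  calc W x * ξ (chartSymmDeriv n x₀ y v) ≤ B * ξ (chartSymmDeriv n x₀ y v) := by gcongr
    _ ≤ B * (C * ‖v‖ ^ 2) := by gcongr
    _ = _ := by ring

/-- The Agmon distance is locally Lipschitz in the charts. -/
theorem exists_agmonEDist_chart_le (hA : IsEllipticField n A) (hW : LocallyBounded W) (x₀ : M) :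
    ∃ δ > 0, ∃ C : ℝ≥0, Metric.ball (chartAt (Eucl n) x₀ x₀) δ ⊆ (chartAt (Eucl n) x₀).target ∧
      (∀ y ∈ Metric.ball (chartAt (Eucl n) x₀ x₀) δ, ∀ v : Eucl n,
        agmonNorm A W ((chartAt (Eucl n) x₀).symm y) (chartSymmDeriv n x₀ y v) ≤ C * ‖v‖) ∧
      ∀ y ∈ Metric.ball (chartAt (Eucl n) x₀ x₀) δ,
      ∀ y' ∈ Metric.ball (chartAt (Eucl n) x₀ x₀) δ,
        agmonEDist A W ((chartAt (Eucl n) x₀).symm y) ((chartAt (Eucl n) x₀).symm y') ≤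
          ENNReal.ofReal (C * ‖y' - y‖) := by
  obtain ⟨C, hC, hb⟩ := hA.bounds x₀
  obtain ⟨B, hB⟩ := hW x₀
  obtain ⟨δ, hδ, hsub, h⟩ := exists_ball_chart (n := n) x₀ (hb.and hB)
  have hB0 : 0 ≤ B := (abs_nonneg _).trans hB.self_of_nhds
  have hn : ∀ y ∈ Metric.ball (chartAt (Eucl n) x₀ x₀) δ, ∀ v : Eucl n,
        agmonNorm A W ((chartAt (Eucl n) x₀).symm y) (chartSymmDeriv n x₀ y v) ≤
        √(B * C) * ‖v‖ := fun y hy v =>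
    agmonNorm_chart_le hA (hsub hy) hC (fun η => ((h y hy).1 η).1)
      ((le_abs_self _).trans (h y hy).2) hB0 v
  refine ⟨δ, hδ, ⟨√(B * C), Real.sqrt_nonneg _⟩, hsub, hn, fun y hy y' hy' => ?_⟩
  have hseg : ∀ s ∈ Icc (0 : ℝ) 1, y + s • (y' - y) ∈ Metric.ball (chartAt (Eucl n) x₀ x₀) δ :=
    fun s hs => (convex_ball _ _).add_smul_sub_mem hy hy' hs
  have h1 := agmonEDist_chart_line_le (A := A) (W := W) x₀ zero_le_one
    (fun s hs => hsub (hseg s hs))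
  rw [one_smul, add_sub_cancel] at h1
  refine h1.trans ?_
  calc _ ≤ ∫⁻ s in Icc (0 : ℝ) 1, ENNReal.ofReal (√(B * C) * ‖y' - y‖) :=
        setLIntegral_mono measurable_const fun s hs =>
          ENNReal.ofReal_le_ofReal (hn _ (hseg s hs) _)
    _ = _ := by
        rw [setLIntegral_const, Real.volume_Icc, sub_zero, ENNReal.ofReal_one, mul_one]
        rfl

theorem exists_nhds_agmonEDist_lt (hA : IsEllipticField n A) (hW : LocallyBounded W) (x : M)
    {ε : ℝ≥0∞} (hε : 0 < ε) : ∀ᶠ z in 𝓝 x, agmonEDist A W x z < ε := by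
  obtain ⟨δ, hδ, C, hsub, -, h⟩ := exists_agmonEDist_chart_le hA hW x
  set e := chartAt (Eucl n) x with he
  have hx : x ∈ e.source := mem_chart_source _ _
  have h1 : Tendsto (fun z => ENNReal.ofReal (C * ‖e z - e x‖)) (𝓝 x) (𝓝 0) := by
    have : ContinuousAt (fun z => ENNReal.ofReal (C * ‖e z - e x‖)) x :=
      ENNReal.continuous_ofReal.continuousAt.comp
        (continuousAt_const.mul ((e.continuousAt hx).sub continuousAt_const).norm)
    simpa [ContinuousAt] using this
  filter_upwards [h1.eventually (gt_mem_nhds hε), e.open_source.mem_nhds hx,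
    (e.continuousAt hx).preimage_mem_nhds (Metric.ball_mem_nhds _ hδ)] with z hz hzs hzb
  have := h (e x) (Metric.mem_ball_self hδ) (e z) hzb
  rw [e.left_inv hx, e.left_inv hzs] at this
  exact this.trans_lt hz

/-- Nearby points are at finite distance, so the points at finite distance from `x` form a nonempty
clopen set. -/
theorem agmonEDist_ne_top [ConnectedSpace M] (hA : IsEllipticField n A) (hW : LocallyBounded W)
    (x y : M) : agmonEDist A W x y ≠ ⊤ := by
  have hcl : IsClopen {z | agmonEDist A W x z ≠ ⊤} := by
    constructor
    · rw [← isOpen_compl_iff, isOpen_iff_mem_nhds]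
      intro z hz
      filter_upwards [exists_nhds_agmonEDist_lt hA hW z ENNReal.zero_lt_top] with w hw hw'
      refine hz fun h => ?_
      have := agmonEDist_triangle (A := A) (W := W) x w z
      rw [h, agmonEDist_comm w z] at this
      exact (ENNReal.add_lt_top.2 ⟨lt_top_iff_ne_top.2 hw', hw⟩).ne (top_le_iff.1 this)
    · rw [isOpen_iff_mem_nhds]
      intro z hz
      filter_upwards [exists_nhds_agmonEDist_lt hA hW z ENNReal.zero_lt_top] with w hw
      exact ((agmonEDist_triangle x z w).trans_lt
        (ENNReal.add_lt_top.2 ⟨lt_top_iff_ne_top.2 hz, hw⟩)).ne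
  have := hcl.eq_univ ⟨x, by simp [agmonEDist_self]⟩
  exact this.ge (mem_univ y)

theorem continuous_agmonEDist (hA : IsEllipticField n A) (hW : LocallyBounded W) (x : M) :
    Continuous (agmonEDist A W x) := by
  rw [continuous_iff_continuousAt]
  intro z
  refine ENNReal.tendsto_nhds_of_Icc fun ε hε => ?_
  filter_upwards [exists_nhds_agmonEDist_lt hA hW z hε] with w hw
  constructor
  · rw [tsub_le_iff_right]
    refine (agmonEDist_triangle x w z).trans ?_
    rw [agmonEDist_comm w z]
    gcongr
  · refine (agmonEDist_triangle x z w).trans ?_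
    gcongr

/-- Convergence for a complete Agmon metric is convergence in the topology of the manifold. -/
theorem exists_agmonEDist_lt_subset [T2Space M] (hcomplete : AgmonComplete A W)
    {x : M} {s : Set M} (hs : s ∈ 𝓝 x) : ∃ ε > 0, {z | agmonEDist A W x z < ε} ⊆ s := by
  by_contra! hne
  have hne' : ∀ k : ℕ, ∃ z, agmonEDist A W x z < ((k : ℝ≥0∞) + 1)⁻¹ ∧ z ∉ s := fun k =>
    not_subset.1 (hne _ (ENNReal.inv_pos.2 (by finiteness)))
  choose y hy hys using hne'
  -- Points escaping `s` alternate with `x` itself. The sequence is Cauchy for the Agmon distance,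
  -- so it converges in `M`; its odd terms force the limit to be `x`, and its even terms then
  -- contradict `s ∈ 𝓝 x`. Completeness thus replaces a local lower bound on `W`.
  let u : ℕ → M := fun m => if Even m then y (m / 2) else x
  have hu : ∀ m, agmonEDist A W x (u m) < (((m / 2 : ℕ) : ℝ≥0∞) + 1)⁻¹ := by
    intro m
    by_cases hm : Even m
    · simp only [u, if_pos hm]
      exact hy _
    · simp only [u, if_neg hm, agmonEDist_self]
      exact ENNReal.inv_pos.2 (by finiteness)
  obtain ⟨z, hz⟩ := hcomplete u (by
    intro ε hε
    obtain ⟨N, hN⟩ := ENNReal.exists_inv_nat_lt (ENNReal.half_pos hε.ne').ne'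
    have hsmall : ∀ k ≥ 2 * N, agmonEDist A W x (u k) < ε / 2 := by
      intro k hk
      refine (hu k).trans (lt_of_le_of_lt (ENNReal.inv_le_inv.2 ?_) hN)
      have : N ≤ k / 2 := by omega
      exact (Nat.cast_le.2 this).trans le_self_add
    refine ⟨2 * N, fun k hk l hl => ?_⟩
    refine (agmonEDist_triangle _ x _).trans_lt ?_
    rw [agmonEDist_comm (u k) x]
    exact (ENNReal.add_lt_add (hsmall k hk) (hsmall l hl)).trans_le (ENNReal.add_halves ε).le)
  have h1 : Tendsto (fun k : ℕ => u (2 * k + 1)) atTop (𝓝 z) :=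
    hz.comp (tendsto_atTop_mono (fun k => by rw [id]; omega) tendsto_id)
  have h2 : Tendsto (fun k : ℕ => u (2 * k)) atTop (𝓝 z) :=
    hz.comp (tendsto_atTop_mono (fun k => by rw [id]; omega) tendsto_id)
  have e1 : (fun k : ℕ => u (2 * k + 1)) = fun _ => x := by
    ext k
    have : ¬ Even (2 * k + 1) := by simp
    simp only [u, if_neg this]
  have e2 : (fun k : ℕ => u (2 * k)) = y := by
    ext k
    simp [u]
  rw [e1] at h1
  rw [e2] at h2
  have hzx := tendsto_nhds_unique h1 tendsto_const_nhds
  rw [hzx] at h2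
  obtain ⟨k, hk⟩ := (h2.eventually hs).exists
  exact hys k hk

/-- Completeness of the Agmon metric implies that its balls are relatively compact. -/
theorem isCompact_agmonEDist_le [T2Space M] [ConnectedSpace M]
    (hA : IsEllipticField n A) (hW : LocallyBounded W) (hcomplete : AgmonComplete A W)
    (x : M) {r : ℝ} (hr : 0 ≤ r) : IsCompact {z | agmonEDist A W x z ≤ ENNReal.ofReal r} := by
  have hlc : LocallyCompactSpace M := ChartedSpace.locallyCompactSpace (Eucl n) M
  have hfin := agmonEDist_ne_top hA hW
  let P₁ : PseudoEMetricSpace M :=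
    { edist := agmonEDist A W
      edist_self := agmonEDist_self
      edist_comm := agmonEDist_comm
      edist_triangle := agmonEDist_triangle }
  let P₂ : PseudoMetricSpace M := @PseudoEMetricSpace.toPseudoMetricSpace M P₁ hfin
  -- One inclusion is the continuity of the distance, the other is the previous lemma. Identifying
  -- the topologies transfers the local compactness of the manifold to the pseudometric space.
  have htop : (inferInstance : TopologicalSpace M) = P₂.toUniformSpace.toTopologicalSpace := by
    refine TopologicalSpace.ext_nhds fun z => Filter.ext fun s => ?_
    rw [@EMetric.mem_nhds_iff M P₁]
    constructor
    · intro hs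
      obtain ⟨ε, hε, h⟩ := exists_agmonEDist_lt_subset hcomplete hs
      refine ⟨ε, hε, fun w hw => h ?_⟩
      change agmonEDist A W z w < ε
      rw [agmonEDist_comm]
      exact hw
    · rintro ⟨ε, hε, h⟩
      filter_upwards [exists_nhds_agmonEDist_lt hA hW z hε] with w hw
      refine h ?_
      rw [agmonEDist_comm] at hw
      exact hw
  let P : PseudoMetricSpace M := P₂.replaceTopology htop
  have hdist : ∀ z w, @dist M P.toDist z w = (agmonEDist A W z w).toReal := fun _ _ => rfl
  have hed : ∀ z w, @edist M P.toPseudoEMetricSpace.toEDist z w = agmonEDist A W z w :=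
    fun _ _ => rfl
  have hPc : @CompleteSpace M P.toUniformSpace := by
    refine @EMetric.complete_of_cauchySeq_tendsto M P.toPseudoEMetricSpace fun u hu => ?_
    refine hcomplete u fun ε hε => ?_
    obtain ⟨N, hN⟩ := (@EMetric.cauchySeq_iff M ℕ P.toPseudoEMetricSpace _ _ u).1 hu ε hε
    exact ⟨N, fun k hk l hl => hN k hk l hl⟩
  have key := @isCompact_closedBall_of_length_space M P hPc hlc (by
    intro z w a b ha hb hab
    rw [hdist] at hab
    have h1 : agmonEDist A W z w < ENNReal.ofReal a + ENNReal.ofReal b := by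
      rw [← ENNReal.ofReal_add ha hb.le]
      exact (ENNReal.lt_ofReal_iff_toReal_lt (hfin _ _)).2 hab
    obtain ⟨y, hy1, hy2⟩ := exists_agmonEDist_le_and_lt (continuous_agmonEDist hA hW z)
      ENNReal.ofReal_ne_top (ENNReal.ofReal_pos.2 hb) h1
    exact ⟨y, ENNReal.toReal_le_of_le_ofReal ha hy1,
      (ENNReal.lt_ofReal_iff_toReal_lt (hfin _ _)).1 hy2⟩) x r
  have hset : {z | agmonEDist A W x z ≤ ENNReal.ofReal r} = @Metric.closedBall M P x r := by
    ext z
    rw [@Metric.mem_closedBall' M P, hdist]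
    exact ⟨fun h => ENNReal.toReal_le_of_le_ofReal hr h,
      fun h => (ENNReal.le_ofReal_iff_toReal_le (hfin _ _) hr).2 h⟩
  rw [hset]
  exact key

end AgmonDistance

/-! ### Lebesgue differentiation along lines. -/

section Lines

variable {E : Type*} [NormedAddCommGroup E] [NormedSpace ℝ E] [FiniteDimensional ℝ E]
  [MeasurableSpace E] [BorelSpace E] {μ : Measure E} [μ.IsAddHaarMeasure]

/-- Lebesgue's differentiation theorem along the lines of a fixed direction. -/
theorem ae_tendsto_integral_line {g : E → ℝ} (hg : Measurable g) {B : ℝ} (hB : ∀ y, |g y| ≤ B)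
    (v : E) : ∀ᵐ y ∂μ, Tendsto (fun k : ℕ => ((k : ℝ) + 1) *
      ∫ s in (0 : ℝ)..((k : ℝ) + 1)⁻¹, g (y + s • v)) atTop (𝓝 (g y)) := by
  have hm : ∀ k : ℕ, Measurable fun y : E => ((k : ℝ) + 1) *
      ∫ s in (0 : ℝ)..((k : ℝ) + 1)⁻¹, g (y + s • v) := by
    intro k
    refine Measurable.const_mul ?_ _
    have h0 : (0 : ℝ) ≤ ((k : ℝ) + 1)⁻¹ := by positivity
    simp only [intervalIntegral.integral_of_le h0]
    have : Measurable fun p : E × ℝ => g (p.1 + p.2 • v) :=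
      hg.comp (measurable_fst.add (measurable_snd.smul_const v))
    exact (this.stronglyMeasurable.integral_prod_right' (ν := volume.restrict _)).measurable
  let L : ℝ →L[ℝ] E := ContinuousLinearMap.smulRight (1 : ℝ →L[ℝ] ℝ) v
  -- By Fubini it is enough to work on each line parallel to `v`, where this is the one-dimensional
  -- theorem.
  refine ae_mem_of_ae_add_linearMap_mem L.toLinearMap volume μ (measurableSet_tendsto_fun hm hg) ?_
  intro y
  have hloc : LocallyIntegrable (fun s : ℝ => g (y + s • v)) volume := by
    have : Measurable fun s : ℝ => g (y + s • v) := by fun_prop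
    exact (memLp_top_of_bound this.aestronglyMeasurable B
      (Eventually.of_forall fun s => hB _)).locallyIntegrable le_top
  filter_upwards [_root_.LocallyIntegrable.ae_hasDerivAt_integral hloc] with s₀ hs
  have h1 := (hs s₀).tendsto_slope_zero_right
  have h2 : Tendsto (fun k : ℕ => ((k : ℝ) + 1)⁻¹) atTop (𝓝[>] 0) := by
    refine tendsto_nhdsWithin_iff.2 ⟨?_, Eventually.of_forall fun k => ?_⟩
    · exact (tendsto_natCast_atTop_atTop.atTop_add tendsto_const_nhds).inv_tendsto_atTop
    · exact mem_Ioi.2 (by positivity)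
  refine (h1.comp h2).congr fun k => ?_
  simp only [Function.comp_apply, intervalIntegral.integral_same, sub_zero, inv_inv, smul_eq_mul]
  congr 1
  have h3 := intervalIntegral.integral_comp_add_left (a := 0) (b := ((k : ℝ) + 1)⁻¹)
    (fun s => g (y + s • v)) s₀
  rw [add_zero] at h3
  rw [← h3]
  refine intervalIntegral.integral_congr fun s _ => ?_
  simp [L, add_smul, add_assoc]

end Lines

/-! ### Almost everywhere statements in charts and the eikonal inequality. -/

section Eikonal

variable {n : ℕ} {M : Type*} [TopologicalSpace M] [ChartedSpace (Eucl n) M]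

/-- The open set of points with coordinates in a ball, in the preferred chart around `x₀`. -/
def chartBall (n : ℕ) {M : Type*} [TopologicalSpace M] [ChartedSpace (Eucl n) M]
    (x₀ : M) (δ : ℝ) : Set M :=
  (chartAt (Eucl n) x₀).source ∩ chartAt (Eucl n) x₀ ⁻¹' Metric.ball (chartAt (Eucl n) x₀ x₀) δ

theorem isOpen_chartBall (x₀ : M) (δ : ℝ) : IsOpen (chartBall n x₀ δ) :=
  (chartAt (Eucl n) x₀).isOpen_inter_preimage Metric.isOpen_ball

theorem mem_chartBall_self (x₀ : M) {δ : ℝ} (hδ : 0 < δ) : x₀ ∈ chartBall n x₀ δ :=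
  ⟨mem_chart_source _ _, Metric.mem_ball_self hδ⟩

variable [MeasurableSpace M] [BorelSpace M]

theorem measurable_indicator_comp_chart_symm (x₀ : M) {s : Set (Eucl n)} (hs : MeasurableSet s)
    (hst : s ⊆ (chartAt (Eucl n) x₀).target) {G : M → ℝ} (hG : Measurable G) :
    Measurable (s.indicator fun y => G ((chartAt (Eucl n) x₀).symm y)) := by
  classical
  have hT : Measurable (s.piecewise (chartAt (Eucl n) x₀).symm fun _ => x₀) :=
    ((chartAt (Eucl n) x₀).continuousOn_symm.mono hst).measurable_piecewise
      continuousOn_const hs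
  have : (s.indicator fun y => G ((chartAt (Eucl n) x₀).symm y)) =
      s.indicator fun y => G (s.piecewise (chartAt (Eucl n) x₀).symm (fun _ => x₀) y) := by
    ext y
    by_cases hy : y ∈ s <;> simp [hy]
  rw [this]
  exact (hG.comp hT).indicator hs

/-- Charts in which the measure is dominated by Lebesgue measure. -/
theorem exists_chartBall_map_le {ν : Measure M} (hν : HasLocallyBoundedDensity n ν) (x₀ : M)
    {s : Set M} (hs : s ∈ 𝓝 x₀) :
    ∃ δ > 0, ∃ C : ℝ≥0,
      Metric.ball (chartAt (Eucl n) x₀ x₀) δ ⊆ (chartAt (Eucl n) x₀).target ∧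
      chartBall n x₀ δ ⊆ s ∧ AEMeasurable (chartAt (Eucl n) x₀) (ν.restrict (chartBall n x₀ δ)) ∧
      (ν.restrict (chartBall n x₀ δ)).map (chartAt (Eucl n) x₀) ≤ C • volume := by
  classical
  obtain ⟨C, U, hU, hUs, h⟩ := hν x₀
  obtain ⟨δ, hδ, hsub, hb⟩ := exists_ball_chart (n := n) x₀ (inter_mem hU hs)
  set e := chartAt (Eucl n) x₀ with he
  have hN : chartBall n x₀ δ ⊆ U ∩ s := by
    rintro x ⟨hx1, hx2⟩
    have := hb _ hx2
    rwa [e.left_inv hx1] at this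
  have hNo := isOpen_chartBall (n := n) x₀ δ
  have hcont : ContinuousOn e (chartBall n x₀ δ) := e.continuousOn.mono inter_subset_left
  have hae : AEMeasurable e (ν.restrict (chartBall n x₀ δ)) := hcont.aemeasurable hNo.measurableSet
  refine ⟨δ, hδ, C, hsub, fun x hx => (hN hx).2, hae, Measure.le_iff.2 fun Z hZ => ?_⟩
  rw [Measure.map_apply_of_aemeasurable hae hZ, Measure.restrict_apply' hNo.measurableSet]
  have hm : MeasurableSet (e ⁻¹' Z ∩ chartBall n x₀ δ) := by
    have hT : Measurable ((chartBall n x₀ δ).piecewise e fun _ => e x₀) :=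
      hcont.measurable_piecewise continuousOn_const hNo.measurableSet
    have : e ⁻¹' Z ∩ chartBall n x₀ δ =
        ((chartBall n x₀ δ).piecewise e fun _ => e x₀) ⁻¹' Z ∩ chartBall n x₀ δ := by
      ext x
      refine and_congr_left fun hx => ?_
      simp [hx]
    rw [this]
    exact (hT hZ).inter hNo.measurableSet
  refine (h _ (fun x hx => (hN hx.2).1) hm).1.trans ?_
  change _ ≤ (C : ℝ≥0∞) * volume Z
  gcongr
  rintro _ ⟨x, hx, rfl⟩
  exact hx.1

/-- Near each point `ν` is absolutely continuous with respect to Lebesgue measure in coordinates;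
second countability turns locally null sets into null sets. -/
theorem ae_of_chart [SecondCountableTopology M] {ν : Measure M}
    (hν : HasLocallyBoundedDensity n ν) {P : M → Prop}
    (h : ∀ x₀ : M, ∃ δ > 0, ∀ᵐ y ∂(volume : Measure (Eucl n)),
      y ∈ Metric.ball (chartAt (Eucl n) x₀ x₀) δ → P ((chartAt (Eucl n) x₀).symm y)) :
    ∀ᵐ x ∂ν, P x := by
  rw [ae_iff]
  refine measure_null_of_locally_null _ fun x₀ _ => ?_
  obtain ⟨δ, hδ, hP⟩ := h x₀
  obtain ⟨δ', hδ', C, hsub, hN, hae, hle⟩ := exists_chartBall_map_le hν x₀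
    ((isOpen_chartBall (n := n) x₀ δ).mem_nhds (mem_chartBall_self x₀ hδ))
  refine ⟨{x | ¬P x} ∩ chartBall n x₀ δ', mem_nhdsWithin.2
    ⟨_, isOpen_chartBall x₀ δ', mem_chartBall_self x₀ hδ', fun x hx => ⟨hx.2, hx.1⟩⟩, ?_⟩
  have h1 : ∀ᵐ y ∂((ν.restrict (chartBall n x₀ δ')).map (chartAt (Eucl n) x₀)),
      y ∈ Metric.ball (chartAt (Eucl n) x₀ x₀) δ → P ((chartAt (Eucl n) x₀).symm y) := by
    have hac : (ν.restrict (chartBall n x₀ δ')).map (chartAt (Eucl n) x₀) ≪ volume :=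
      (Measure.absolutelyContinuous_of_le hle).trans Measure.smul_absolutelyContinuous
    exact hac.ae_le hP
  have h2 := ae_of_ae_map hae h1
  rw [ae_restrict_iff' (isOpen_chartBall x₀ δ').measurableSet, ae_iff] at h2
  refine measure_mono_null (fun x hx => show ¬_ from fun h3 => hx.1 ?_) h2
  have h4 := h3 hx.2 (hN hx.2).2
  rwa [(chartAt (Eucl n) x₀).left_inv hx.2.1] at h4

variable [IsManifold (𝓡 n) ∞ M] {A : CoeffField n M} {W : M → ℝ}

/-- Measurability of `A` is postulated only against globally smooth functions, so the linear
coordinates are multiplied by a bump function and `s` is the set where that bump is locally `1`. -/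
theorem exists_measurable_ellipticField_chart [T2Space M] (hA : IsEllipticField n A) (x₀ : M) :
    ∃ s ∈ 𝓝 x₀, ∀ t : Set (Eucl n), MeasurableSet t → t ⊆ (chartAt (Eucl n) x₀).target →
      (∀ y ∈ t, (chartAt (Eucl n) x₀).symm y ∈ s) → ∀ η : Eucl n →L[ℝ] ℝ,
      Measurable (t.indicator fun y =>
        (η.comp (chartDeriv n x₀ ((chartAt (Eucl n) x₀).symm y)))
          (A _ (η.comp (chartDeriv n x₀ ((chartAt (Eucl n) x₀).symm y))))) := by
  obtain ⟨f⟩ : Nonempty (SmoothBumpFunction (𝓡 n) x₀) := inferInstance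
  refine ⟨{x | ∀ᶠ z in 𝓝 x, f z = 1}, f.eventuallyEq_one.eventually_nhds, fun t ht htt hts η => ?_⟩
  set e := chartAt (Eucl n) x₀ with he
  have hu : ContMDiff (𝓡 n) 𝓘(ℝ, ℝ) ∞ fun x => f x • η (e x) := by
    refine f.contMDiff_smul ?_
    exact η.contMDiff.comp_contMDiffOn contMDiffOn_chart
  have hm := measurable_indicator_comp_chart_symm x₀ ht htt (hA.measurable _ _ hu hu)
  convert hm using 1
  ext y
  by_cases hy : y ∈ t
  · rw [indicator_of_mem hy, indicator_of_mem hy]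
    have hd : diff n (fun x => f x • η (e x)) (e.symm y) =
        η.comp (chartDeriv n x₀ (e.symm y)) := by
      refine (hasMFDerivAt_of_comp_chart_symm (htt hy) η.hasFDerivAt ?_).mfderiv
      have h1 : Tendsto e.symm (𝓝 y) (𝓝 (e.symm y)) := e.continuousAt_symm (htt hy)
      filter_upwards [h1.eventually (hts y hy), e.open_target.mem_nhds (htt hy)] with z hz hzt
      rw [hz, one_smul, e.right_inv hzt]
    rw [hd]
  · rw [indicator_of_notMem hy, indicator_of_notMem hy]

/-- `⟨A⁻¹v, v⟩` is the supremum over covectors `η` of `2 η(v) - ⟨η, Aη⟩`, attained at `η = A⁻¹v`. By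
continuity in `η` a countable dense family suffices, and each of its members gives a measurable
function. -/
theorem exists_measurable_agmonNorm_chart [T2Space M] (hA : IsEllipticField n A)
    (hW : Measurable W) (x₀ : M) :
    ∃ s ∈ 𝓝 x₀, ∀ t : Set (Eucl n), MeasurableSet t → t ⊆ (chartAt (Eucl n) x₀).target →
      (∀ y ∈ t, (chartAt (Eucl n) x₀).symm y ∈ s) → ∀ v : Eucl n,
      Measurable (t.indicator fun y =>
        agmonNorm A W ((chartAt (Eucl n) x₀).symm y) (chartSymmDeriv n x₀ y v)) := by
  obtain ⟨s, hs, h⟩ := exists_measurable_ellipticField_chart hA x₀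
  refine ⟨s, hs, fun t ht htt hts v => ?_⟩
  set e := chartAt (Eucl n) x₀ with he
  have h1 : Measurable (t.indicator fun y =>
      (A (e.symm y)).symm (chartSymmDeriv n x₀ y v) (chartSymmDeriv n x₀ y v)) := by
    refine Measurable.isLUB (ι := ℕ) (f := fun i => t.indicator fun y =>
      2 * (TopologicalSpace.denseSeq (Eucl n →L[ℝ] ℝ) i) v -
        ((TopologicalSpace.denseSeq (Eucl n →L[ℝ] ℝ) i).comp (chartDeriv n x₀ (e.symm y)))
          (A _ ((TopologicalSpace.denseSeq (Eucl n →L[ℝ] ℝ) i).comp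
            (chartDeriv n x₀ (e.symm y))))) (fun i => ?_) fun y => ?_
    · have h2 := ((measurable_const (a := 2 * (TopologicalSpace.denseSeq (Eucl n →L[ℝ] ℝ) i) v)
        ).indicator ht).sub (h t ht htt hts (TopologicalSpace.denseSeq (Eucl n →L[ℝ] ℝ) i))
      convert h2 using 1
      ext y
      by_cases hy : y ∈ t <;> simp [hy]
    · by_cases hy : y ∈ t
      · simp only [indicator_of_mem hy]
        set x := e.symm y with hx
        have e2 : ∀ η : Eucl n →L[ℝ] ℝ,
            (η.comp (chartDeriv n x₀ x) : Cotangent n x) (chartSymmDeriv n x₀ y v) = η v :=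
          fun η => congrArg η (chartDeriv_chartSymmDeriv (htt hy) v)
        constructor
        · rintro _ ⟨i, rfl⟩
          have := two_mul_sub_le_inverse hA x (chartSymmDeriv n x₀ y v)
            ((TopologicalSpace.denseSeq (Eucl n →L[ℝ] ℝ) i).comp (chartDeriv n x₀ x))
          rwa [e2] at this
        · intro b hb
          let D' : Eucl n →L[ℝ] Eucl n := chartDeriv n x₀ x
          let A' : (Eucl n →L[ℝ] ℝ) →L[ℝ] Eucl n := (A x).toContinuousLinearMap
          have hcont : Continuous fun η : Eucl n →L[ℝ] ℝ =>
              2 * η v - (η.comp D') (A' (η.comp D')) := by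
            have hc : Continuous fun η : Eucl n →L[ℝ] ℝ => η.comp D' :=
              continuous_id.clm_comp continuous_const
            exact (continuous_const.mul (continuous_id.clm_apply continuous_const)).sub
              (hc.clm_apply (A'.continuous.comp hc))
          have hall : ∀ η : Eucl n →L[ℝ] ℝ, 2 * η v - (η.comp D') (A' (η.comp D')) ≤ b := by
            intro η
            refine (TopologicalSpace.denseRange_denseSeq (Eucl n →L[ℝ] ℝ)).induction_on η
              (isClosed_le hcont continuous_const) fun i => hb ⟨i, rfl⟩
          set ξ := (A x).symm (chartSymmDeriv n x₀ y v) with hξ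
          have h3 := hall (ξ.comp (chartSymmDeriv n x₀ y))
          have h4 : ((ξ.comp (chartSymmDeriv n x₀ y)).comp D' : Eucl n →L[ℝ] ℝ) = ξ :=
            cotangent_eq_comp_chartDeriv (htt hy) ξ
          have h5 : A' ξ = chartSymmDeriv n x₀ y v := (A x).apply_symm_apply _
          rw [h4, h5] at h3
          have h6 : (ξ.comp (chartSymmDeriv n x₀ y)) v = ξ (chartSymmDeriv n x₀ y v) := rfl
          rw [h6] at h3
          have h7 : (2 * ξ (chartSymmDeriv n x₀ y v) - ξ (chartSymmDeriv n x₀ y v) : ℝ) ≤ b := h3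
          linarith
      · simp only [indicator_of_notMem hy]
        simp [isLUB_singleton]
  have h2 := ((measurable_indicator_comp_chart_symm x₀ ht htt hW).mul h1).sqrt
  convert h2 using 1
  ext y
  by_cases hy : y ∈ t
  · simp only [indicator_of_mem hy, Pi.mul_apply]
    rfl
  · simp [hy]

/-- A distance function is differentiable almost everywhere, with differential bounded by the
Agmon norm. -/
theorem ae_fderiv_agmonEDist_le [T2Space M] [ConnectedSpace M] (hA : IsEllipticField n A)
    (hW : Measurable W) (hWb : LocallyBounded W) (o x₀ : M) :
    ∃ δ > 0, Metric.ball (chartAt (Eucl n) x₀ x₀) δ ⊆ (chartAt (Eucl n) x₀).target ∧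
      ∀ᵐ y ∂(volume : Measure (Eucl n)), y ∈ Metric.ball (chartAt (Eucl n) x₀ x₀) δ →
        ∃ L : Eucl n →L[ℝ] ℝ,
          HasFDerivAt (fun z => (agmonEDist A W o ((chartAt (Eucl n) x₀).symm z)).toReal) L y ∧
          ∀ v, L v ≤ agmonNorm A W ((chartAt (Eucl n) x₀).symm y) (chartSymmDeriv n x₀ y v) := by
  obtain ⟨δ₁, hδ₁, C, hsub₁, hn, hlip⟩ := exists_agmonEDist_chart_le hA hWb x₀
  obtain ⟨s, hs, hmeas⟩ := exists_measurable_agmonNorm_chart hA hW x₀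
  obtain ⟨δ₂, hδ₂, -, hsub₂⟩ := exists_ball_chart (n := n) x₀ hs
  have hfin := agmonEDist_ne_top hA hWb
  set e := chartAt (Eucl n) x₀ with he
  set b := Metric.ball (e x₀) (min δ₁ δ₂) with hb
  have hb1 : b ⊆ Metric.ball (e x₀) δ₁ := Metric.ball_subset_ball (min_le_left _ _)
  have hb2 : b ⊆ Metric.ball (e x₀) δ₂ := Metric.ball_subset_ball (min_le_right _ _)
  have hbt : b ⊆ e.target := hb1.trans hsub₁
  have hbo : IsOpen b := Metric.isOpen_ball
  refine ⟨min δ₁ δ₂, lt_min hδ₁ hδ₂, hbt, ?_⟩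
  set r : Eucl n → ℝ := fun z => (agmonEDist A W o (e.symm z)).toReal with hr
  have hrle : ∀ y z, agmonEDist A W (e.symm y) (e.symm z) ≠ ⊤ →
      r z - r y ≤ (agmonEDist A W (e.symm y) (e.symm z)).toReal := by
    intro y z h
    have h1 := ENNReal.toReal_mono (ENNReal.add_ne_top.2 ⟨hfin _ _, h⟩)
      (agmonEDist_triangle (A := A) (W := W) o (e.symm y) (e.symm z))
    rw [ENNReal.toReal_add (hfin _ _) h] at h1
    linarith
  have hrl : LipschitzOnWith C r b := by
    refine LipschitzOnWith.of_le_add_mul C fun z hz y hy => ?_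
    have h1 := hrle y z (hfin _ _)
    have h2 := ENNReal.toReal_le_of_le_ofReal (by positivity) (hlip y (hb1 hy) z (hb1 hz))
    rw [dist_eq_norm]
    linarith
  -- Extension by zero gives a measurable bounded function on the whole space, as differentiation
  -- along lines requires.
  let g : Eucl n → Eucl n → ℝ := fun v => b.indicator fun y =>
    agmonNorm A W (e.symm y) (chartSymmDeriv n x₀ y v)
  have hgm : ∀ v, Measurable (g v) := fun v =>
    hmeas b hbo.measurableSet hbt (fun y hy => hsub₂ y (hb2 hy)) v
  have hg0 : ∀ v y, 0 ≤ g v y := fun v y => indicator_nonneg (fun _ _ => Real.sqrt_nonneg _) y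
  have hgB : ∀ v y, |g v y| ≤ C * ‖v‖ := by
    intro v y
    rw [abs_of_nonneg (hg0 v y)]
    by_cases hy : y ∈ b
    · simp only [g, indicator_of_mem hy]
      exact hn y (hb1 hy) v
    · simp only [g, indicator_of_notMem hy]
      positivity
  -- Only a countable dense set of directions is treated, so that a single null set is removed; the
  -- other directions follow by continuity in `v`.
  have hlines : ∀ᵐ y ∂(volume : Measure (Eucl n)), ∀ i : ℕ, Tendsto (fun k : ℕ => ((k : ℝ) + 1) *
      ∫ s in (0 : ℝ)..((k : ℝ) + 1)⁻¹, g (TopologicalSpace.denseSeq (Eucl n) i)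
        (y + s • TopologicalSpace.denseSeq (Eucl n) i)) atTop
        (𝓝 (g (TopologicalSpace.denseSeq (Eucl n) i) y)) :=
    ae_all_iff.2 fun i => ae_tendsto_integral_line (hgm _) (hgB _) _
  filter_upwards [hlines, hrl.ae_differentiableWithinAt_of_mem (μ := volume)] with y hy1 hy2 hyb
  have hdiff : DifferentiableAt ℝ r y := (hy2 hyb).differentiableAt (hbo.mem_nhds hyb)
  refine ⟨fderiv ℝ r y, hdiff.hasFDerivAt, ?_⟩
  have ht : Tendsto (fun k : ℕ => ((k : ℝ) + 1)⁻¹) atTop (𝓝[>] 0) := by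
    refine tendsto_nhdsWithin_iff.2 ⟨?_, Eventually.of_forall fun k => ?_⟩
    · exact (tendsto_natCast_atTop_atTop.atTop_add tendsto_const_nhds).inv_tendsto_atTop
    · exact mem_Ioi.2 (by positivity)
  have hdense : ∀ i, fderiv ℝ r y (TopologicalSpace.denseSeq (Eucl n) i) ≤
      agmonNorm A W (e.symm y) (chartSymmDeriv n x₀ y (TopologicalSpace.denseSeq (Eucl n) i)) := by
    intro i
    set v := TopologicalSpace.denseSeq (Eucl n) i with hv
    have h1 := (hdiff.hasFDerivAt.hasLineDerivAt v).tendsto_slope_zero_right.comp ht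
    have h2 := hy1 i
    rw [← hv] at h2
    have h3 : g v y = agmonNorm A W (e.symm y) (chartSymmDeriv n x₀ y v) := by
      exact indicator_of_mem (show y ∈ b from hyb) _
    rw [← h3]
    -- The difference quotient of the distance along `v` is at most the mean of the Agmon norm of
    -- `v` over the segment; the two sides tend to the derivative and to the norm at `y`.
    refine le_of_tendsto_of_tendsto h1 h2 ?_
    have hev : ∀ᶠ t in 𝓝[>] (0 : ℝ), y + t • v ∈ b := by
      have : ContinuousAt (fun t : ℝ => y + t • v) 0 := by fun_prop
      exact nhdsWithin_le_nhds
        (this.preimage_mem_nhds (hbo.mem_nhds (by rw [zero_smul, add_zero]; exact hyb)))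
    filter_upwards [ht.eventually hev] with k hk
    have hk0 : (0 : ℝ) ≤ ((k : ℝ) + 1)⁻¹ := by positivity
    simp only [Function.comp_apply, inv_inv, smul_eq_mul]
    refine mul_le_mul_of_nonneg_left ?_ (by positivity)
    have hseg : ∀ s ∈ Icc (0 : ℝ) ((k : ℝ) + 1)⁻¹, y + s • v ∈ b := by
      intro s hs
      have hpos : (0 : ℝ) < (k : ℝ) + 1 := by positivity
      have h5 := (convex_ball (e x₀) (min δ₁ δ₂)).add_smul_mem (x := y)
        (y := ((k : ℝ) + 1)⁻¹ • v) hyb hk (t := s * ((k : ℝ) + 1))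
        ⟨mul_nonneg hs.1 hpos.le, by
          have := mul_le_mul_of_nonneg_right hs.2 hpos.le
          rwa [inv_mul_cancel₀ hpos.ne'] at this⟩
      rwa [smul_smul, mul_assoc, mul_inv_cancel₀ hpos.ne', mul_one] at h5
    refine (hrle _ _ (hfin _ _)).trans ?_
    have h4 := agmonEDist_chart_line_le (A := A) (W := W) x₀ hk0 fun s hs => hbt (hseg s hs)
    have hgi : IntegrableOn (fun s : ℝ => g v (y + s • v)) (Icc 0 ((k : ℝ) + 1)⁻¹) := by
      refine Measure.integrableOn_of_bounded (M := C * ‖v‖) (by simp) ?_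
        (Eventually.of_forall fun s => hgB v _)
      have hmv := hgm v
      exact Measurable.aestronglyMeasurable (by fun_prop)
    have h5 : ∫⁻ s in Icc 0 ((k : ℝ) + 1)⁻¹, ENNReal.ofReal (agmonNorm A W (e.symm (y + s • v))
        (chartSymmDeriv n x₀ (y + s • v) v)) =
        ENNReal.ofReal (∫ s in (0 : ℝ)..((k : ℝ) + 1)⁻¹, g v (y + s • v)) := by
      rw [intervalIntegral.integral_of_le hk0, ← integral_Icc_eq_integral_Ioc,
        ofReal_integral_eq_lintegral_ofReal hgi (Eventually.of_forall fun s => hg0 v _)]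
      refine setLIntegral_congr_fun measurableSet_Icc fun s hs => ?_
      simp only [g, indicator_of_mem (hseg s hs)]
    rw [h5] at h4
    exact ENNReal.toReal_le_of_le_ofReal
      (intervalIntegral.integral_nonneg hk0 fun s _ => hg0 v _) h4
  have hclosed : IsClosed {v : Eucl n | fderiv ℝ r y v ≤
      agmonNorm A W (e.symm y) (chartSymmDeriv n x₀ y v)} := by
    let S' : Eucl n →L[ℝ] Eucl n := chartSymmDeriv n x₀ y
    let B' : Eucl n →L[ℝ] (Eucl n →L[ℝ] ℝ) := (A (e.symm y)).symm.toContinuousLinearMap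
    have : Continuous fun v : Eucl n => √(W (e.symm y) * B' (S' v) (S' v)) :=
      (continuous_const.mul ((B'.continuous.comp S'.continuous).clm_apply S'.continuous)).sqrt
    exact isClosed_le (fderiv ℝ r y).continuous this
  exact fun v => (TopologicalSpace.denseRange_denseSeq (Eucl n)).induction_on v hclosed hdense

/-- The eikonal inequality `⟨A∇ρ, ∇ρ⟩ ≤ W` for the Agmon distance `ρ` to a point. -/
theorem ae_diff_agmonEDist_le [T2Space M] [ConnectedSpace M] [SecondCountableTopology M]
    {ν : Measure M} (hν : HasLocallyBoundedDensity n ν) (hA : IsEllipticField n A)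
    (hW : Measurable W) (hWpos : ∀ x, 0 < W x) (hWb : LocallyBounded W) (o : M) :
    ∀ᵐ x ∂ν, ∃ ξ : Cotangent n x,
      HasMFDerivAt (𝓡 n) 𝓘(ℝ, ℝ) (fun z => (agmonEDist A W o z).toReal) x ξ ∧
      ξ (A x ξ) ≤ W x := by
  refine ae_of_chart hν fun x₀ => ?_
  obtain ⟨δ, hδ, hsub, h⟩ := ae_fderiv_agmonEDist_le hA hW hWb o x₀
  refine ⟨δ, hδ, ?_⟩
  filter_upwards [h] with y hy hyb
  obtain ⟨L, hL, hLv⟩ := hy hyb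
  set x := (chartAt (Eucl n) x₀).symm y with hx
  set ξ : Cotangent n x := L.comp (chartDeriv n x₀ x) with hξ
  refine ⟨ξ, hasMFDerivAt_of_comp_chart_symm (hsub hyb) hL (Eventually.of_forall fun _ => rfl), ?_⟩
  -- Duality: testing on the vector `Aξ` gives `⟨ξ, Aξ⟩ ≤ (W ⟨ξ, Aξ⟩)^{1/2}`, which is the claim
  -- after squaring.
  have h1 := hLv (chartDeriv n x₀ x (A x ξ))
  rw [chartSymmDeriv_chartDeriv (hsub hyb)] at h1
  have h2 : L (chartDeriv n x₀ x (A x ξ)) = ξ (A x ξ) := rfl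
  rw [h2] at h1
  unfold agmonNorm at h1
  rw [(A x).symm_apply_apply] at h1
  have h3 : 0 ≤ ξ (A x ξ) := by
    have := inverse_nonneg hA x (A x ξ)
    rwa [(A x).symm_apply_apply] at this
  rcases h3.eq_or_lt with h4 | h4
  · rw [← h4]
    exact (hWpos x).le
  · have h5 := (Real.le_sqrt' h4).1 h1
    nlinarith

end Eikonal

/-! ### A convergence criterion for integrals. -/

section Convergence

variable {X : Type*} [MeasurableSpace X] {μ : Measure X}

/-- A form of convergence in `L¹`. -/
theorem integrable_and_tendsto_integral {fk H : ℕ → X → ℝ} {f g : X → ℝ}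
    (hfk : ∀ k, Integrable (fk k) μ) (hH : ∀ k, Integrable (H k) μ) (hH0 : ∀ k, ∀ᵐ x ∂μ, 0 ≤ H k x)
    (hHt : Tendsto (fun k => ∫ x, H k x ∂μ) atTop (𝓝 0)) (hg : Integrable g μ)
    (hb : ∀ τ > 0, ∀ k, ∀ᵐ x ∂μ, |fk k x - f x| ≤ (1 + τ⁻¹) * H k x + τ * g x) :
    Integrable f μ ∧ Tendsto (fun k => ∫ x, fk k x ∂μ) atTop (𝓝 (∫ x, f x ∂μ)) := by
  have hL1 : Tendsto (fun k => eLpNorm (H k - 0) 1 μ) atTop (𝓝 0) := by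
    have : ∀ k, eLpNorm (H k - 0) 1 μ = ENNReal.ofReal (∫ x, H k x ∂μ) := by
      intro k
      rw [sub_zero, eLpNorm_one_eq_lintegral_enorm,
        ofReal_integral_eq_lintegral_ofReal (hH k) (hH0 k)]
      refine lintegral_congr_ae ?_
      filter_upwards [hH0 k] with x hx
      exact Real.enorm_of_nonneg hx
    simp only [this]
    rw [← ENNReal.ofReal_zero]
    exact (ENNReal.continuous_ofReal.tendsto 0).comp hHt
  -- Nothing is assumed on `f`. Along a subsequence `H → 0` almost everywhere, and since `τ` is
  -- arbitrary, `fk → f` there; this yields measurability, and then integrability, of `f`.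
  obtain ⟨ns, -, hns⟩ := (tendstoInMeasure_of_tendsto_eLpNorm one_ne_zero
    (fun k => (hH k).1) aestronglyMeasurable_zero hL1).exists_seq_tendsto_ae
  have hb' : ∀ᵐ x ∂μ, ∀ m : ℕ, ∀ k,
      |fk k x - f x| ≤ (1 + (((m : ℝ) + 1)⁻¹)⁻¹) * H k x + ((m : ℝ) + 1)⁻¹ * g x :=
    ae_all_iff.2 fun m => ae_all_iff.2 fun k => hb _ (by positivity) k
  have hlim : ∀ᵐ x ∂μ, Tendsto (fun i => fk (ns i) x) atTop (𝓝 (f x)) := by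
    filter_upwards [hns, hb'] with x hx hbx
    rw [Metric.tendsto_nhds]
    intro ε hε
    have h1 : Tendsto (fun m : ℕ => ((m : ℝ) + 1)⁻¹ * g x) atTop (𝓝 0) := by
      simpa using ((tendsto_natCast_atTop_atTop.atTop_add
        tendsto_const_nhds).inv_tendsto_atTop).mul_const (g x)
    obtain ⟨m, hm⟩ := (h1.eventually (gt_mem_nhds (half_pos hε))).exists
    have h2 : Tendsto (fun i => (1 + (((m : ℝ) + 1)⁻¹)⁻¹) * H (ns i) x) atTop (𝓝 0) := by
      simpa using hx.const_mul (1 + (((m : ℝ) + 1)⁻¹)⁻¹)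
    filter_upwards [h2.eventually (gt_mem_nhds (half_pos hε))] with i hi
    rw [Real.dist_eq]
    linarith [hbx m (ns i)]
  have hfm : AEStronglyMeasurable f μ :=
    aestronglyMeasurable_of_tendsto_ae atTop (fun i => (hfk (ns i)).1) hlim
  have hfi : Integrable f μ := by
    have h1 : Integrable (fun x => fk 0 x - f x) μ := by
      refine (((hH 0).const_mul (1 + 1⁻¹)).add (hg.const_mul 1)).mono' ((hfk 0).1.sub hfm) ?_
      filter_upwards [hb 1 one_pos 0] with x hx
      exact hx
    have h2 := (hfk 0).sub h1
    refine h2.congr (Eventually.of_forall fun x => ?_)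
    simp
  refine ⟨hfi, ?_⟩
  rw [Metric.tendsto_nhds]
  intro ε hε
  have hint : ∀ τ > 0, ∀ k, |∫ x, fk k x ∂μ - ∫ x, f x ∂μ| ≤
      (1 + τ⁻¹) * ∫ x, H k x ∂μ + τ * ∫ x, g x ∂μ := by
    intro τ hτ k
    rw [← integral_sub (hfk k) hfi, ← integral_const_mul, ← integral_const_mul,
      ← integral_add ((hH k).const_mul _) (hg.const_mul _)]
    exact (abs_integral_le_integral_abs).trans (integral_mono_ae ((hfk k).sub hfi).abs
      (((hH k).const_mul _).add (hg.const_mul _)) (hb τ hτ k))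
  have h1 : Tendsto (fun m : ℕ => ((m : ℝ) + 1)⁻¹ * ∫ x, g x ∂μ) atTop (𝓝 0) := by
    simpa using ((tendsto_natCast_atTop_atTop.atTop_add
      tendsto_const_nhds).inv_tendsto_atTop).mul_const (∫ x, g x ∂μ)
  obtain ⟨m, hm⟩ := (h1.eventually (gt_mem_nhds (half_pos hε))).exists
  have h2 : Tendsto (fun k => (1 + (((m : ℝ) + 1)⁻¹)⁻¹) * ∫ x, H k x ∂μ) atTop (𝓝 0) := by
    simpa using hHt.const_mul (1 + (((m : ℝ) + 1)⁻¹)⁻¹)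
  filter_upwards [h2.eventually (gt_mem_nhds (half_pos hε))] with k hk
  rw [Real.dist_eq]
  linarith [hint ((m : ℝ) + 1)⁻¹ (by positivity) k]

end Convergence

/-! ### Convergence in energy and continuity of the quadratic forms. -/

section Energy

variable {n : ℕ} {M : Type*} [TopologicalSpace M] [ChartedSpace (Eucl n) M]
  [MeasurableSpace M] {A : CoeffField n M}

theorem IsEllipticField.nonneg (hA : IsEllipticField n A) (x : M) (ξ : Cotangent n x) :
    0 ≤ ξ (A x ξ) := by
  by_cases h0 : ξ = 0
  · rw [h0]; simp
  · exact (hA.pos x _ h0).le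

/-- The pointwise bilinear form `a ⟨ξ, Aζ⟩ + b s t`. -/
def pairing (A : CoeffField n M) (a b : ℝ) (x : M) (s : ℝ) (ξ : Cotangent n x) (t : ℝ)
    (ζ : Cotangent n x) : ℝ :=
  a * ξ (A x ζ) + b * (s * t)

theorem pairing_sub_sub (a b : ℝ) (x : M) (s s' t t' : ℝ)
    (ξ ξ' ζ ζ' : Cotangent n x) :
    pairing A a b x s' ξ' t' ζ' - pairing A a b x s ξ t ζ =
      pairing A a b x (s' - s) (ξ' - ξ) (t' - t) (ζ' - ζ) +
        pairing A a b x (s' - s) (ξ' - ξ) t ζ + pairing A a b x s ξ (t' - t) (ζ' - ζ) := by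
  simp only [pairing, map_sub, _root_.sub_apply]
  ring

theorem energy_sub_sq (hA : IsEllipticField n A) (x : M) (τ : ℝ) (ξ ζ : Cotangent n x) :
    (ξ - τ • ζ) (A x (ξ - τ • ζ)) = ξ (A x ξ) - 2 * τ * ξ (A x ζ) + τ ^ 2 * ζ (A x ζ) := by
  have h := hA.symm x ξ ζ
  simp only [map_sub, _root_.sub_apply, map_smul, _root_.smul_apply, smul_eq_mul]
  rw [← h]
  ring

/-- Weighted Cauchy–Schwarz, from the positivity of the form at `ξ ± τζ`. The free weight `τ` yields
the type of bound that `integrable_and_tendsto_integral` asks for. -/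
theorem abs_pairing_le (hA : IsEllipticField n A) {a b B : ℝ} (hb : |b| ≤ B) (x : M) (s t : ℝ)
    (ξ ζ : Cotangent n x) {τ : ℝ} (hτ : 0 < τ) :
    |pairing A a b x s ξ t ζ| ≤ (|a| + B) / 2 *
      (τ⁻¹ * (s ^ 2 + ξ (A x ξ)) + τ * (t ^ 2 + ζ (A x ζ))) := by
  have h1 : |ξ (A x ζ)| ≤ (τ⁻¹ * ξ (A x ξ) + τ * ζ (A x ζ)) / 2 := by
    have e1 := hA.nonneg x (ξ - τ • ζ)
    have e2 := hA.nonneg x (ξ - (-τ) • ζ)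
    rw [energy_sub_sq hA] at e1 e2
    have h3 : τ * |ξ (A x ζ)| ≤ (ξ (A x ξ) + τ ^ 2 * ζ (A x ζ)) / 2 := by
      rcases abs_cases (ξ (A x ζ)) with ⟨h, _⟩ | ⟨h, _⟩ <;> rw [h] <;> nlinarith
    have h4 : |ξ (A x ζ)| = τ⁻¹ * (τ * |ξ (A x ζ)|) := by
      rw [← mul_assoc, inv_mul_cancel₀ hτ.ne', one_mul]
    rw [h4]
    calc _ ≤ τ⁻¹ * ((ξ (A x ξ) + τ ^ 2 * ζ (A x ζ)) / 2) := by gcongr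
      _ = _ := by field_simp
  have h2 : |s * t| ≤ (τ⁻¹ * s ^ 2 + τ * t ^ 2) / 2 := by
    have h3 : τ * |s * t| ≤ (s ^ 2 + τ ^ 2 * t ^ 2) / 2 := by
      rcases abs_cases (s * t) with ⟨h, _⟩ | ⟨h, _⟩ <;> rw [h] <;>
        nlinarith [sq_nonneg (s - τ * t), sq_nonneg (s + τ * t)]
    have h4 : |s * t| = τ⁻¹ * (τ * |s * t|) := by
      rw [← mul_assoc, inv_mul_cancel₀ hτ.ne', one_mul]
    rw [h4]
    calc _ ≤ τ⁻¹ * ((s ^ 2 + τ ^ 2 * t ^ 2) / 2) := by gcongr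
      _ = _ := by field_simp
  have hB : 0 ≤ B := (abs_nonneg _).trans hb
  have hξ := hA.nonneg x ξ
  have hζ := hA.nonneg x ζ
  calc _ ≤ |a| * |ξ (A x ζ)| + |b| * |s * t| := by
        unfold pairing
        refine (abs_add_le _ _).trans ?_
        rw [abs_mul, abs_mul]
    _ ≤ |a| * ((τ⁻¹ * ξ (A x ξ) + τ * ζ (A x ζ)) / 2) +
        B * ((τ⁻¹ * s ^ 2 + τ * t ^ 2) / 2) := by gcongr
    _ ≤ _ := by
        have e1 : 0 ≤ |a| * ((τ⁻¹ * s ^ 2 + τ * t ^ 2) / 2) := by positivity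
        have e2 : 0 ≤ B * ((τ⁻¹ * ξ (A x ξ) + τ * ζ (A x ζ)) / 2) := by positivity
        nlinarith

/-- The pairs `(uk k, Uk k)` converge to `(u, U)` in energy, dominated by `h`. -/
structure EnergyTendsto (ν : Measure M) (A : CoeffField n M) (uk : ℕ → M → ℝ)
    (Uk : ℕ → ∀ x : M, Cotangent n x) (u : M → ℝ) (U : ∀ x : M, Cotangent n x)
    (h : ℕ → M → ℝ) : Prop where
  integrable : ∀ k, Integrable (h k) ν
  tendsto : Tendsto (fun k => ∫ x, h k x ∂ν) atTop (𝓝 0)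
  bound : ∀ k, ∀ᵐ x ∂ν,
    (uk k x - u x) ^ 2 + (Uk k x - U x) (A x (Uk k x - U x)) ≤ h k x

theorem EnergyTendsto.const (ν : Measure M) (u : M → ℝ) (U : ∀ x : M, Cotangent n x) :
    EnergyTendsto ν A (fun _ => u) (fun _ => U) u U fun _ _ => 0 where
  integrable _ := integrable_zero _ _ _
  tendsto := by simp
  bound _ := Eventually.of_forall fun x => by simp

variable {ν : Measure M} {uk wk : ℕ → M → ℝ} {Uk Zk : ℕ → ∀ x : M, Cotangent n x} {u w : M → ℝ}
  {U Z : ∀ x : M, Cotangent n x} {h h' : ℕ → M → ℝ}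

theorem EnergyTendsto.nonneg (hA : IsEllipticField n A) (H : EnergyTendsto ν A uk Uk u U h) (k : ℕ) :
    ∀ᵐ x ∂ν, 0 ≤ h k x := by
  filter_upwards [H.bound k] with x hx
  exact (add_nonneg (sq_nonneg _) (hA.nonneg x _)).trans hx

/-- In each of the two terms this is `u² ≤ 2a² + 2(a - u)²`, whose defect is `4(a - u/2)²`. It gives
a majorant of the limit energy before that energy is known to be measurable. -/
theorem EnergyTendsto.energy_le (hA : IsEllipticField n A) (H : EnergyTendsto ν A uk Uk u U h)
    (k : ℕ) : ∀ᵐ x ∂ν, u x ^ 2 + U x (A x (U x)) ≤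
      2 * (uk k x ^ 2 + Uk k x (A x (Uk k x))) + 2 * h k x := by
  filter_upwards [H.bound k] with x hx
  have h1 := hA.nonneg x (Uk k x - (1 / 2 : ℝ) • U x)
  have h2 := energy_sub_sq hA x 1 (Uk k x) (U x)
  rw [one_smul] at h2
  rw [h2] at hx
  rw [energy_sub_sq hA] at h1
  nlinarith [sq_nonneg (uk k x - 1 / 2 * u x)]

/-- Continuity of the integral of `a ⟨U, AZ⟩ + b u w` with respect to the energy. -/
theorem EnergyTendsto.pairing (hA : IsEllipticField n A) (H : EnergyTendsto ν A uk Uk u U h)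
    (H' : EnergyTendsto ν A wk Zk w Z h') {L : Set M}
    (huk : ∀ k, ∀ x ∉ L, uk k x = 0) (hUk : ∀ k, ∀ x ∉ L, Uk k x = 0)
    (hu : ∀ x ∉ L, u x = 0) (hU : ∀ x ∉ L, U x = 0)
    {a B : ℝ} {b : M → ℝ} (hb : ∀ x ∈ L, |b x| ≤ B) (hB : 0 ≤ B)
    (hi : Integrable (fun x => uk 0 x ^ 2 + Uk 0 x (A x (Uk 0 x))) ν)
    (hi' : Integrable (fun x => wk 0 x ^ 2 + Zk 0 x (A x (Zk 0 x))) ν)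
    (hik : ∀ k, Integrable (fun x => pairing A a (b x) x (uk k x) (Uk k x) (wk k x) (Zk k x)) ν) :
    Integrable (fun x => AgmonBrooks.pairing A a (b x) x (u x) (U x) (w x) (Z x)) ν ∧
    Tendsto (fun k => ∫ x, AgmonBrooks.pairing A a (b x) x (uk k x) (Uk k x) (wk k x) (Zk k x) ∂ν)
      atTop (𝓝 (∫ x, AgmonBrooks.pairing A a (b x) x (u x) (U x) (w x) (Z x) ∂ν)) := by
  have hK : 0 ≤ (|a| + B) / 2 := by positivity
  refine integrable_and_tendsto_integral (H := fun k x => (|a| + B) / 2 * (h k x + h' k x))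
    (g := fun x => (|a| + B) / 2 * ((2 * (uk 0 x ^ 2 + Uk 0 x (A x (Uk 0 x))) + 2 * h 0 x) +
      (2 * (wk 0 x ^ 2 + Zk 0 x (A x (Zk 0 x))) + 2 * h' 0 x))) hik
    (fun k => ((H.integrable k).add (H'.integrable k)).const_mul _) (fun k => ?_) ?_ ?_ ?_
  · filter_upwards [H.nonneg hA k, H'.nonneg hA k] with x h1 h2
    positivity
  · have : ∀ k, ∫ x, (|a| + B) / 2 * (h k x + h' k x) ∂ν =
        (|a| + B) / 2 * (∫ x, h k x ∂ν + ∫ x, h' k x ∂ν) := fun k => by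
      rw [integral_const_mul, integral_add (H.integrable k) (H'.integrable k)]
    simp only [this]
    simpa using (H.tendsto.add H'.tendsto).const_mul ((|a| + B) / 2)
  · exact (((hi.const_mul 2).add ((H.integrable 0).const_mul 2)).add
      ((hi'.const_mul 2).add ((H'.integrable 0).const_mul 2))).const_mul _
  · intro τ hτ k
    filter_upwards [H.bound k, H'.bound k, H.energy_le hA 0, H'.energy_le hA 0, H.nonneg hA k,
      H'.nonneg hA k, H.nonneg hA 0, H'.nonneg hA 0] with x e1 e2 e3 e4 e5 e6 e7 e8
    have n1 := hA.nonneg x (Uk 0 x)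
    have n2 := hA.nonneg x (Zk 0 x)
    by_cases hx : x ∈ L
    -- The product of differences gets weight `1`; in the mixed terms the weights are chosen so that
    -- the difference always carries `τ⁻¹` and the limit carries `τ`.
    · rw [pairing_sub_sub]
      have d1 := abs_pairing_le hA (a := a) (hb x hx) x (uk k x - u x) (wk k x - w x)
        (Uk k x - U x) (Zk k x - Z x) one_pos
      have d2 := abs_pairing_le hA (a := a) (hb x hx) x (uk k x - u x) (w x)
        (Uk k x - U x) (Z x) hτ
      have d3 := abs_pairing_le hA (a := a) (hb x hx) x (u x) (wk k x - w x)
        (U x) (Zk k x - Z x) (inv_pos.2 hτ)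
      rw [inv_inv] at d3
      rw [inv_one, one_mul, one_mul] at d1
      refine (abs_add_three _ _ _).trans ?_
      have hτi := inv_pos.2 hτ
      calc _ ≤ (|a| + B) / 2 * (h k x + h' k x) +
            (|a| + B) / 2 * (τ⁻¹ * h k x + τ * (2 * (wk 0 x ^ 2 + Zk 0 x (A x (Zk 0 x))) +
              2 * h' 0 x)) +
            (|a| + B) / 2 * (τ * (2 * (uk 0 x ^ 2 + Uk 0 x (A x (Uk 0 x))) + 2 * h 0 x) +
              τ⁻¹ * h' k x) := by
            refine add_le_add (add_le_add (d1.trans ?_) (d2.trans ?_)) (d3.trans ?_)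
            · gcongr
            · gcongr
            · gcongr
        _ = _ := by ring
    · have z1 : AgmonBrooks.pairing A a (b x) x (uk k x) (Uk k x) (wk k x) (Zk k x) = 0 := by
        simp [AgmonBrooks.pairing, huk k x hx, hUk k x hx]
      have z2 : AgmonBrooks.pairing A a (b x) x (u x) (U x) (w x) (Z x) = 0 := by
        simp [AgmonBrooks.pairing, hu x hx, hU x hx]
      rw [z1, z2, sub_zero, abs_zero]
      positivity

end Energy

/-! ### Limits of test functions: Hardy inequality and weak equation by density. -/

section TestFunctions

variable {n : ℕ} {M : Type*} [TopologicalSpace M] [ChartedSpace (Eucl n) M]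

theorem LocallyBounded.exists_bound {f : M → ℝ} (hf : LocallyBounded f) {L : Set M}
    (hL : IsCompact L) : ∃ B, 0 ≤ B ∧ ∀ x ∈ L, |f x| ≤ B := by
  refine hL.induction_on (p := fun s => ∃ B, 0 ≤ B ∧ ∀ x ∈ s, |f x| ≤ B) ⟨0, le_rfl, by simp⟩
    ?_ ?_ ?_
  · rintro s t hst ⟨B, hB, h⟩
    exact ⟨B, hB, fun x hx => h x (hst hx)⟩
  · rintro s t ⟨B, hB, h⟩ ⟨B', hB', h'⟩
    refine ⟨max B B', le_max_of_le_left hB, fun x hx => ?_⟩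
    rcases hx with hx | hx
    · exact (h x hx).trans (le_max_left _ _)
    · exact (h' x hx).trans (le_max_right _ _)
  · intro x _
    obtain ⟨C, hC⟩ := hf x
    exact ⟨_, mem_nhdsWithin_of_mem_nhds hC, C, (abs_nonneg _).trans hC.self_of_nhds, fun y hy => hy⟩

theorem Continuous.locallyBounded {f : M → ℝ} (hf : Continuous f) : LocallyBounded f := fun x =>
  ⟨|f x| + 1, (hf.abs.continuousAt.eventually (gt_mem_nhds (lt_add_one _))).mono fun _ h => h.le⟩

theorem diff_eq_zero_of_notMem_tsupport {u : M → ℝ} {x : M} (hx : x ∉ tsupport u) :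
    diff n u x = 0 := by
  have h : u =ᶠ[𝓝 x] fun _ => 0 := notMem_tsupport_iff_eventuallyEq.1 hx
  unfold diff
  rw [h.mfderiv_eq]
  exact mfderiv_const

variable [MeasurableSpace M] [BorelSpace M] {A : CoeffField n M} {ν : Measure M}

theorem isLocallyFiniteMeasure (hν : HasLocallyBoundedDensity n ν) : IsLocallyFiniteMeasure ν := by
  refine ⟨fun x => ?_⟩
  obtain ⟨δ, hδ, C, hsub, -, hae, hle⟩ := exists_chartBall_map_le hν x univ_mem
  refine ⟨chartBall n x δ, (isOpen_chartBall x δ).mem_nhds (mem_chartBall_self x hδ), ?_⟩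
  have h1 := hle (Metric.ball (chartAt (Eucl n) x x) δ)
  rw [Measure.map_apply_of_aemeasurable hae measurableSet_ball,
    Measure.restrict_apply' (isOpen_chartBall x δ).measurableSet] at h1
  have h2 : chartBall n x δ ⊆ chartAt (Eucl n) x ⁻¹' Metric.ball (chartAt (Eucl n) x x) δ ∩
      chartBall n x δ := fun z hz => ⟨hz.2, hz⟩
  refine (measure_mono h2).trans_lt (h1.trans_lt ?_)
  exact ENNReal.mul_lt_top ENNReal.coe_lt_top measure_ball_lt_top

theorem LocallyBounded.integrable [T2Space M] {f : M → ℝ} (hf : LocallyBounded f)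
    (hν : HasLocallyBoundedDensity n ν)
    (hm : Measurable f) {L : Set M} (hL : IsCompact L) (h0 : ∀ x ∉ L, f x = 0) :
    Integrable f ν := by
  have := isLocallyFiniteMeasure hν
  obtain ⟨B, hB, h⟩ := hf.exists_bound hL
  refine (integrableOn_iff_integrable_of_support_subset (s := L) fun x hx => ?_).1 ?_
  · by_contra hxL
    exact hx (h0 x hxL)
  · refine Measure.integrableOn_of_bounded hL.measure_lt_top.ne hm.aestronglyMeasurable (M := B) ?_
    exact (ae_restrict_iff' hL.measurableSet).2 (Eventually.of_forall h)

variable [IsManifold (𝓡 n) ∞ M] [T2Space M]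

theorem contDiffOn_comp_chart_symm {u : M → ℝ} (hu : ContMDiff (𝓡 n) 𝓘(ℝ, ℝ) ∞ u) (x₀ : M) :
    ContDiffOn ℝ ∞ (fun z => u ((chartAt (Eucl n) x₀).symm z)) (chartAt (Eucl n) x₀).target :=
  contMDiffOn_iff_contDiffOn.1 (hu.comp_contMDiffOn contMDiffOn_chart_symm)

theorem locallyBounded_energy (hA : IsEllipticField n A) {u : M → ℝ}
    (hu : ContMDiff (𝓡 n) 𝓘(ℝ, ℝ) ∞ u) :
    LocallyBounded fun x => diff n u x (A x (diff n u x)) := by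
  intro x₀
  obtain ⟨C, hC, hb⟩ := hA.bounds x₀
  set e := chartAt (Eucl n) x₀ with he
  have hx₀ : x₀ ∈ e.source := mem_chart_source _ _
  have hF := contDiffOn_comp_chart_symm hu x₀
  have hF' := (hF.continuousOn_fderiv_of_isOpen e.open_target (by simp)).continuousAt
    (e.open_target.mem_nhds (mem_chart_target _ x₀))
  have h1 : ContinuousAt (fun x => ‖fderiv ℝ (fun z => u (e.symm z)) (e x)‖) x₀ :=
    (ContinuousAt.comp (f := e) (x := x₀) hF' (e.continuousAt hx₀)).norm
  refine ⟨C * (‖fderiv ℝ (fun z => u (e.symm z)) (e x₀)‖ + 1) ^ 2, ?_⟩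
  filter_upwards [hb, h1.eventually (gt_mem_nhds (lt_add_one _)), e.open_source.mem_nhds hx₀]
    with x hx1 hx2 hx3
  obtain ⟨y, hy, rfl⟩ : ∃ y ∈ e.target, e.symm y = x := ⟨e x, e.map_source hx3, e.left_inv hx3⟩
  have hd : diff n u (e.symm y) = (fderiv ℝ (fun z => u (e.symm z)) y).comp
      (chartDeriv n x₀ (e.symm y)) :=
    (hasMFDerivAt_of_comp_chart_symm hy ((hF.differentiableOn (by simp)).differentiableAt
      (e.open_target.mem_nhds hy)).hasFDerivAt (Eventually.of_forall fun _ => rfl)).mfderiv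
  rw [e.right_inv hy] at hx2
  rw [hd, abs_of_nonneg (hA.nonneg _ _)]
  refine (hx1 _).2.trans ?_
  gcongr

theorem integrable_pairing_of_smooth (hν : HasLocallyBoundedDensity n ν) (hA : IsEllipticField n A)
    {u w : M → ℝ} (hu : ContMDiff (𝓡 n) 𝓘(ℝ, ℝ) ∞ u) (hw : ContMDiff (𝓡 n) 𝓘(ℝ, ℝ) ∞ w)
    {L : Set M} (hL : IsCompact L) (huL : tsupport u ⊆ L) (a : ℝ) {b : M → ℝ} (hb : Measurable b)
    (hbb : LocallyBounded b) :
    Integrable (fun x => pairing A a (b x) x (u x) (diff n u x) (w x) (diff n w x)) ν := by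
  have hum := hu.continuous.measurable
  have hwm := hw.continuous.measurable
  refine LocallyBounded.integrable (n := n) ?_ hν ?_ hL fun x hx => ?_
  · intro x
    obtain ⟨B, hB⟩ := hbb x
    obtain ⟨B1, hB1⟩ := locallyBounded_energy hA hu x
    obtain ⟨B2, hB2⟩ := locallyBounded_energy hA hw x
    obtain ⟨B3, hB3⟩ := Continuous.locallyBounded (f := fun x => u x ^ 2) (hu.continuous.pow 2) x
    obtain ⟨B4, hB4⟩ := Continuous.locallyBounded (f := fun x => w x ^ 2) (hw.continuous.pow 2) x
    refine ⟨(|a| + B) / 2 * ((B3 + B1) + (B4 + B2)), ?_⟩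
    filter_upwards [hB, hB1, hB2, hB3, hB4] with y h h1 h2 h3 h4
    have h0 : 0 ≤ B := (abs_nonneg _).trans h
    refine (abs_pairing_le hA h y _ _ _ _ one_pos).trans ?_
    rw [inv_one, one_mul, one_mul]
    have := (le_abs_self _).trans h1
    have := (le_abs_self _).trans h2
    have := (le_abs_self _).trans h3
    have := (le_abs_self _).trans h4
    gcongr
  · exact ((hA.measurable u w hu hw).const_mul a).add (hb.mul (hum.mul hwm))
  · have hx' : x ∉ tsupport u := fun h => hx (huL h)
    simp [pairing, image_eq_zero_of_notMem_tsupport hx', diff_eq_zero_of_notMem_tsupport hx']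

/-- The pair `(u, U)` is a limit in energy of test functions supported in `L`. -/
structure IsApprox (ν : Measure M) (A : CoeffField n M) (L : Set M) (u : M → ℝ)
    (U : ∀ x : M, Cotangent n x) (uk : ℕ → M → ℝ) (h : ℕ → M → ℝ) : Prop where
  smooth : ∀ k, ContMDiff (𝓡 n) 𝓘(ℝ, ℝ) ∞ (uk k)
  tsupport_subset : ∀ k, tsupport (uk k) ⊆ L
  eq_zero : ∀ x ∉ L, u x = 0
  diff_eq_zero : ∀ x ∉ L, U x = 0
  energy : EnergyTendsto ν A uk (fun k => diff n (uk k)) u U h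

variable {L L' : Set M} {u w : M → ℝ} {U Z : ∀ x : M, Cotangent n x} {uk wk h h' : ℕ → M → ℝ}

theorem IsApprox.isTestFunction (H : IsApprox ν A L u U uk h) (hL : IsCompact L) {O : Set M}
    (hLO : L ⊆ O) (k : ℕ) : IsTestFunction n O (uk k) :=
  ⟨H.smooth k, hL.of_isClosed_subset (isClosed_tsupport _) (H.tsupport_subset k),
    (H.tsupport_subset k).trans hLO⟩

theorem integrable_energy_of_smooth (hν : HasLocallyBoundedDensity n ν) (hA : IsEllipticField n A)
    {u : M → ℝ} (hu : ContMDiff (𝓡 n) 𝓘(ℝ, ℝ) ∞ u)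
    {L : Set M} (hL : IsCompact L) (huL : tsupport u ⊆ L) :
    Integrable (fun x => u x ^ 2 + diff n u x (A x (diff n u x))) ν := by
  refine (integrable_pairing_of_smooth hν hA hu hu hL huL 1 (measurable_const (a := (1 : ℝ)))
    fun x => ⟨1, by simp⟩).congr (Eventually.of_forall fun x => ?_)
  simp only [pairing]
  ring

theorem IsApprox.pairing (hν : HasLocallyBoundedDensity n ν) (hA : IsEllipticField n A)
    (hL : IsCompact L) (H : IsApprox ν A L u U uk h) (hL' : IsCompact L')
    (H' : IsApprox ν A L' w Z wk h') (a : ℝ) {b : M → ℝ} (hb : Measurable b)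
    (hbb : LocallyBounded b) :
    Integrable (fun x => pairing A a (b x) x (u x) (U x) (w x) (Z x)) ν ∧
    Tendsto (fun k => ∫ x, AgmonBrooks.pairing A a (b x) x (uk k x) (diff n (uk k) x)
      (wk k x) (diff n (wk k) x) ∂ν)
      atTop (𝓝 (∫ x, AgmonBrooks.pairing A a (b x) x (u x) (U x) (w x) (Z x) ∂ν)) := by
  obtain ⟨B, hB, hbL⟩ := hbb.exists_bound hL
  exact H.energy.pairing hA H'.energy (L := L)
    (fun k x hx => image_eq_zero_of_notMem_tsupport fun h => hx (H.tsupport_subset k h))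
    (fun k x hx => diff_eq_zero_of_notMem_tsupport fun h => hx (H.tsupport_subset k h))
    H.eq_zero H.diff_eq_zero hbL hB
    (integrable_energy_of_smooth hν hA (H.smooth 0) hL (H.tsupport_subset 0))
    (integrable_energy_of_smooth hν hA (H'.smooth 0) hL' (H'.tsupport_subset 0))
    fun k => integrable_pairing_of_smooth hν hA (H.smooth k) (H'.smooth k) hL
      (H.tsupport_subset k) a hb hbb

/-- Extension of the Hardy inequality outside a compact set by density. -/
theorem IsApprox.hardy (hν : HasLocallyBoundedDensity n ν) (hA : IsEllipticField n A)
    (hL : IsCompact L) (H : IsApprox ν A L u U uk h) {c W : M → ℝ} (hc : Measurable c)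
    (hcb : LocallyBounded c) (hW : Measurable W) (hWb : LocallyBounded W) {K : Set M}
    (hLK : L ⊆ Kᶜ) {α : ℝ}
    (hardy : ∀ u : M → ℝ, IsTestFunction n Kᶜ u →
      α * ∫ x in Kᶜ, W x * u x ^ 2 ∂ν ≤ quadForm n ν A c u) :
    Integrable (fun x => W x * u x ^ 2) ν ∧
    Integrable (fun x => U x (A x (U x)) + c x * u x ^ 2) ν ∧
    α * ∫ x, W x * u x ^ 2 ∂ν ≤ ∫ x, (U x (A x (U x)) + c x * u x ^ 2) ∂ν := by
  -- The two sides of the inequality are the pairings of the approximation with itself for the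
  -- coefficients `(0, W)` and `(1, c)`.
  obtain ⟨i1, t1⟩ := H.pairing hν hA hL hL H 0 hW hWb
  obtain ⟨i2, t2⟩ := H.pairing hν hA hL hL H 1 hc hcb
  simp only [AgmonBrooks.pairing, zero_mul, zero_add, one_mul, ← sq] at i1 t1 i2 t2
  refine ⟨i1, i2, le_of_tendsto_of_tendsto' (t1.const_mul α) t2 fun k => ?_⟩
  have h1 := hardy _ (H.isTestFunction hL hLK k)
  rwa [setIntegral_eq_integral_of_forall_compl_eq_zero fun x hx => ?_] at h1
  rw [image_eq_zero_of_notMem_tsupport fun h => hx (hLK (H.tsupport_subset k h))]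
  ring

/-- Extension of the weak equation by density, when the weak solution `(f, G)` coincides on the
support with an approximable pair. -/
theorem IsApprox.weak_eq (hν : HasLocallyBoundedDensity n ν) (hA : IsEllipticField n A)
    (hL : IsCompact L) (H : IsApprox ν A L u U uk h) (hL' : IsCompact L')
    (H' : IsApprox ν A L' w Z wk h') {c : M → ℝ} (hc : Measurable c) (hcb : LocallyBounded c)
    {f : M → ℝ} {G : ∀ x : M, Cotangent n x} (hf : ∀ x ∈ L, w x = f x) (hG : ∀ x ∈ L, Z x = G x)
    (hweak : ∀ ψ : M → ℝ, IsTestFunction n univ ψ →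
      ∫ x, (diff n ψ x (A x (G x)) + c x * f x * ψ x) ∂ν = 0) :
    Integrable (fun x => U x (A x (G x)) + c x * f x * u x) ν ∧
    ∫ x, (U x (A x (G x)) + c x * f x * u x) ∂ν = 0 := by
  obtain ⟨B, hB, hbL⟩ := hcb.exists_bound hL
  have hE : Integrable (fun x => w x ^ 2 + Z x (A x (Z x))) ν := by
    refine ((H'.pairing hν hA hL' hL' H' 1 (measurable_const (a := (1 : ℝ)))
      fun x => ⟨1, by simp⟩).1).congr (Eventually.of_forall fun x => ?_)
    simp only [AgmonBrooks.pairing]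
    ring
  have hz : ∀ k, ∀ x ∉ L, uk k x = 0 := fun k x hx =>
    image_eq_zero_of_notMem_tsupport fun h => hx (H.tsupport_subset k h)
  have hz' : ∀ k, ∀ x ∉ L, diff n (uk k) x = 0 := fun k x hx =>
    diff_eq_zero_of_notMem_tsupport fun h => hx (H.tsupport_subset k h)
  have hcongr : ∀ (s : M → ℝ) (S : ∀ x : M, Cotangent n x), (∀ x ∉ L, s x = 0) →
      (∀ x ∉ L, S x = 0) → ∀ x, AgmonBrooks.pairing A 1 (c x) x (s x) (S x) (w x) (Z x) =
        S x (A x (G x)) + c x * f x * s x := by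
    intro s S hs hS x
    by_cases hx : x ∈ L
    · simp only [AgmonBrooks.pairing, hf x hx, hG x hx]
      ring
    · simp [AgmonBrooks.pairing, hs x hx, hS x hx]
  -- Two stages: with `uk k` fixed, the limit in the second argument gives integrability of the
  -- mixed pairing; only then does `k → ∞`.
  have hik : ∀ k, Integrable
      (fun x => AgmonBrooks.pairing A 1 (c x) x (uk k x) (diff n (uk k) x) (w x) (Z x)) ν := fun k =>
    ((EnergyTendsto.const ν (uk k) (diff n (uk k))).pairing hA H'.energy (L := L)
      (fun _ => hz k) (fun _ => hz' k) (hz k) (hz' k) hbL hB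
      (integrable_energy_of_smooth hν hA (H.smooth k) hL (H.tsupport_subset k))
      (integrable_energy_of_smooth hν hA (H'.smooth 0) hL' (H'.tsupport_subset 0))
      fun j => integrable_pairing_of_smooth hν hA (H.smooth k) (H'.smooth j) hL
        (H.tsupport_subset k) 1 hc hcb).1
  obtain ⟨i, t⟩ := H.energy.pairing hA (EnergyTendsto.const ν w Z) hz hz' H.eq_zero H.diff_eq_zero
    hbL hB (integrable_energy_of_smooth hν hA (H.smooth 0) hL (H.tsupport_subset 0)) hE hik
  simp only [hcongr u U H.eq_zero H.diff_eq_zero, hcongr _ _ (hz _) (hz' _)] at i t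
  refine ⟨i, tendsto_nhds_unique t ?_⟩
  simp only [hweak _ (H.isTestFunction hL (subset_univ _) _)]
  exact tendsto_const_nhds

end TestFunctions

/-! ### Euclidean preliminaries. -/

section EuclideanPreliminaries

/-- Extension by zero of a Lipschitz function supported in a compact subset. -/
theorem exists_lipschitzWith_indicator {E : Type*} [NormedAddCommGroup E] [NormedSpace ℝ E]
    {f : E → ℝ} {s K : Set E} {C : ℝ≥0}
    (hs : IsOpen s) (hK : IsCompact K) (hKs : K ⊆ s) (hf : LipschitzOnWith C f s)
    (h0 : ∀ x ∈ s, x ∉ K → f x = 0) : ∃ C', LipschitzWith C' (s.indicator f) := by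
  obtain ⟨η, hη, hηs⟩ := hK.exists_thickening_subset_open hs hKs
  obtain ⟨B, hB⟩ := hK.exists_bound_of_continuousOn (hf.continuousOn.mono hKs)
  have hBn : 0 ≤ max B 0 := le_max_right _ _
  -- Points of `K` are at distance at least `η` from the complement of `s`, so a value of size at
  -- most `max B 0` costs only the slope `max B 0 / η`.
  have key : ∀ x ∈ s, ∀ y ∉ s, |f x| ≤ (C + max B 0 / η) * dist x y := by
    intro x hx y hy
    by_cases hxK : x ∈ K
    · have h1 : η ≤ dist x y := by
        by_contra! h
        exact hy (hηs (Metric.mem_thickening_iff.2 ⟨x, hxK, by rwa [dist_comm]⟩))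
      calc |f x| ≤ max B 0 := (hB x hxK).trans (le_max_left _ _)
        _ = max B 0 / η * η := by field_simp
        _ ≤ (C + max B 0 / η) * dist x y := by
          gcongr
          exact le_add_of_nonneg_left C.2
    · rw [h0 x hx hxK, abs_zero]
      positivity
  refine ⟨⟨C + max B 0 / η, by positivity⟩, LipschitzWith.of_dist_le_mul fun x y => ?_⟩
  change _ ≤ ((C : ℝ) + max B 0 / η) * dist x y
  by_cases hx : x ∈ s <;> by_cases hy : y ∈ s
  · rw [indicator_of_mem hx, indicator_of_mem hy]
    refine (hf.dist_le_mul x hx y hy).trans ?_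
    gcongr
    exact le_add_of_nonneg_right (by positivity)
  · rw [indicator_of_mem hx, indicator_of_notMem hy, Real.dist_eq, sub_zero]
    exact key x hx y hy
  · rw [indicator_of_notMem hx, indicator_of_mem hy, dist_comm, Real.dist_eq, sub_zero, dist_comm]
    exact key y hy x hx
  · rw [indicator_of_notMem hx, indicator_of_notMem hy, dist_self]
    positivity

theorem exists_lipschitzOnWith_mul_ball {E : Type*} [PseudoMetricSpace E] {f g : E → ℝ}
    {p : E} {r : ℝ} {C C' : ℝ≥0} (hr : 0 < r) (hf : LipschitzOnWith C f (Metric.ball p r))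
    (hg : LipschitzOnWith C' g (Metric.ball p r)) :
    ∃ K, LipschitzOnWith K (fun x => f x * g x) (Metric.ball p r) := by
  have hb : ∀ {f : E → ℝ} {D : ℝ≥0}, LipschitzOnWith D f (Metric.ball p r) →
      ∃ B : ℝ≥0, ∀ y ∈ Metric.ball p r, ‖f y‖ ≤ B := by
    intro f D hf
    refine ⟨⟨‖f p‖ + D * r, by positivity⟩, fun y hy => ?_⟩
    change ‖f y‖ ≤ ‖f p‖ + D * r
    have h1 := hf.dist_le_mul y hy p (Metric.mem_ball_self hr)
    have h2 : dist (f y) (f p) ≤ D * r := h1.trans (by gcongr; exact (Metric.mem_ball.1 hy).le)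
    rw [dist_eq_norm] at h2
    linarith [norm_sub_norm_le (f y) (f p)]
  obtain ⟨B, hB⟩ := hb hf
  obtain ⟨B', hB'⟩ := hb hg
  refine ⟨B * C' + C * B', LipschitzOnWith.of_dist_le_mul fun y hy z hz => ?_⟩
  have e1 := hf.dist_le_mul y hy z hz
  have e2 := hg.dist_le_mul y hy z hz
  have e3 := hB y hy
  have e4 := hB' z hz
  rw [dist_eq_norm] at e1 e2 ⊢
  calc ‖f y * g y - f z * g z‖ = ‖f y * (g y - g z) + (f y - f z) * g z‖ := by ring_nf
    _ ≤ ‖f y‖ * ‖g y - g z‖ + ‖f y - f z‖ * ‖g z‖ := by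
      refine (norm_add_le _ _).trans ?_
      rw [norm_mul, norm_mul]
    _ ≤ B * (C' * dist y z) + C * dist y z * B' := by gcongr
    _ = _ := by push_cast; ring

/-- Cauchy–Schwarz in coordinates: the norm of an error covector is controlled by finitely many
directional derivatives, for which `L²` convergence is known. -/
theorem norm_sq_le_sum_sq {n : ℕ} (η : Eucl n →L[ℝ] ℝ) :
    ‖η‖ ^ 2 ≤ ∑ i, η (EuclideanSpace.single i 1) ^ 2 := by
  have hS : 0 ≤ ∑ i, η (EuclideanSpace.single i 1) ^ 2 := Finset.sum_nonneg fun _ _ => sq_nonneg _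
  have h : ‖η‖ ≤ √(∑ i, η (EuclideanSpace.single i 1) ^ 2) := by
    refine η.opNorm_le_bound (Real.sqrt_nonneg _) fun x => ?_
    have hx : η x = ∑ i, η (EuclideanSpace.single i 1) * x i := by
      conv_lhs => rw [← (EuclideanSpace.basisFun (Fin n) ℝ).sum_repr x]
      simp [mul_comm]
    rw [EuclideanSpace.norm_eq, ← Real.sqrt_mul hS, hx]
    refine Real.abs_le_sqrt ((Finset.sum_mul_sq_le_sq_mul_sq _ _ _).trans_eq ?_)
    simp
  calc ‖η‖ ^ 2 ≤ √(∑ i, η (EuclideanSpace.single i 1) ^ 2) ^ 2 := by gcongr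
    _ = _ := Real.sq_sqrt hS

theorem integral_sq_eq_eLpNorm {X : Type*} [MeasurableSpace X] {μ : Measure X} {f : X → ℝ}
    (hf : MemLp f 2 μ) : ∫ x, f x ^ 2 ∂μ = (eLpNorm f 2 μ).toReal ^ 2 := by
  rw [hf.eLpNorm_eq_integral_rpow_norm two_ne_zero ENNReal.ofNat_ne_top,
    ENNReal.toReal_ofReal (by positivity), ← Real.rpow_natCast, ← Real.rpow_mul (by positivity)]
  simp

theorem tendsto_integral_sq {X : Type*} [MeasurableSpace X] {μ : Measure X} {f : ℕ → X → ℝ}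
    (hf : ∀ k, MemLp (f k) 2 μ) (h : Tendsto (fun k => eLpNorm (f k) 2 μ) atTop (𝓝 0)) :
    Tendsto (fun k => ∫ x, f k x ^ 2 ∂μ) atTop (𝓝 0) := by
  simp only [fun k => integral_sq_eq_eLpNorm (hf k)]
  simpa using ((ENNReal.tendsto_toReal ENNReal.zero_ne_top).comp h).pow 2

end EuclideanPreliminaries

/-! ### Functions that are Lipschitz in charts. -/

section ChartLipschitz

variable {n : ℕ} {M : Type*} [TopologicalSpace M] [ChartedSpace (Eucl n) M]

/-- A function that is Lipschitz in small balls of the preferred charts. -/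
def ChartLipschitz (n : ℕ) {M : Type*} [TopologicalSpace M] [ChartedSpace (Eucl n) M]
    (v : M → ℝ) : Prop :=
  ∀ x₀ : M, ∃ δ > 0, Metric.ball (chartAt (Eucl n) x₀ x₀) δ ⊆ (chartAt (Eucl n) x₀).target ∧
    ∃ C : ℝ≥0, LipschitzOnWith C (fun y => v ((chartAt (Eucl n) x₀).symm y))
      (Metric.ball (chartAt (Eucl n) x₀ x₀) δ)

variable {v w : M → ℝ}

theorem ChartLipschitz.mul (hv : ChartLipschitz n v) (hw : ChartLipschitz n w) :
    ChartLipschitz n fun x => v x * w x := by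
  intro x₀
  obtain ⟨δ, hδ, hsub, C, hC⟩ := hv x₀
  obtain ⟨δ', hδ', -, C', hC'⟩ := hw x₀
  refine ⟨min δ δ', lt_min hδ hδ', (Metric.ball_subset_ball (min_le_left _ _)).trans hsub, ?_⟩
  exact exists_lipschitzOnWith_mul_ball (lt_min hδ hδ')
    (hC.mono (Metric.ball_subset_ball (min_le_left _ _)))
    (hC'.mono (Metric.ball_subset_ball (min_le_right _ _)))

theorem ChartLipschitz.comp (hv : ChartLipschitz n v) {f : ℝ → ℝ} {D : ℝ≥0}
    (hf : LipschitzWith D f) : ChartLipschitz n fun x => f (v x) := by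
  intro x₀
  obtain ⟨δ, hδ, hsub, C, hC⟩ := hv x₀
  exact ⟨δ, hδ, hsub, D * C, hf.comp_lipschitzOnWith hC⟩

variable [IsManifold (𝓡 n) ∞ M]

theorem chartLipschitz_of_contMDiff (hv : ContMDiff (𝓡 n) 𝓘(ℝ, ℝ) ∞ v) : ChartLipschitz n v := by
  intro x₀
  have h1 : ContDiffAt ℝ 1 (fun z => v ((chartAt (Eucl n) x₀).symm z))
      (chartAt (Eucl n) x₀ x₀) :=
    (((contMDiffOn_iff_contDiffOn.1 (hv.comp_contMDiffOn contMDiffOn_chart_symm)).contDiffAt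
      ((chartAt (Eucl n) x₀).open_target.mem_nhds (mem_chart_target _ _)))).of_le (by simp)
  obtain ⟨C, s, hs, hC⟩ := h1.exists_lipschitzOnWith
  obtain ⟨δ, hδ, h⟩ := Metric.mem_nhds_iff.1
    (inter_mem hs ((chartAt (Eucl n) x₀).open_target.mem_nhds (mem_chart_target _ x₀)))
  exact ⟨δ, hδ, h.trans inter_subset_right, C, hC.mono (h.trans inter_subset_left)⟩

theorem ChartLipschitz.ae_mdifferentiableAt [SecondCountableTopology M] [MeasurableSpace M]
    [BorelSpace M] {ν : Measure M} (hν : HasLocallyBoundedDensity n ν) (hv : ChartLipschitz n v) :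
    ∀ᵐ x ∂ν, MDifferentiableAt (𝓡 n) 𝓘(ℝ, ℝ) v x := by
  refine ae_of_chart hν fun x₀ => ?_
  obtain ⟨δ, hδ, hsub, C, hC⟩ := hv x₀
  refine ⟨δ, hδ, ?_⟩
  filter_upwards [hC.ae_differentiableWithinAt_of_mem (μ := volume)] with y hy hyb
  have h1 := ((hy hyb).differentiableAt (Metric.isOpen_ball.mem_nhds hyb)).hasFDerivAt
  exact (hasMFDerivAt_of_comp_chart_symm (hsub hyb) h1
    (Eventually.of_forall fun _ => rfl)).mdifferentiableAt

end ChartLipschitz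

/-! ### Approximation of `φ v` in energy by test functions. -/

section Membership

variable {n : ℕ} {M : Type*} [TopologicalSpace M] [ChartedSpace (Eucl n) M]

theorem IsSobolevWithDiff.isLocalSobolev {φ : M → ℝ} {G : ∀ x : M, Cotangent n x}
    (h : IsSobolevWithDiff n φ G) (x₀ : M) {Ω : Set (Eucl n)}
    (hΩ : Ω ⊆ (chartAt (Eucl n) x₀).target) :
    IsLocalSobolev volume Ω (fun y => φ ((chartAt (Eucl n) x₀).symm y))
      (fun v y => G ((chartAt (Eucl n) x₀).symm y) (chartSymmDeriv n x₀ y v)) where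
  memLp K hK hKc := ((h x₀).1 K (hK.trans hΩ) hKc).1
  memLp_deriv K hK hKc v := ((h x₀).1 K (hK.trans hΩ) hKc).2 v
  weak ψ h1 h2 h3 v := (h x₀).2 ψ h1 h2 (h3.trans hΩ) v

/-- A function on a chart, extended by zero. -/
def chartExtend (n : ℕ) {M : Type*} [TopologicalSpace M] [ChartedSpace (Eucl n) M]
    (x₀ : M) (f : Eucl n → ℝ) : M → ℝ :=
  (chartAt (Eucl n) x₀).source.indicator fun x => f (chartAt (Eucl n) x₀ x)

theorem chartExtend_symm {x₀ : M} {y : Eucl n} (hy : y ∈ (chartAt (Eucl n) x₀).target)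
    (f : Eucl n → ℝ) : chartExtend n x₀ f ((chartAt (Eucl n) x₀).symm y) = f y := by
  rw [chartExtend, indicator_of_mem ((chartAt (Eucl n) x₀).map_target hy),
    (chartAt (Eucl n) x₀).right_inv hy]

theorem tsupport_chartExtend_subset [T2Space M] (x₀ : M) {f : Eucl n → ℝ} {L : Set (Eucl n)}
    (hL : IsCompact L) (hLt : L ⊆ (chartAt (Eucl n) x₀).target) (hf : tsupport f ⊆ L) :
    tsupport (chartExtend n x₀ f) ⊆ (chartAt (Eucl n) x₀).symm '' L := by
  refine closure_minimal (fun x hx => ?_)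
    (hL.image_of_continuousOn ((chartAt (Eucl n) x₀).continuousOn_symm.mono hLt)).isClosed
  have hs : x ∈ (chartAt (Eucl n) x₀).source := mem_of_indicator_ne_zero hx
  refine ⟨chartAt (Eucl n) x₀ x, hf (subset_tsupport _ ?_), (chartAt (Eucl n) x₀).left_inv hs⟩
  rw [Function.mem_support, chartExtend, indicator_of_mem hs] at hx
  exact hx

variable [IsManifold (𝓡 n) ∞ M]

theorem contMDiff_chartExtend [T2Space M] (x₀ : M) {f : Eucl n → ℝ} {L : Set (Eucl n)}
    (hL : IsCompact L) (hLt : L ⊆ (chartAt (Eucl n) x₀).target) (hfL : tsupport f ⊆ L)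
    (hf : ContDiff ℝ ∞ f) : ContMDiff (𝓡 n) 𝓘(ℝ, ℝ) ∞ (chartExtend n x₀ f) := by
  refine contMDiff_of_tsupport fun x hx => ?_
  obtain ⟨y, hy, rfl⟩ := tsupport_chartExtend_subset x₀ hL hLt hfL hx
  have hs : (chartAt (Eucl n) x₀).symm y ∈ (chartAt (Eucl n) x₀).source :=
    (chartAt (Eucl n) x₀).map_target (hLt hy)
  have h1 : ContMDiffAt (𝓡 n) 𝓘(ℝ, ℝ) ∞ (f ∘ chartAt (Eucl n) x₀)
      ((chartAt (Eucl n) x₀).symm y) :=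
    hf.contMDiff.contMDiffAt.comp _ (contMDiffOn_chart.contMDiffAt
      ((chartAt (Eucl n) x₀).open_source.mem_nhds hs))
  refine h1.congr_of_eventuallyEq ?_
  filter_upwards [(chartAt (Eucl n) x₀).open_source.mem_nhds hs] with z hz
  exact indicator_of_mem hz _

theorem diff_chartExtend {x₀ : M} {y : Eucl n} (hy : y ∈ (chartAt (Eucl n) x₀).target)
    {f : Eucl n → ℝ} (hf : DifferentiableAt ℝ f y) :
    diff n (chartExtend n x₀ f) ((chartAt (Eucl n) x₀).symm y) =
      ((fderiv ℝ f y).comp (chartDeriv n x₀ ((chartAt (Eucl n) x₀).symm y)) :) :=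
  (hasMFDerivAt_of_comp_chart_symm hy hf.hasFDerivAt
    (((chartAt (Eucl n) x₀).open_target.eventually_mem hy).mono
      fun _ hz => chartExtend_symm hz f)).mfderiv

variable [T2Space M] [MeasurableSpace M] [BorelSpace M] {A : CoeffField n M} {ν : Measure M}

/-- Change of variables, with the bound `hle` on the image measure in place of a Jacobian. -/
theorem integrable_indicator_chart {x₀ : M} {δ : ℝ} {C : ℝ≥0}
    (hae : AEMeasurable (chartAt (Eucl n) x₀) (ν.restrict (chartBall n x₀ δ)))
    (hle : (ν.restrict (chartBall n x₀ δ)).map (chartAt (Eucl n) x₀) ≤ C • volume)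
    {F : Eucl n → ℝ} (hF : Integrable F) (hF0 : ∀ y, 0 ≤ F y) :
    Integrable ((chartBall n x₀ δ).indicator fun x => F (chartAt (Eucl n) x₀ x)) ν ∧
    ∫ x, (chartBall n x₀ δ).indicator (fun x => F (chartAt (Eucl n) x₀ x)) x ∂ν ≤
      C * ∫ y, F y := by
  have hm := (isOpen_chartBall (n := n) x₀ δ).measurableSet
  have hF1 : Integrable F ((C : ℝ≥0∞) • volume) := hF.smul_measure ENNReal.coe_ne_top
  have hF2 := hF1.mono_measure hle
  refine ⟨(integrable_indicator_iff hm).2 ((integrable_map_measure hF2.1 hae).1 hF2), ?_⟩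
  rw [integral_indicator hm, ← integral_map hae hF2.1]
  refine (integral_mono_measure hle (Eventually.of_forall hF0) hF1).trans_eq ?_
  rw [integral_smul_nnreal_measure]
  rfl

/-- The weak differential of the product `φ v`. -/
def mulDiff (n : ℕ) {M : Type*} [TopologicalSpace M] [ChartedSpace (Eucl n) M] (φ : M → ℝ)
    (G : ∀ x : M, Cotangent n x) (v : M → ℝ) (x : M) : Cotangent n x :=
  φ x • diff n v x + v x • G x

variable [SecondCountableTopology M] {φ : M → ℝ} {G : ∀ x : M, Cotangent n x} {v : M → ℝ}

/-- In coordinates `φ v` is a Sobolev function times a compactly supported Lipschitz one, so it can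
be mollified. `L²` convergence of the function and of its partial derivatives controls the energy,
because `A` is bounded above by `C₂` in the ball and `ν` is dominated by Lebesgue measure. -/
theorem exists_isApprox_chartBall (hν : HasLocallyBoundedDensity n ν)
    (hφ : IsSobolevWithDiff n φ G) {x₀ : M} {δ : ℝ} {C C₁ : ℝ≥0} {C₂ : ℝ} (hC₂ : 0 ≤ C₂)
    (hsub : Metric.ball (chartAt (Eucl n) x₀ x₀) δ ⊆ (chartAt (Eucl n) x₀).target)
    (hae : AEMeasurable (chartAt (Eucl n) x₀) (ν.restrict (chartBall n x₀ δ)))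
    (hle : (ν.restrict (chartBall n x₀ δ)).map (chartAt (Eucl n) x₀) ≤ C • volume)
    (hAb : ∀ x ∈ chartBall n x₀ δ, ∀ η : Eucl n →L[ℝ] ℝ,
      (η.comp (chartDeriv n x₀ x)) (A x (η.comp (chartDeriv n x₀ x))) ≤ C₂ * ‖η‖ ^ 2)
    (hv : ChartLipschitz n v)
    (hvL : LipschitzOnWith C₁ (fun y => v ((chartAt (Eucl n) x₀).symm y))
      (Metric.ball (chartAt (Eucl n) x₀ x₀) δ))
    (hvc : HasCompactSupport v) (hvB : tsupport v ⊆ chartBall n x₀ δ) :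
    ∃ (L : Set M) (uk h : ℕ → M → ℝ), IsCompact L ∧ L ⊆ chartBall n x₀ δ ∧
      IsApprox ν A L (fun x => φ x * v x) (mulDiff n φ G v) uk h := by
  set e := chartAt (Eucl n) x₀ with he
  set b := Metric.ball (e x₀) δ with hb
  have hK : IsCompact (e '' tsupport v) :=
    hvc.isCompact.image_of_continuousOn (e.continuousOn.mono fun x hx => (hvB hx).1)
  have hKb : e '' tsupport v ⊆ b := by
    rintro _ ⟨x, hx, rfl⟩
    exact (hvB hx).2
  have hv0 : ∀ y ∈ b, y ∉ e '' tsupport v → v (e.symm y) = 0 := fun y hy hyK =>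
    image_eq_zero_of_notMem_tsupport fun h => hyK ⟨_, h, e.right_inv (hsub hy)⟩
  set w : Eucl n → ℝ := b.indicator fun y => v (e.symm y) with hw
  obtain ⟨C', hwL⟩ := exists_lipschitzWith_indicator Metric.isOpen_ball hK hKb hvL hv0
  have hwK : tsupport w ⊆ e '' tsupport v := by
    refine closure_minimal (fun y hy => ?_) hK.isClosed
    by_contra hyK
    have hyb : y ∈ b := mem_of_indicator_ne_zero hy
    exact hy ((indicator_of_mem hyb _).trans (hv0 y hyb hyK))
  have hwc : HasCompactSupport w := hK.of_isClosed_subset (isClosed_tsupport _) hwK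
  have hwb : tsupport w ⊆ b := hwK.trans hKb
  have hS := hφ.isLocalSobolev x₀ hsub
  obtain ⟨L, uk, hL, hLb, hwL', huk, hukL, ht, ht'⟩ :=
    hS.exists_smooth_approx_mul Metric.isOpen_ball hwL hwc hwb
  have hLt : L ⊆ e.target := hLb.trans hsub
  have hukc : ∀ k, HasCompactSupport (uk k) := fun k =>
    hL.of_isClosed_subset (isClosed_tsupport _) (hukL k)
  have m0 : ∀ k, MemLp (fun y => uk k y - φ (e.symm y) * w y) 2 volume := fun k =>
    ((huk k).continuous.memLp_of_hasCompactSupport (hukc k)).sub (hS.memLp_mul hwL hwc hwb)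
  have m1 : ∀ k v, MemLp (fun y => fderiv ℝ (uk k) y v - (G (e.symm y) (chartSymmDeriv n x₀ y v) *
      w y + φ (e.symm y) * lineDeriv ℝ w y v)) 2 volume := fun k v =>
    ((((huk k).continuous_fderiv (by simp)).clm_apply
      continuous_const).memLp_of_hasCompactSupport ((hukc k).fderiv_apply ℝ v)).sub
      (hS.memLp_mul_deriv hwL hwc hwb v)
  have t0 := tendsto_integral_sq m0 ht
  have t1 := fun v => tendsto_integral_sq (fun k => m1 k v) (ht' v)
  set F : ℕ → Eucl n → ℝ := fun k y => (uk k y - φ (e.symm y) * w y) ^ 2 + C₂ * ∑ i : Fin n,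
    (fderiv ℝ (uk k) y (EuclideanSpace.single i 1) -
      (G (e.symm y) (chartSymmDeriv n x₀ y (EuclideanSpace.single i 1)) * w y +
        φ (e.symm y) * lineDeriv ℝ w y (EuclideanSpace.single i 1))) ^ 2 with hF
  have hFs : ∀ k, Integrable (fun y => ∑ i : Fin n,
    (fderiv ℝ (uk k) y (EuclideanSpace.single i 1) -
      (G (e.symm y) (chartSymmDeriv n x₀ y (EuclideanSpace.single i 1)) * w y +
        φ (e.symm y) * lineDeriv ℝ w y (EuclideanSpace.single i 1))) ^ 2) := fun k =>
    integrable_finsetSum _ fun i _ => (m1 k _).integrable_sq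
  have hFi : ∀ k, Integrable (F k) := fun k => (m0 k).integrable_sq.add ((hFs k).const_mul C₂)
  have hF0 : ∀ k y, 0 ≤ F k y := fun k y => by positivity
  have hFt : Tendsto (fun k => ∫ y, F k y) atTop (𝓝 0) := by
    have h1 := t0.add ((tendsto_finsetSum Finset.univ
      fun i _ => t1 (EuclideanSpace.single i 1)).const_mul C₂)
    simp only [Finset.sum_const_zero, mul_zero, add_zero] at h1
    refine h1.congr fun k => ?_
    rw [hF, integral_add (m0 k).integrable_sq ((hFs k).const_mul C₂), integral_const_mul,
      integral_finsetSum _ fun i _ => (m1 k _).integrable_sq]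
  have hFm := fun k => integrable_indicator_chart hae hle (hFi k) (hF0 k)
  have htL : ∀ k, tsupport (chartExtend n x₀ (uk k)) ⊆ e.symm '' L := fun k =>
    tsupport_chartExtend_subset x₀ hL hLt (hukL k)
  have hLM : IsCompact (e.symm '' L) := hL.image_of_continuousOn (e.continuousOn_symm.mono hLt)
  have hvt : ∀ x, v x ≠ 0 → x ∈ e.symm '' L := by
    intro x hx
    have hxB := hvB (subset_tsupport v hx)
    refine ⟨e x, hwL' (subset_tsupport _ ?_), e.left_inv hxB.1⟩
    have hxb : e x ∈ b := hxB.2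
    have h1 : w (e x) = v x := (indicator_of_mem hxb _).trans (by rw [e.left_inv hxB.1])
    exact ne_of_eq_of_ne h1 hx
  have hvL' : tsupport v ⊆ e.symm '' L := closure_minimal hvt hLM.isClosed
  have hz : ∀ x ∉ e.symm '' L, φ x * v x = 0 := fun x hx => by
    rw [not_not.1 (mt (hvt x) hx), mul_zero]
  have hz' : ∀ x ∉ e.symm '' L, mulDiff n φ G v x = 0 := fun x hx => by
    rw [mulDiff, not_not.1 (mt (hvt x) hx), diff_eq_zero_of_notMem_tsupport (mt (@hvL' x) hx)]
    simp
  have hLB : e.symm '' L ⊆ chartBall n x₀ δ := by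
    rintro _ ⟨y, hy, rfl⟩
    refine ⟨e.map_target (hLt hy), ?_⟩
    rw [mem_preimage, e.right_inv (hLt hy)]
    exact hLb hy
  refine ⟨e.symm '' L, fun k => chartExtend n x₀ (uk k),
    fun k => (chartBall n x₀ δ).indicator fun x => F k (e x), hLM, hLB,
    fun k => contMDiff_chartExtend x₀ hL hLt (hukL k) (huk k), htL, hz, hz',
    fun k => (hFm k).1, ?_, fun k => ?_⟩
  · refine squeeze_zero (fun k => integral_nonneg fun x => indicator_nonneg (fun x _ => hF0 k _) x)
      (fun k => (hFm k).2) ?_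
    simpa using hFt.const_mul (C : ℝ)
  · filter_upwards [hv.ae_mdifferentiableAt hν] with x hx
    by_cases hxB : x ∈ chartBall n x₀ δ
    · rw [indicator_of_mem hxB]
      have hb' := hAb x hxB
      obtain ⟨y, hy, hyb, rfl⟩ : ∃ y, e x = y ∧ y ∈ b ∧ e.symm y = x :=
        ⟨_, rfl, hxB.2, e.left_inv hxB.1⟩
      rw [hy]
      have hyt := hsub hyb
      have hwy : w y = v (e.symm y) := indicator_of_mem hyb _
      have hwd : HasFDerivAt w ((diff n v (e.symm y)).comp (chartSymmDeriv n x₀ y)) y := by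
        refine (HasMFDerivAt.hasFDerivAt_comp_chart_symm hyt
          hx.hasMFDerivAt).congr_of_eventuallyEq ?_
        filter_upwards [Metric.isOpen_ball.mem_nhds hyb] with z hz
        exact indicator_of_mem hz _
      -- The error of the differential in coordinates; its values on the basis vectors are exactly
      -- the differences whose squares are summed in `F`.
      set η : Eucl n →L[ℝ] ℝ := fderiv ℝ (uk k) y -
        (mulDiff n φ G v (e.symm y)).comp (chartSymmDeriv n x₀ y) with hη
      have hdd : diff n (chartExtend n x₀ (uk k)) (e.symm y) - mulDiff n φ G v (e.symm y) =
          η.comp (chartDeriv n x₀ (e.symm y)) := by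
        rw [hη, ContinuousLinearMap.sub_comp, cotangent_eq_comp_chartDeriv hyt,
          diff_chartExtend hyt ((huk k).differentiable (by simp) y)]
      have hηv : ∀ v', η v' = fderiv ℝ (uk k) y v' -
          (G (e.symm y) (chartSymmDeriv n x₀ y v') * w y + φ (e.symm y) * lineDeriv ℝ w y v') := by
        intro v'
        have h1 : lineDeriv ℝ w y v' = diff n v (e.symm y) (chartSymmDeriv n x₀ y v') :=
          hwd.hasLineDerivAt v' |>.lineDeriv
        rw [h1, hwy, hη]
        simp only [mulDiff]
        change fderiv ℝ (uk k) y v' - (φ (e.symm y) * diff n v (e.symm y) (chartSymmDeriv n x₀ y v')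
          + v (e.symm y) * G (e.symm y) (chartSymmDeriv n x₀ y v')) = _
        ring
      rw [hdd, chartExtend_symm hyt, ← hwy]
      refine add_le_add le_rfl ((hb' η).trans ?_)
      gcongr
      refine (norm_sq_le_sum_sq η).trans_eq (Finset.sum_congr rfl fun i _ => ?_)
      rw [hηv]
    · have hx' : x ∉ e.symm '' L := fun h => hxB (hLB h)
      have hx'' : x ∉ tsupport (chartExtend n x₀ (uk k)) := fun h => hx' (htL k h)
      rw [indicator_of_notMem hxB, hz x hx', hz' x hx', image_eq_zero_of_notMem_tsupport hx'',
        diff_eq_zero_of_notMem_tsupport hx'']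
      simp

/-- The set `B` must not depend on `χ`: these sets form the cover to which a partition of unity is
subordinated afterwards. -/
theorem exists_isApprox_chart (hν : HasLocallyBoundedDensity n ν) (hA : IsEllipticField n A)
    (hφ : IsSobolevWithDiff n φ G) (hv : ChartLipschitz n v) (hvc : HasCompactSupport v) (x₀ : M)
    {O : Set M} (hO : O ∈ 𝓝 x₀) :
    ∃ B : Set M, IsOpen B ∧ x₀ ∈ B ∧ ∀ χ : M → ℝ, ContMDiff (𝓡 n) 𝓘(ℝ, ℝ) ∞ χ →
      tsupport χ ⊆ B → ∃ (L : Set M) (uk h : ℕ → M → ℝ),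
        IsCompact L ∧ L ⊆ O ∧ IsApprox ν A L (fun x => φ x * (χ x * v x))
          (mulDiff n φ G fun x => χ x * v x) uk h := by
  obtain ⟨C₂, hC₂, hb⟩ := hA.bounds x₀
  obtain ⟨δ₁, hδ₁, hsub, C₁, hC₁⟩ := hv x₀
  set e := chartAt (Eucl n) x₀ with he
  obtain ⟨δ, hδ, C, hsub', hB, hae, hle⟩ := exists_chartBall_map_le hν x₀
    (inter_mem (inter_mem hb hO)
      ((isOpen_chartBall (n := n) x₀ (δ₁ / 2)).mem_nhds (mem_chartBall_self x₀ (half_pos hδ₁))))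
  refine ⟨chartBall n x₀ δ, isOpen_chartBall x₀ δ, mem_chartBall_self x₀ hδ, fun χ hχ hχB => ?_⟩
  have hbb : Metric.ball (e x₀) δ ⊆ Metric.ball (e x₀) (δ₁ / 2) := by
    intro y hy
    have h1 : e.symm y ∈ chartBall n x₀ δ := by
      refine ⟨e.map_target (hsub' hy), ?_⟩
      rw [mem_preimage, e.right_inv (hsub' hy)]
      exact hy
    have h2 := (hB h1).2.2
    rwa [mem_preimage, e.right_inv (hsub' hy)] at h2
  have hcl : Metric.closedBall (e x₀) (δ₁ / 2) ⊆ Metric.ball (e x₀) δ₁ :=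
    Metric.closedBall_subset_ball (half_lt_self hδ₁)
  obtain ⟨D, hD⟩ := ((contDiffOn_comp_chart_symm hχ x₀).mono
    (hcl.trans hsub)).exists_lipschitzOnWith (by simp) (convex_closedBall _ _)
      (isCompact_closedBall _ _)
  obtain ⟨D', hD'⟩ := exists_lipschitzOnWith_mul_ball hδ
    (hD.mono (hbb.trans Metric.ball_subset_closedBall))
    (hC₁.mono (hbb.trans (Metric.ball_subset_ball (half_le_self hδ₁.le))))
  obtain ⟨L, uk, h, h1, h2, h3⟩ := exists_isApprox_chartBall hν hφ hC₂.le hsub' hae hle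
    (fun x hx η => ((hB hx).1.1 η).2) ((chartLipschitz_of_contMDiff hχ).mul hv) hD' hvc.mul_left
    ((tsupport_mul_subset_left).trans hχB)
  exact ⟨L, uk, h, h1, h2.trans fun x hx => (hB hx).1.2, h3⟩

theorem hasMFDerivAt_finsetSum {ι : Type*} {s : Finset ι} {f : ι → M → ℝ} {x : M}
    {f' : ι → Cotangent n x} (hf : ∀ i ∈ s, HasMFDerivAt (𝓡 n) 𝓘(ℝ, ℝ) (f i) x (f' i))
    {D : Cotangent n x} (hD : D = ∑ i ∈ s, f' i) :
    HasMFDerivAt (𝓡 n) 𝓘(ℝ, ℝ) (∑ i ∈ s, f i) x D := by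
  classical
  induction s using Finset.induction_on generalizing D with
  | empty =>
    rw [hD]
    exact hasMFDerivAt_const (0 : ℝ) x
  | insert i s his ih =>
    rw [Finset.sum_insert his] at hD ⊢
    rw [hD]
    exact (hf i (Finset.mem_insert_self i s)).add
      (ih (fun j hj => hf j (Finset.mem_insert_of_mem hj)) rfl)

/-- The sum of the local differentials equals the differential of the sum only where all pieces are
differentiable, that is, almost everywhere. -/
theorem IsApprox.congr {L : Set M} {u : M → ℝ} {U U' : ∀ x : M, Cotangent n x} {uk h : ℕ → M → ℝ}
    (H : IsApprox ν A L u U uk h) (hU : ∀ᵐ x ∂ν, U x = U' x) (h0 : ∀ x ∉ L, U' x = 0) :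
    IsApprox ν A L u U' uk h where
  smooth := H.smooth
  tsupport_subset := H.tsupport_subset
  eq_zero := H.eq_zero
  diff_eq_zero := h0
  energy :=
    { integrable := H.energy.integrable
      tendsto := H.energy.tendsto
      bound := fun k => by
        filter_upwards [H.energy.bound k, hU] with x hx hx'
        rwa [← hx'] }

theorem IsApprox.add (hA : IsEllipticField n A) {L L' : Set M} {u u' : M → ℝ}
    {U U' : ∀ x : M, Cotangent n x}
    {uk h uk' h' : ℕ → M → ℝ} (H : IsApprox ν A L u U uk h) (H' : IsApprox ν A L' u' U' uk' h') :
    IsApprox ν A (L ∪ L') (fun x => u x + u' x) (fun x => U x + U' x)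
      (fun k x => uk k x + uk' k x) (fun k x => 2 * (h k x + h' k x)) where
  smooth k := (H.smooth k).add (H'.smooth k)
  tsupport_subset k := by
    refine (tsupport_add (uk k) (uk' k)).trans ?_
    exact union_subset_union (H.tsupport_subset k) (H'.tsupport_subset k)
  eq_zero x hx := by
    rw [H.eq_zero x fun h => hx (Or.inl h), H'.eq_zero x fun h => hx (Or.inr h), add_zero]
  diff_eq_zero x hx := by
    rw [H.diff_eq_zero x fun h => hx (Or.inl h), H'.diff_eq_zero x fun h => hx (Or.inr h), add_zero]
  energy :=
    { integrable := fun k => ((H.energy.integrable k).add (H'.energy.integrable k)).const_mul 2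
      tendsto := by
        have : ∀ k, ∫ x, 2 * (h k x + h' k x) ∂ν = 2 * (∫ x, h k x ∂ν + ∫ x, h' k x ∂ν) :=
          fun k => by
            rw [integral_const_mul, integral_add (H.energy.integrable k) (H'.energy.integrable k)]
        simp only [this]
        simpa using (H.energy.tendsto.add H'.energy.tendsto).const_mul 2
      bound := fun k => by
        filter_upwards [H.energy.bound k, H'.energy.bound k] with x h1 h2
        have hd : diff n (fun x => uk k x + uk' k x) x = diff n (uk k) x + diff n (uk' k) x :=
          (((H.smooth k).mdifferentiable (by simp) x).hasMFDerivAt.add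
            ((H'.smooth k).mdifferentiable (by simp) x).hasMFDerivAt).mfderiv
        rw [hd]
        set ξ := diff n (uk k) x - U x with hξ
        set ζ := diff n (uk' k) x - U' x with hζ
        have e1 : diff n (uk k) x + diff n (uk' k) x - (U x + U' x) = ξ - (-1 : ℝ) • ζ := by
          rw [hξ, hζ]
          module
        have e2 := hA.nonneg x (ξ - (1 : ℝ) • ζ)
        rw [energy_sub_sq hA] at e2
        rw [e1, energy_sub_sq hA]
        nlinarith [sq_nonneg ((uk k x - u x) - (uk' k x - u' x))] }

/-- The product of a `W^{1,2}_loc` function and a compactly supported Lipschitz function is a limit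
in energy of test functions. -/
theorem exists_isApprox (hν : HasLocallyBoundedDensity n ν) (hA : IsEllipticField n A)
    (hφ : IsSobolevWithDiff n φ G) {O : Set M} (hO : IsOpen O) (hv : ChartLipschitz n v)
    (hvc : HasCompactSupport v) (hvO : tsupport v ⊆ O) :
    ∃ (L : Set M) (uk h : ℕ → M → ℝ), IsCompact L ∧ L ⊆ O ∧ tsupport v ⊆ L ∧
      IsApprox ν A L (fun x => φ x * v x) (mulDiff n φ G v) uk h := by
  classical
  have : LocallyCompactSpace M := ChartedSpace.locallyCompactSpace (Eucl n) M
  have hB : ∀ x : tsupport v, _ := fun x =>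
    exists_isApprox_chart hν hA hφ hv hvc x.1 (hO.mem_nhds (hvO x.2))
  choose B hBo hxB hBv using hB
  obtain ⟨f, hf⟩ := SmoothPartitionOfUnity.exists_isSubordinate (𝓡 n) (isClosed_tsupport v) B hBo
    fun x hx => mem_iUnion.2 ⟨⟨x, hx⟩, hxB _⟩
  have hfin : {i | (Function.support (f i) ∩ tsupport v).Nonempty}.Finite :=
    f.locallyFinite.finite_nonempty_inter_compact hvc.isCompact
  have hLi : ∀ i, ChartLipschitz n fun x => f i x * v x := fun i =>
    (chartLipschitz_of_contMDiff (f i).contMDiff).mul hv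
  have hsum : ∀ s : Finset (tsupport v), ∃ (L : Set M) (uk h : ℕ → M → ℝ), IsCompact L ∧ L ⊆ O ∧
      IsApprox ν A L (fun x => φ x * ∑ i ∈ s, f i x * v x)
        (fun x => ∑ i ∈ s, mulDiff n φ G (fun x => f i x * v x) x) uk h := by
    intro s
    induction s using Finset.induction_on with
    | empty =>
      refine ⟨∅, fun _ _ => 0, fun _ _ => 0, isCompact_empty, empty_subset _, ?_⟩
      refine ⟨fun k => contMDiff_const, fun k => by simp [tsupport], by simp, by simp, ?_⟩
      have h0 : diff n (fun _ : M => (0 : ℝ)) = fun _ => 0 := by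
        ext1 x
        exact mfderiv_const
      simpa [h0] using EnergyTendsto.const (A := A) ν (fun _ => 0) fun _ => 0
    | insert i s his ih =>
      obtain ⟨L, uk, h, hL, hLO, H⟩ := ih
      obtain ⟨L', uk', h', hL', hLO', H'⟩ := hBv i _ (f i).contMDiff (hf i)
      have H'' := H'.add hA H
      have e1 : (fun x => φ x * ∑ j ∈ insert i s, f j x * v x) =
          fun x => φ x * (f i x * v x) + φ x * ∑ j ∈ s, f j x * v x := by
        ext x
        rw [Finset.sum_insert his, mul_add]
      have e2 : (fun x => ∑ j ∈ insert i s, mulDiff n φ G (fun x => f j x * v x) x) =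
          fun x => mulDiff n φ G (fun x => f i x * v x) x +
            ∑ j ∈ s, mulDiff n φ G (fun x => f j x * v x) x := by
        ext1 x
        rw [Finset.sum_insert his]
      rw [e1, e2]
      exact ⟨_, _, _, hL'.union hL, union_subset hLO' hLO, H''⟩
  obtain ⟨L, uk, h, hL, hLO, H⟩ := hsum hfin.toFinset
  have hv_eq : ∀ x, ∑ i ∈ hfin.toFinset, f i x * v x = v x := by
    intro x
    by_cases hx : x ∈ tsupport v
    · rw [← Finset.sum_mul, f.sum_finsupport' x hx, one_mul]
      intro i hi
      rw [Finite.mem_toFinset]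
      exact ⟨x, (f.mem_finsupport x).1 hi, hx⟩
    · simp [image_eq_zero_of_notMem_tsupport hx]
  simp only [hv_eq] at H
  -- The set is enlarged so that `v` and its differential vanish everywhere outside it, not only
  -- almost everywhere.
  have hLv : IsCompact (L ∪ tsupport v) := hL.union hvc.isCompact
  refine ⟨L ∪ tsupport v, uk, h, hLv, union_subset hLO hvO, subset_union_right, ?_⟩
  have H' : IsApprox ν A (L ∪ tsupport v) (fun x => φ x * v x)
      (fun x => ∑ i ∈ hfin.toFinset, mulDiff n φ G (fun x => f i x * v x) x) uk h :=
    ⟨H.smooth, fun k => (H.tsupport_subset k).trans subset_union_left,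
      fun x hx => H.eq_zero x fun h => hx (Or.inl h),
      fun x hx => H.diff_eq_zero x fun h => hx (Or.inl h), H.energy⟩
  refine H'.congr ?_ fun x hx => ?_
  · have hd := fun i => (hLi i).ae_mdifferentiableAt hν
    filter_upwards [(Finset.eventually_all hfin.toFinset).2 fun i _ => hd i] with x hx
    have h1 : diff n v x = ∑ i ∈ hfin.toFinset, diff n (fun x => f i x * v x) x := by
      have h4 : ∀ i ∈ hfin.toFinset, HasMFDerivAt (𝓡 n) 𝓘(ℝ, ℝ) (fun x => f i x * v x) x
          (diff n (fun x => f i x * v x) x) := fun i hi => (hx i hi).hasMFDerivAt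
      have h2 := (hasMFDerivAt_finsetSum h4 rfl).mfderiv
      have h3 : ∑ i ∈ hfin.toFinset, (fun x => f i x * v x) = v := by
        ext z
        rw [Finset.sum_apply, hv_eq]
      rw [h3] at h2
      exact h2
    simp only [mulDiff]
    rw [Finset.sum_add_distrib, ← Finset.smul_sum, ← Finset.sum_smul, hv_eq, ← h1]
  · have hx' : x ∉ tsupport v := fun h => hx (Or.inr h)
    simp [mulDiff, diff_eq_zero_of_notMem_tsupport hx', image_eq_zero_of_notMem_tsupport hx']

end Membership

/-! ### The ground state transform. -/

section WeightedHardy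

variable {n : ℕ} {M : Type*} [TopologicalSpace M] [ChartedSpace (Eucl n) M]
  [IsManifold (𝓡 n) ∞ M] [T2Space M] [SecondCountableTopology M]

theorem exists_smooth_cutoff {L : Set M} (hL : IsCompact L) :
    ∃ θ : M → ℝ, ContMDiff (𝓡 n) 𝓘(ℝ, ℝ) ∞ θ ∧ HasCompactSupport θ ∧ ∀ x ∈ L, θ =ᶠ[𝓝 x] fun _ => 1 := by
  have : LocallyCompactSpace M := ChartedSpace.locallyCompactSpace (Eucl n) M
  obtain ⟨t, ht, hLt⟩ := exists_compact_superset hL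
  obtain ⟨f, h1, h0, -⟩ := exists_contMDiffMap_one_nhds_of_subset_interior (𝓡 n) (n := ⊤)
    hL.isClosed hLt
  exact ⟨f, f.contMDiff, HasCompactSupport.intro ht h0,
    fun x hx => Filter.Eventually.filter_mono (nhds_le_nhdsSet hx) h1⟩

variable [MeasurableSpace M] [BorelSpace M] {A : CoeffField n M} {ν : Measure M}
  {φ v c W : M → ℝ} {G : ∀ x : M, Cotangent n x}

/-- For a cutoff `θ` equal to `1` on `L`, the product `φ θ` is a limit in energy of test functions,
so `W (φ θ)²` is integrable. -/
theorem integrableOn_sq_mul (hν : HasLocallyBoundedDensity n ν) (hA : IsEllipticField n A)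
    (hφ : IsSobolevWithDiff n φ G) (hW : Measurable W) (hWb : LocallyBounded W) {L : Set M}
    (hL : IsCompact L) : IntegrableOn (fun x => φ x ^ 2 * W x) L ν := by
  obtain ⟨θ, h1, h2, h3⟩ := exists_smooth_cutoff (n := n) hL
  obtain ⟨L', uk, h, hL', -, -, H⟩ := exists_isApprox hν hA hφ isOpen_univ
    (chartLipschitz_of_contMDiff h1) h2 (subset_univ _)
  refine ((H.pairing hν hA hL' hL' H 0 hW hWb).1.integrableOn (s := L)).congr_fun ?_
    hL.measurableSet
  intro x hx
  simp only [pairing, (h3 x hx).self_of_nhds]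
  ring

/-- The Hardy inequality outside a compact set, in terms of the ground state `φ`. -/
theorem integral_le_of_hardy (hν : HasLocallyBoundedDensity n ν) (hA : IsEllipticField n A)
    (hc : Measurable c) (hcb : LocallyBounded c) (hW : Measurable W) (hWb : LocallyBounded W)
    (hφ : IsSobolevWithDiff n φ G)
    (hweak : ∀ ψ : M → ℝ, IsTestFunction n univ ψ →
      ∫ x, (diff n ψ x (A x (G x)) + c x * φ x * ψ x) ∂ν = 0)
    {K : Set M} (hK : IsCompact K) {α : ℝ}
    (hardy : ∀ u : M → ℝ, IsTestFunction n Kᶜ u →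
      α * ∫ x in Kᶜ, W x * u x ^ 2 ∂ν ≤ quadForm n ν A c u)
    (hv : ChartLipschitz n v) (hvc : HasCompactSupport v) (hvK : tsupport v ⊆ Kᶜ) :
    α * ∫ x, φ x ^ 2 * W x * v x ^ 2 ∂ν ≤ ∫ x, φ x ^ 2 * diff n v x (A x (diff n v x)) ∂ν := by
  obtain ⟨L, uk, h, hL, hLK, -, H⟩ := exists_isApprox hν hA hφ hK.isClosed.isOpen_compl hv hvc hvK
  obtain ⟨-, i2, hle⟩ := H.hardy hν hA hL hc hcb hW hWb hLK hardy
  obtain ⟨L₁, uk₁, h₁, hL₁, -, -, H₁⟩ := exists_isApprox hν hA hφ isOpen_univ (hv.mul hv)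
    hvc.mul_right (subset_univ _)
  -- The weak equation is to be tested against `φ v²`. Since `φ` need not have compact support, it
  -- is replaced by `φ θ`, which agrees with it on `L₁`, differential included.
  obtain ⟨θ, hθ, hθc, hθ1⟩ := exists_smooth_cutoff (n := n) hL₁
  obtain ⟨L₂, uk₂, h₂, hL₂, -, -, H₂⟩ := exists_isApprox hν hA hφ isOpen_univ
    (chartLipschitz_of_contMDiff hθ) hθc (subset_univ _)
  obtain ⟨i3, h3⟩ := H₁.weak_eq hν hA hL₁ hL₂ H₂ hc hcb (f := φ) (G := G)
    (fun x hx => by rw [(hθ1 x hx).self_of_nhds, mul_one])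
    (fun x hx => by
      have h0 : diff n θ x = 0 := by
        unfold diff
        rw [(hθ1 x hx).mfderiv_eq]
        exact mfderiv_const
      rw [mulDiff, h0, (hθ1 x hx).self_of_nhds, smul_zero, zero_add, one_smul]) hweak
  -- The ground state identity: with `d(φv) = φ dv + v G` and `d(φv²) = 2φv dv + v² G`, the terms in
  -- `c`, in `⟨G, AG⟩` and in `⟨dv, AG⟩` cancel.
  have key : ∀ᵐ x ∂ν, (mulDiff n φ G v x (A x (mulDiff n φ G v x)) + c x * (φ x * v x) ^ 2) -
      (mulDiff n φ G (fun x => v x * v x) x (A x (G x)) + c x * φ x * (φ x * (v x * v x))) =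
      φ x ^ 2 * diff n v x (A x (diff n v x)) := by
    filter_upwards [hv.ae_mdifferentiableAt hν] with x hx
    have hd : diff n (fun x => v x * v x) x = (2 * v x) • diff n v x := by
      have h1 := (hx.hasMFDerivAt.mul hx.hasMFDerivAt).mfderiv
      have h2 : diff n (fun x => v x * v x) x = v x • diff n v x + v x • diff n v x := h1
      rw [h2]
      module
    have hs := hA.symm x (G x) (diff n v x)
    rw [mulDiff, mulDiff, hd]
    generalize diff n v x = V at *
    generalize G x = g at *
    simp only [map_add, map_smul, _root_.add_apply, _root_.smul_apply, smul_eq_mul, hs]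
    ring
  have h4 : ∫ x, φ x ^ 2 * diff n v x (A x (diff n v x)) ∂ν =
      ∫ x, (mulDiff n φ G v x (A x (mulDiff n φ G v x)) + c x * (φ x * v x) ^ 2) ∂ν := by
    rw [← integral_congr_ae key, integral_sub i2 i3, h3, sub_zero]
  rw [h4]
  convert hle using 3
  ext x
  ring

end WeightedHardy

/-! ### Reduction to the distribution of the Agmon distance. -/

section Radial

variable {n : ℕ} {M : Type*} [TopologicalSpace M] [ChartedSpace (Eucl n) M]
  [IsManifold (𝓡 n) ∞ M] [T2Space M] [SecondCountableTopology M] [ConnectedSpace M]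
  [MeasurableSpace M] [BorelSpace M] {A : CoeffField n M} {ν : Measure M}
  {φ c W : M → ℝ} {G : ∀ x : M, Cotangent n x}

/-- The real-valued Agmon distance to a point. -/
def agmonDist (A : CoeffField n M) (W : M → ℝ) (o x : M) : ℝ :=
  (agmonEDist A W o x).toReal

theorem agmonDist_nonneg (o x : M) : 0 ≤ agmonDist A W o x := ENNReal.toReal_nonneg

theorem continuous_agmonDist (hA : IsEllipticField n A) (hWb : LocallyBounded W) (o : M) :
    Continuous (agmonDist A W o) :=
  ENNReal.continuousOn_toReal.comp_continuous (continuous_agmonEDist hA hWb o)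
    fun x => agmonEDist_ne_top hA hWb o x

theorem chartLipschitz_agmonDist (hA : IsEllipticField n A) (hWb : LocallyBounded W) (o : M) :
    ChartLipschitz n (agmonDist A W o) := by
  intro x₀
  obtain ⟨δ, hδ, C, hsub, -, h⟩ := exists_agmonEDist_chart_le hA hWb x₀
  refine ⟨δ, hδ, hsub, C, LipschitzOnWith.of_dist_le_mul fun y hy z hz => ?_⟩
  have key : ∀ y ∈ Metric.ball (chartAt (Eucl n) x₀ x₀) δ,
      ∀ z ∈ Metric.ball (chartAt (Eucl n) x₀ x₀) δ,
      agmonDist A W o ((chartAt (Eucl n) x₀).symm y) ≤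
        agmonDist A W o ((chartAt (Eucl n) x₀).symm z) + C * dist y z := by
    intro y hy z hz
    have h1 := (agmonEDist_triangle (A := A) (W := W) o ((chartAt (Eucl n) x₀).symm z)
      ((chartAt (Eucl n) x₀).symm y)).trans (add_le_add le_rfl (h z hz y hy))
    have h2 := ENNReal.toReal_mono
      (ENNReal.add_ne_top.2 ⟨agmonEDist_ne_top hA hWb _ _, ENNReal.ofReal_ne_top⟩) h1
    rwa [ENNReal.toReal_add (agmonEDist_ne_top hA hWb _ _) ENNReal.ofReal_ne_top,
      ENNReal.toReal_ofReal (by positivity), ← dist_eq_norm] at h2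
  rw [Real.dist_eq, abs_le]
  have h1 := key y hy z hz
  have h2 := key z hz y hy
  rw [dist_comm] at h2
  constructor <;> linarith

theorem isCompact_agmonDist_le (hA : IsEllipticField n A) (hWb : LocallyBounded W)
    (hcomplete : AgmonComplete A W) (o : M) (r : ℝ) : IsCompact {x | agmonDist A W o x ≤ r} := by
  rcases lt_or_ge r 0 with hr | hr
  · convert isCompact_empty
    exact eq_empty_of_forall_notMem fun x hx => (hx.trans_lt hr).not_ge (agmonDist_nonneg o x)
  · convert isCompact_agmonEDist_le hA hWb hcomplete o hr using 3 with x
    exact (ENNReal.le_ofReal_iff_toReal_le (agmonEDist_ne_top hA hWb o x) hr).symm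

theorem agmonBall_eq (hA : IsEllipticField n A) (hWb : LocallyBounded W) (o : M) (r : ℝ) :
    agmonBall A W o r = agmonDist A W o ⁻¹' Iio r := by
  ext x
  exact ENNReal.lt_ofReal_iff_toReal_lt (agmonEDist_ne_top hA hWb o x)

theorem aemeasurable_sq_mul (hν : HasLocallyBoundedDensity n ν) (hA : IsEllipticField n A)
    (hφ : IsSobolevWithDiff n φ G) (hW : Measurable W) (hWb : LocallyBounded W) :
    AEMeasurable (fun x => φ x ^ 2 * W x) ν := by
  have : LocallyCompactSpace M := ChartedSpace.locallyCompactSpace (Eucl n) M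
  rw [← Measure.restrict_univ (μ := ν), ← iUnion_compactCovering M, aemeasurable_iUnion_iff]
  exact fun k => (integrableOn_sq_mul hν hA hφ hW hWb (isCompact_compactCovering M k)).1.aemeasurable

theorem groundMeasure_lt_top (hν : HasLocallyBoundedDensity n ν) (hA : IsEllipticField n A)
    (hφ : IsSobolevWithDiff n φ G) (hW : Measurable W) (hWb : LocallyBounded W) {L : Set M}
    (hL : IsCompact L) : groundMeasure ν W φ L < ⊤ := by
  rw [groundMeasure, withDensity_apply _ hL.measurableSet]
  exact (integrableOn_sq_mul hν hA hφ hW hWb hL).lintegral_lt_top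

theorem integral_groundMeasure (hν : HasLocallyBoundedDensity n ν) (hA : IsEllipticField n A)
    (hφ : IsSobolevWithDiff n φ G) (hW : Measurable W) (hWpos : ∀ x, 0 < W x)
    (hWb : LocallyBounded W) (f : M → ℝ) :
    ∫ x, f x ∂(groundMeasure ν W φ) = ∫ x, φ x ^ 2 * W x * f x ∂ν := by
  rw [groundMeasure, integral_withDensity_eq_integral_toReal_smul₀
    (aemeasurable_sq_mul hν hA hφ hW hWb).ennreal_ofReal
    (Eventually.of_forall fun _ => ENNReal.ofReal_lt_top)]
  refine integral_congr_ae (Eventually.of_forall fun x => ?_)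
  have := (hWpos x).le
  simp only [smul_eq_mul]
  rw [ENNReal.toReal_ofReal (by positivity)]

/-- The Hardy inequality outside a compact set reduces to a one-dimensional inequality for the
distribution of the Agmon distance. -/
theorem integral_map_agmonDist_le (hν : HasLocallyBoundedDensity n ν) (hA : IsEllipticField n A)
    (hc : Measurable c) (hcb : LocallyBounded c) (hW : Measurable W) (hWpos : ∀ x, 0 < W x)
    (hWb : LocallyBounded W) (hφ : IsSobolevWithDiff n φ G)
    (hweak : ∀ ψ : M → ℝ, IsTestFunction n univ ψ →
      ∫ x, (diff n ψ x (A x (G x)) + c x * φ x * ψ x) ∂ν = 0)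
    (hcomplete : AgmonComplete A W) (o : M)
    {K : Set M} (hK : IsCompact K) {α : ℝ}
    (hardy : ∀ u : M → ℝ, IsTestFunction n Kᶜ u →
      α * ∫ x in Kᶜ, W x * u x ^ 2 ∂ν ≤ quadForm n ν A c u)
    {R₀ : ℝ} (hR₀ : ∀ x ∈ K, agmonDist A W o x ≤ R₀) {f : ℝ → ℝ} (hf : ContDiff ℝ 1 f)
    (hfc : HasCompactSupport f) (hfR : tsupport f ⊆ Ioi R₀) :
    α * ∫ t, f t ^ 2 ∂((groundMeasure ν W φ).map (agmonDist A W o)) ≤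
      ∫ t, deriv f t ^ 2 ∂((groundMeasure ν W φ).map (agmonDist A W o)) := by
  set ρ := agmonDist A W o with hρ
  have hρc : Continuous ρ := continuous_agmonDist hA hWb o
  obtain ⟨D, hD⟩ := hf.lipschitzWith_of_hasCompactSupport hfc one_ne_zero
  have hf'c : Continuous (deriv f) := hf.continuous_deriv le_rfl
  have hsupp : tsupport (fun x => f (ρ x)) ⊆ ρ ⁻¹' tsupport f :=
    closure_minimal (fun x hx => subset_tsupport _ hx) ((isClosed_tsupport f).preimage hρc)
  obtain ⟨r, hr⟩ := hfc.isCompact.bddAbove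
  -- Completeness is what makes a compactly supported function of `ρ` compactly supported on `M`.
  have hcpt : IsCompact (ρ ⁻¹' tsupport f) :=
    (isCompact_agmonDist_le hA hWb hcomplete o r).of_isClosed_subset
      ((isClosed_tsupport f).preimage hρc) fun x hx => hr hx
  have h1 := integral_le_of_hardy hν hA hc hcb hW hWb hφ hweak hK hardy
    (v := fun x => f (ρ x)) ((chartLipschitz_agmonDist hA hWb o).comp hD)
    (hcpt.of_isClosed_subset (isClosed_tsupport _) hsupp)
    fun x hx hxK => (hR₀ x hxK).not_gt (hfR (hsupp hx))
  rw [integral_map (f := fun t => f t ^ 2) hρc.aemeasurable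
      (hf.continuous.pow 2).aestronglyMeasurable,
    integral_map (f := fun t => deriv f t ^ 2) hρc.aemeasurable
      (hf'c.pow 2).aestronglyMeasurable,
    integral_groundMeasure hν hA hφ hW hWpos hWb, integral_groundMeasure hν hA hφ hW hWpos hWb]
  refine h1.trans (integral_mono_of_nonneg (Eventually.of_forall fun x =>
    mul_nonneg (sq_nonneg _) (hA.nonneg x _)) ?_ ?_)
  · obtain ⟨B, hB⟩ := hfc.deriv.exists_bound_of_continuous hf'c
    have h0 : ∀ x ∉ ρ ⁻¹' tsupport f, φ x ^ 2 * W x * deriv f (ρ x) ^ 2 = 0 := fun x hx => by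
      rw [image_eq_zero_of_notMem_tsupport fun h => hx (tsupport_deriv_subset h)]
      ring
    refine (integrableOn_iff_integrable_of_support_subset (s := ρ ⁻¹' tsupport f)
      fun x hx => not_not.1 (mt (h0 x) hx)).1 ?_
    refine (integrableOn_sq_mul hν hA hφ hW hWb hcpt).mul_bdd (c := B ^ 2)
      ((hf'c.pow 2).comp hρc).aestronglyMeasurable (Eventually.of_forall fun x => ?_)
    simp only [norm_pow]
    gcongr
    exact hB _
  -- Chain rule and eikonal inequality: `⟨A∇(f∘ρ), ∇(f∘ρ)⟩ ≤ f'(ρ)² W`.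
  · filter_upwards [ae_diff_agmonEDist_le hν hA hW hWpos hWb o] with x ⟨ξ, hξ, hle⟩
    have hd : diff n (fun x => f (ρ x)) x = deriv f (ρ x) • ξ := by
      have h2 := ((hf.differentiable one_ne_zero (ρ x)).hasFDerivAt.hasMFDerivAt.comp x hξ).mfderiv
      have h3 : diff n (fun x => f (ρ x)) x = (fderiv ℝ f (ρ x)).comp ξ := h2
      rw [h3]
      ext t
      have h4 : fderiv ℝ f (ρ x) (ξ t) = ξ t • fderiv ℝ f (ρ x) 1 := by
        rw [← map_smul, smul_eq_mul, mul_one]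
      exact h4.trans (mul_comm _ _)
    rw [hd]
    simp only [map_smul, _root_.smul_apply, smul_eq_mul]
    calc φ x ^ 2 * (deriv f (ρ x) * (deriv f (ρ x) * ξ (A x ξ))) =
          φ x ^ 2 * deriv f (ρ x) ^ 2 * ξ (A x ξ) := by ring
      _ ≤ φ x ^ 2 * deriv f (ρ x) ^ 2 * W x := by gcongr
      _ = _ := by ring

end Radial

/-! ### From the exponential rate of the volume to the bound. -/

section Rate

theorem le_ofReal_exp_of_inv_mul_log_lt {r s : ℝ} (hr : 0 < r) {V : ℝ≥0∞}
    (h : ((r⁻¹ : ℝ) : EReal) * ENNReal.log V < (s : EReal)) :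
    V ≤ ENNReal.ofReal (Real.exp (s * r)) := by
  have h1 : ENNReal.log V ≤ ((s * r : ℝ) : EReal) := by
    induction hL : ENNReal.log V using EReal.rec with
    | bot => exact bot_le
    | top =>
      rw [hL, EReal.coe_mul_top_of_pos (inv_pos.2 hr)] at h
      exact absurd h not_top_lt
    | coe a =>
      rw [hL, ← EReal.coe_mul, EReal.coe_lt_coe_iff] at h
      rw [EReal.coe_le_coe_iff]
      calc a = r⁻¹ * a * r := by field_simp
        _ ≤ s * r := by gcongr
  rw [← EReal.exp_coe, ← ENNReal.exp_log V]
  exact EReal.exp_monotone h1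

variable {n : ℕ} {M : Type*} [TopologicalSpace M] [ChartedSpace (Eucl n) M]
  [IsManifold (𝓡 n) ∞ M] [T2Space M] [SecondCountableTopology M] [ConnectedSpace M]
  [MeasurableSpace M] [BorelSpace M] {A : CoeffField n M} {W : M → ℝ}

/-- If the one-dimensional Hardy inequality holds for the distribution of the Agmon distance, then
its constant is bounded in terms of the exponential rate of the volume. -/
theorem le_sq_div_four_of_expRate (hA : IsEllipticField n A) (hWb : LocallyBounded W)
    (hcomplete : AgmonComplete A W) (o : M) {μ : Measure M}
    (hμ : ∀ L, IsCompact L → μ L < ⊤) {α R₀ σ : ℝ}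
    (h : ∀ f : ℝ → ℝ, ContDiff ℝ 1 f → HasCompactSupport f → tsupport f ⊆ Ioi R₀ →
      α * ∫ t, f t ^ 2 ∂(μ.map (agmonDist A W o)) ≤ ∫ t, deriv f t ^ 2 ∂(μ.map (agmonDist A W o)))
    (hσ : expRate A W μ o = (σ : EReal)) : α ≤ σ ^ 2 / 4 := by
  have hm : Measurable (agmonDist A W o) := (continuous_agmonDist hA hWb o).measurable
  by_contra! hlt
  have hα : 0 < α := (by positivity : (0 : ℝ) ≤ σ ^ 2 / 4).trans_lt hlt
  have h1 : |σ| < 2 * √α := by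
    refine abs_lt_of_sq_lt_sq ?_ (by positivity)
    rw [mul_pow, Real.sq_sqrt hα.le]
    linarith
  -- `s'` lies above the limsup and bounds the volume for large `r`; the gap `s' < s` gives the
  -- exponential gain in Brooks' argument, and `s < 2√α` leaves `s²/4 < α` to be contradicted.
  obtain ⟨s', h2, h3⟩ := exists_between h1
  obtain ⟨s, h4, h5⟩ := exists_between h3
  have hs : 0 < s := ((abs_nonneg σ).trans_lt h2).trans h4
  have hsα : s ^ 2 / 4 < α := by
    have : s ^ 2 < (2 * √α) ^ 2 := by gcongr
    rw [mul_pow, Real.sq_sqrt hα.le] at this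
    linarith
  have hlim : limsup (fun r : ℝ => ((r⁻¹ : ℝ) : EReal) * ENNReal.log (volumeFunction A W μ o r))
      atTop < (s' : EReal) := by
    change expRate A W μ o < _
    rw [hσ, EReal.coe_lt_coe_iff]
    exact (le_abs_self σ).trans_lt h2
  have hV : ∀ᶠ r : ℝ in atTop,
      volumeFunction A W μ o r ≤ ENNReal.ofReal (Real.exp (s' * r)) := by
    filter_upwards [eventually_lt_of_limsup_lt hlim, eventually_gt_atTop 0] with r hr hr0
    exact le_ofReal_exp_of_inv_mul_log_lt hr0 hr
  have huniv : μ.map (agmonDist A W o) univ = μ univ := by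
    rw [Measure.map_apply hm MeasurableSet.univ, preimage_univ]
  refine hsα.not_ge ?_
  by_cases hfin : μ univ = ⊤
  · refine le_sq_div_four_of_measure_univ_eq_top hs h4 (fun r => ?_) (huniv.trans hfin) ?_ h
    · rw [Measure.map_apply hm measurableSet_Iic]
      exact hμ _ (isCompact_agmonDist_le hA hWb hcomplete o r)
    · filter_upwards [hV] with r hr
      rwa [volumeFunction, if_pos hfin, agmonBall_eq hA hWb,
        ← Measure.map_apply hm measurableSet_Iio] at hr
  · refine le_sq_div_four_of_measure_univ_ne_top hs h4 (huniv.trans_ne hfin) ?_ h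
    filter_upwards [hV] with r hr
    -- For finite mass, `V(r) ≤ e^{s'r}` is a lower bound `e^{-s'r}` for the mass of `[r, ∞)`.
    rw [volumeFunction, if_neg hfin, agmonBall_eq hA hWb, ← preimage_compl, compl_Iio,
      ← Measure.map_apply hm measurableSet_Ici, ENNReal.inv_le_iff_inv_le] at hr
    rwa [Real.exp_neg, ENNReal.ofReal_inv_of_pos (Real.exp_pos _)]

end Rate

end AgmonBrooks

end

/-! ### The theorem. -/

theorem theorem5p2 (n : ℕ) (hn : 2 ≤ n)
    {M : Type*} [TopologicalSpace M] [T2Space M] [SecondCountableTopology M] [ConnectedSpace M]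
    [ChartedSpace (AgmonBrooks.Eucl n) M] [IsManifold (𝓡 n) ∞ M]
    [MeasurableSpace M] [BorelSpace M]
    (ν : Measure M) (hν : AgmonBrooks.HasLocallyBoundedDensity n ν)
    (A : AgmonBrooks.CoeffField n M) (hA : AgmonBrooks.IsEllipticField n A)
    (c : M → ℝ) (hc : Measurable c) (hcb : AgmonBrooks.LocallyBounded c)
    (W : M → ℝ) (hW : Measurable W) (hWpos : ∀ x, 0 < W x) (hWb : AgmonBrooks.LocallyBounded W)
    (lam : ℝ) (hlam : 0 < lam) (hHardy : AgmonBrooks.HardyInequality n ν A c W lam)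
    (φ : M → ℝ) (hφpos : ∀ᵐ x ∂ν, 0 < φ x) (hφ : AgmonBrooks.IsWeakSolution n ν A c φ)
    (hcomplete : AgmonBrooks.AgmonComplete A W) (x₀ : M) :
    (AgmonBrooks.bestConstAtInfinity n ν A c W : EReal) ≤
      AgmonBrooks.expRate A W (AgmonBrooks.groundMeasure ν W φ) x₀ ^ 2 / 4 := by
  obtain ⟨G, hG, hweak⟩ := hφ
  have h4 : (4 : EReal) ≠ ⊤ := EReal.coe_ne_top 4
  induction hσ : AgmonBrooks.expRate A W (AgmonBrooks.groundMeasure ν W φ) x₀ using EReal.rec with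
  | bot =>
    -- In `EReal` the square of `⊥` is `⊤`, so the bound is trivial here, as it is for `⊤`.
    rw [sq, EReal.bot_mul_bot, EReal.top_div_of_pos_ne_top (by norm_num) h4]
    exact le_top
  | top =>
    rw [sq, EReal.top_mul_top, EReal.top_div_of_pos_ne_top (by norm_num) h4]
    exact le_top
  | coe σ =>
    have h1 : AgmonBrooks.bestConstAtInfinity n ν A c W ≤ ENNReal.ofReal (σ ^ 2 / 4) := by
      refine sSup_le ?_
      rintro _ ⟨α, rfl, K, hK, hardy⟩
      -- The distance is bounded by `R₀` on `K`, so functions of it supported in `(R₀, ∞)` live off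
      -- `K`.
      obtain ⟨R₀, hR₀⟩ := hK.bddAbove_image
        (AgmonBrooks.continuous_agmonDist hA hWb x₀).continuousOn
      rw [← ENNReal.ofReal_coe_nnreal]
      refine ENNReal.ofReal_le_ofReal (AgmonBrooks.le_sq_div_four_of_expRate hA hWb hcomplete x₀
        (fun L hL => AgmonBrooks.groundMeasure_lt_top hν hA hG hW hWb hL) (R₀ := R₀)
        (fun f hf hfc hfR => ?_) hσ)
      exact AgmonBrooks.integral_map_agmonDist_le hν hA hc hcb hW hWpos hWb hG hweak hcomplete x₀
        hK hardy (fun x hx => hR₀ (mem_image_of_mem _ hx)) hf hfc hfR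
    refine (EReal.coe_ennreal_le_coe_ennreal_iff.2 h1).trans_eq ?_
    rw [EReal.coe_ennreal_ofReal, max_eq_left (by positivity), EReal.coe_div, EReal.coe_pow]
    rfl
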